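/- Let $d\ge 1$ and endow $\mathbb{R}^d$ with the supremum norm; $B(x,r)$ denotes the closed ball, $|I|$ the diameter of $I$, $\|m\|$ the total mass of a finite measure $m$, and $\dim$ the Hausdorff dimension. Fix an integer $c\ge 2$. For $j\ge 0$ and $\mathbf{k}\in\{0,\dots,c^j-1\}^d$ let $I_{j,\mathbf{k}}=\prod_{i=1}^d[k_ic^{-j},(k_i+1)c^{-j})$ be the $c$-adic boxes of $[0,1)^d$ (so $|I_{j,\mathbf k}|=c^{-j}$), and let $\mathbf{k}_{j,y}$ be the index of the box of generation $j$ that contains $y$. **Multinomial measures.** Let $\mu$ be a multinomial measure on $[0,1]^d$: for some integer $b\ge2$ and some positive weights $(p_a)_{a\in\{0,\dots,b-1\}^d}$ with $\sum_a p_a=1$, $\mu$ is the Borel probability measure that gives to the $b$-adic box with digits $a_1,\dots,a_j\in\{0,\dots,b-1\}^d$ the mass $p_{a_1}\cdots p_{a_j}$, for every $j\ge 0$. Put $$\tau_\mu(q)=\liminf_{j\to\infty}-\frac1j\log_c\sum_{\mathbf{k}\in\{0,\dots,c^j-1\}^d}\mu(I_{j,\mathbf{k}})^q\quad(q\in\mathbb{R}),\qquad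 \tau_\mu^*(\alpha)=\inf_{q\in\mathbb{R}}\big(\alpha q-\tau_\mu(q)\big).$$ ($\tau_\mu$ does not depend on $c$.) **Systems.** Let $(x_n)$ be a sequence in $[0,1]^d$ and $(\lambda_n)$ a non-increasing sequence of positive numbers converging to $0$. The system $\{(x_n,\lambda_n)\}$ is *weakly redundant* if there are integers $N_j$ with $\lim_{j\to\infty}(\log N_j)/j=0$ such that, for every $j\ge1$, $T_j=\{n:2^{-(j+1)}<\lambda_n\le2^{-j}\}$ is the union of $N_j$ pairwise disjoint sets $T_{j,i}$ such that, for each $i$, the balls $B(x_n,\lambda_n)$, $n\in T_{j,i}$, are pairwise disjoint. Let $\rho\in(0,1)$, $\alpha>0$, $\beta\in(0,d]$. The system is *$\rho$-heterogeneous ubiquitous with respect to* $(\mu,\alpha,\beta)$ if there are functions $\varphi,\psi,\chi$ on $[0,\infty)$, a finite Borel measure $m$ with support $[0,1]^d$, and finite measures $m^L$ on $L$, for every $c$-adic box $L$ of $[0,1)^d$, such that: (1) $\varphi,\psi,\chi$ are non-decreasing, continuous, vanish at $0$, and $r^{-\varphi(r)}$, $r^{-\psi(r)}$, $r^{-\chi(r)}$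 are non-increasing functions of $r$ near $0^+$; $r^{-\varphi(r)}\to+\infty$ and $r^{-\chi(r)}\to+\infty$ as $r\to0^+$; for all $\epsilon,\theta,\gamma>0$, $r^{\epsilon-\varphi(r)}$ and $r^{\epsilon-\theta\varphi(r)-\gamma\chi(r)}$ are non-decreasing functions of $r$ near $0^+$. (2) For $m$-almost every $y$ there are infinitely many integers $j$ such that the ball $B(y,c^{-\rho j})$ contains at least $c^{\,j(d(1-\rho)-\chi(c^{-j}))}$ points $x_n$ whose couples $(x_n,\lambda_n)$ satisfy $\lambda_n\in[c^{-j+1},c^{-j(1-\chi(c^{-j}))}]$ and have pairwise disjoint balls $B(x_n,\lambda_n)$. Moreover, for $m$-almost every $y$ there is $j(y)$ such that, for all $j\ge j(y)$ and all $\mathbf{k}\in\{0,\dots,c^j-1\}^d$ with $\|\mathbf{k}-\mathbf{k}_{j,y}\|_\infty\le1$, the box $I=I_{j,\mathbf{k}}$ satisfies $$|I|^{\alpha+\psi(|I|)}\le\mu(I)\le|I|^{\alpha-\psi(|I|)}\quad\text{and}\quad (\ast)\ \ m(I)\le|I|^{\beta-\varphi(|I|)}.$$ (3) For every $L$, $m^L$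 and the restriction $m_{|L}$ are mutually absolutely continuous, and, if $f_L$ denotes the canonical affine map of $L$ onto $[0,1)^d$, the measure $m^L\circ f_L^{-1}$ has property $(\ast)$ of $m$: for almost every $y$ with respect to it, $(\ast)$ holds with $m$ replaced by it, at all large generations, for the box of $y$ and its neighbours. (4') For $n\ge1$ let $E_n^L$ be the set of the $x\in L$ such that $m^L(I_{j,\mathbf{k}})\le\big(|I_{j,\mathbf{k}}|/|L|\big)^{\beta-\varphi(|I_{j,\mathbf{k}}|/|L|)}$ for all $j\ge n+\log_c(|L|^{-1})$ and all $\mathbf{k}\in\{0,\dots,c^j-1\}^d$ with $\|\mathbf{k}-\mathbf{k}_{j,x}\|_\infty\le1$, and let $n_L=\inf\{n\ge1:m^L(E_n^L)\ge\|m^L\|/2\}$. There is $J_m$ such that for every $c$-adic box $L$ of generation at least $J_m$, $$n_L\le\log_c(|L|^{-1})\,\varphi(|L|)\quad\text{and}\quad|L|^{\varphi(|L|)}\le\|m^L\|.$$ **Theorem.** Let $\mu$ be a multinomial measure on $[0,1]^d$, $\rho\in(0,1)$, and let $\alpha>0$ be such that $\tau_\mu^*(\alpha)>0$. Suppose that $\{(x_n,\lambda_n)\}$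 is weakly redundant and $\rho$-heterogeneous ubiquitous with respect to $(\mu,\alpha,\tau_\mu^*(\alpha))$. Then there is a sequence $\varepsilon=(\varepsilon_n)$ of positive numbers converging to $0$ such that, for all $\delta\ge1$, the set $$S_\mu(\rho,\delta,\alpha,\varepsilon)=\bigcap_{N}\ \bigcup_{n\ge N:\ \lambda_n^{\rho(\alpha+\varepsilon_n)}\le\mu(B(x_n,\lambda_n^\rho))\le\lambda_n^{\rho(\alpha-\varepsilon_n)}}B(x_n,\lambda_n^\delta)$$ satisfies $$\dim S_\mu(\rho,\delta,\alpha,\varepsilon)=\min\Big(\frac{d(1-\rho)+\rho\,\tau_\mu^*(\alpha)}{\delta},\ \tau_\mu^*(\alpha)\Big).$$ -/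

import Mathlib

open Set Filter Topology MeasureTheory

namespace HetUbiquity

noncomputable section

/-! Everything takes place in `Fin d → ℝ`, which carries the supremum norm. All balls are closed. -/

/-! ### `c`-adic boxes -/

/-- The `c`-adic box of generation `j` and index `k`,
`∏ i, [k i * c ^ (-j), (k i + 1) * c ^ (-j))`. -/
def cadicBox {d : ℕ} (c j : ℕ) (k : Fin d → ℕ) : Set (Fin d → ℝ) :=
  {x | ∀ i, (k i : ℝ) / (c : ℝ) ^ j ≤ x i ∧ x i < ((k i : ℝ) + 1) / (c : ℝ) ^ j}

/-- `k ∈ {0, …, c ^ j - 1} ^ d`, that is, the box of generation `j` and index `k` lies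
in `[0,1)^d`. -/
def IsIndex {d : ℕ} (c j : ℕ) (k : Fin d → ℕ) : Prop := ∀ i, k i < c ^ j

/-- The index of the `c`-adic box of generation `j` that contains `x ∈ [0,1)^d`. -/
def indexOf {d : ℕ} (c j : ℕ) (x : Fin d → ℝ) : Fin d → ℕ := fun i => ⌊(c : ℝ) ^ j * x i⌋₊

/-- `‖k - k'‖_∞ ≤ 1`. -/
def AreNeighbours {d : ℕ} (k k' : Fin d → ℕ) : Prop := ∀ i, |(k i : ℤ) - (k' i : ℤ)| ≤ 1

/-- The length `c ^ (-j)` of the sides of the `c`-adic boxes of generation `j`, which is their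
diameter for the supremum norm. -/
def side (c j : ℕ) : ℝ := ((c : ℝ) ^ j)⁻¹

/-- The canonical affine map of the box of generation `j` and index `k` onto `[0,1)^d`. -/
def boxChart {d : ℕ} (c j : ℕ) (k : Fin d → ℕ) (x : Fin d → ℝ) : Fin d → ℝ :=
  fun i => (c : ℝ) ^ j * x i - (k i : ℝ)

/-! ### Multinomial measures -/

/-- `μ` is a multinomial measure on `[0,1]^d`: for some base `b ≥ 2` and some probability vector
with positive components indexed by the digits `a ∈ {0, …, b - 1} ^ d`, `μ` is the probability
measure that gives to each `b`-adic box of generation `j` the product of the weights of the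
`j` digits of its index. -/
def IsMultinomial {d : ℕ} (μ : Measure (Fin d → ℝ)) : Prop :=
  ∃ (b : ℕ) (p : (Fin d → Fin b) → ℝ), 2 ≤ b ∧ (∀ a, 0 < p a) ∧ ∑ a, p a = 1 ∧
    μ univ = 1 ∧
    ∀ (j : ℕ) (w : Fin j → Fin d → Fin b),
      μ (cadicBox b j fun i => ∑ s : Fin j, (w s i : ℕ) * b ^ (s : ℕ)) =
        ENNReal.ofReal (∏ s, p (w s))

/-! ### The function `τ_μ` and its Legendre transform -/

/-- `τ_μ (q) = liminf_j - j⁻¹ log_c ∑_k μ (I_{j,k}) ^ q`. -/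
def tau {d : ℕ} (c : ℕ) (μ : Measure (Fin d → ℝ)) (q : ℝ) : EReal :=
  liminf (fun j : ℕ =>
    ((-(j : ℝ)⁻¹ * Real.logb c
      (∑ k ∈ Fintype.piFinset (fun _ : Fin d => Finset.range (c ^ j)),
        (μ.real (cadicBox c j k)) ^ q) : ℝ) : EReal)) atTop

/-- The Legendre transform `τ^* (α) = inf_q (α q - τ (q))`. -/
def legendre (τ : ℝ → EReal) (α : ℝ) : EReal := ⨅ q : ℝ, ((α * q : ℝ) : EReal) - τ q

/-! ### Weakly redundant systems -/

/-- `T_j = {n : 2 ^ (-(j+1)) < λ_n ≤ 2 ^ (-j)}`. -/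
def scaleSet (lam : ℕ → ℝ) (j : ℕ) : Set ℕ :=
  {n | ((2 : ℝ) ^ (j + 1))⁻¹ < lam n ∧ lam n ≤ ((2 : ℝ) ^ j)⁻¹}

def IsWeaklyRedundant {d : ℕ} (x : ℕ → Fin d → ℝ) (lam : ℕ → ℝ) : Prop :=
  ∃ N : ℕ → ℕ,
    Tendsto (fun j : ℕ => Real.log (N j) / (j : ℝ)) atTop (𝓝 0) ∧
    ∀ j, 1 ≤ j → ∃ T : Fin (N j) → Set ℕ,
      (⋃ i, T i) = scaleSet lam j ∧
      Pairwise (fun i i' => Disjoint (T i) (T i')) ∧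
      ∀ i, (T i).PairwiseDisjoint fun n => Metric.closedBall (x n) (lam n)

/-! ### `ρ`-heterogeneous ubiquitous systems, `ρ < 1` -/

/-- A non-decreasing continuous function `f` on `[0, ∞)` such that `f 0 = 0` and
`r ↦ r ^ (-f r)` is non-increasing near `0⁺`. -/
structure IsCorrection (f : ℝ → ℝ) : Prop where
  monotone : MonotoneOn f (Ici 0)
  continuous : ContinuousOn f (Ici 0)
  zero : f 0 = 0
  antitone_near : ∃ r₀ > 0, AntitoneOn (fun r : ℝ => r ^ (-f r)) (Ioo 0 r₀)

/-- Condition (1) on the pair `(φ, ψ)`. -/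
structure IsCorrectionPair (φ ψ : ℝ → ℝ) : Prop where
  left : IsCorrection φ
  right : IsCorrection ψ
  tendsto : Tendsto (fun r : ℝ => r ^ (-φ r)) (𝓝[>] 0) atTop
  monotone_near : ∀ ε > 0, ∃ r₀ > 0, MonotoneOn (fun r : ℝ => r ^ (ε - φ r)) (Ioo 0 r₀)

/-- The condition on `χ` in (2(ρ)). -/
structure IsDilationCorrection (φ χ : ℝ → ℝ) : Prop where
  correction : IsCorrection χ
  tendsto : Tendsto (fun r : ℝ => r ^ (-χ r)) (𝓝[>] 0) atTop
  monotone_near : ∀ ε > 0, ∀ θ > 0, ∀ γ > 0, ∃ r₀ > 0,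
    MonotoneOn (fun r : ℝ => r ^ (ε - θ * φ r - γ * χ r)) (Ioo 0 r₀)

/-- For `m`-almost every `y`, at all large generations, the box that contains `y` and its
neighbours `I` satisfy `|I| ^ (α + ψ |I|) ≤ μ I ≤ |I| ^ (α - ψ |I|)`. -/
def HasLocalExponent {d : ℕ} (c : ℕ) (μ m : Measure (Fin d → ℝ)) (α : ℝ) (ψ : ℝ → ℝ) : Prop :=
  ∀ᵐ y ∂m, ∃ j₀ : ℕ, ∀ j ≥ j₀, ∀ k : Fin d → ℕ, IsIndex c j k →
    AreNeighbours k (indexOf c j y) →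
      side c j ^ (α + ψ (side c j)) ≤ μ.real (cadicBox c j k) ∧
      μ.real (cadicBox c j k) ≤ side c j ^ (α - ψ (side c j))

/-- For `m`-almost every `y`, at all large generations, the box that contains `y` and its
neighbours `I` satisfy `m I ≤ |I| ^ (β - φ |I|)`. -/
def HasLocalMassBound {d : ℕ} (c : ℕ) (m : Measure (Fin d → ℝ)) (β : ℝ) (φ : ℝ → ℝ) : Prop :=
  ∀ᵐ y ∂m, ∃ j₀ : ℕ, ∀ j ≥ j₀, ∀ k : Fin d → ℕ, IsIndex c j k →
    AreNeighbours k (indexOf c j y) →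
      m.real (cadicBox c j k) ≤ side c j ^ (β - φ (side c j))

/-- The ball `B(y, c ^ (-ρ j))` contains at least `c ^ (j (d (1 - ρ) - χ (c ^ (-j))))` points `x_n`
such that `λ_n ∈ [c ^ (-j + 1), c ^ (-j (1 - χ (c ^ (-j))))]` and the balls `B(x_n, λ_n)` attached
to these points are pairwise disjoint (so that the points are distinct). -/
def HasManyDisjointPairs {d : ℕ} (c : ℕ) (x : ℕ → Fin d → ℝ) (lam : ℕ → ℝ) (ρ : ℝ) (χ : ℝ → ℝ)
    (y : Fin d → ℝ) (j : ℕ) : Prop :=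
  ∃ F : Finset ℕ,
    (c : ℝ) ^ ((j : ℝ) * ((d : ℝ) * (1 - ρ) - χ (side c j))) ≤ (F.card : ℝ) ∧
    (∀ n ∈ F, x n ∈ Metric.closedBall y ((c : ℝ) ^ (-(ρ * (j : ℝ)))) ∧
      (c : ℝ) ^ (-(j : ℝ) + 1) ≤ lam n ∧
      lam n ≤ (c : ℝ) ^ (-((j : ℝ) * (1 - χ (side c j))))) ∧
    (F : Set ℕ).PairwiseDisjoint fun n => Metric.closedBall (x n) (lam n)

/-- The set `E_n^L`, for `L` the box of generation `J` and index `K` and `mL` a measure on `L`;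
here `log_c (|L|⁻¹) = J`. -/
def goodSet {d : ℕ} (c : ℕ) (β : ℝ) (φ : ℝ → ℝ) (J : ℕ) (K : Fin d → ℕ)
    (mL : Measure (Fin d → ℝ)) (n : ℕ) : Set (Fin d → ℝ) :=
  {z | z ∈ cadicBox c J K ∧ ∀ j : ℕ, n + J ≤ j → ∀ k : Fin d → ℕ, IsIndex c j k →
    AreNeighbours k (indexOf c j z) →
      mL.real (cadicBox c j k) ≤
        (side c j / side c J) ^ (β - φ (side c j / side c J))}

/-- `n_L = inf {n ≥ 1 : m^L (E_n^L) ≥ ‖m^L‖ / 2}`. The set is non-empty as soon as the image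
of `m^L` under the canonical map of `L` onto `[0,1)^d` has the local mass bound. -/
def growthIndex {d : ℕ} (c : ℕ) (β : ℝ) (φ : ℝ → ℝ) (J : ℕ) (K : Fin d → ℕ)
    (mL : Measure (Fin d → ℝ)) : ℕ :=
  sInf {n | 1 ≤ n ∧ mL.real univ / 2 ≤ mL.real (goodSet c β φ J K mL n)}

/-- `{(x_n, λ_n)}` is a `ρ`-heterogeneous ubiquitous system with respect to `(μ, α, β)`, in the
case `ρ < 1`, for the `c`-adic grid. The measure `mL J K` is the measure `m^L` on the box `L` of
generation `J` and index `K`. -/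
def IsHeterogeneousUbiquitous {d : ℕ} (c : ℕ) (x : ℕ → Fin d → ℝ) (lam : ℕ → ℝ) (ρ : ℝ)
    (μ : Measure (Fin d → ℝ)) (α β : ℝ) : Prop :=
  ∃ (φ ψ χ : ℝ → ℝ) (m : Measure (Fin d → ℝ)) (mL : ℕ → (Fin d → ℕ) → Measure (Fin d → ℝ)),
    -- (1)
    IsCorrectionPair φ ψ ∧
    -- (2(ρ))
    IsFiniteMeasure m ∧ m.support = Icc 0 1 ∧
    IsDilationCorrection φ χ ∧
    (∀ᵐ y ∂m, {j : ℕ | HasManyDisjointPairs c x lam ρ χ y j}.Infinite) ∧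
    HasLocalExponent c μ m α ψ ∧
    HasLocalMassBound c m β φ ∧
    -- (3)
    (∀ (J : ℕ) (K : Fin d → ℕ), IsIndex c J K →
      IsFiniteMeasure (mL J K) ∧
      mL J K ≪ m.restrict (cadicBox c J K) ∧ m.restrict (cadicBox c J K) ≪ mL J K ∧
      HasLocalMassBound c ((mL J K).map (boxChart c J K)) β φ) ∧
    -- (4')
    ∃ Jm : ℕ, ∀ J ≥ Jm, ∀ K : Fin d → ℕ, IsIndex c J K →
      (growthIndex c β φ J K (mL J K) : ℝ) ≤ (J : ℝ) * φ (side c J) ∧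
      side c J ^ φ (side c J) ≤ (mL J K).real univ

/-! ### The limsup set -/

/-- `S_μ(ρ, δ, α, ε)`. -/
def condLimsupSet {d : ℕ} (μ : Measure (Fin d → ℝ)) (x : ℕ → Fin d → ℝ) (lam : ℕ → ℝ)
    (ρ δ α : ℝ) (ε : ℕ → ℝ) : Set (Fin d → ℝ) :=
  ⋂ N : ℕ, ⋃ n ∈ {n : ℕ | N ≤ n ∧
      lam n ^ (ρ * (α + ε n)) ≤ μ.real (Metric.closedBall (x n) (lam n ^ ρ)) ∧
      μ.real (Metric.closedBall (x n) (lam n ^ ρ)) ≤ lam n ^ (ρ * (α - ε n))},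
    Metric.closedBall (x n) (lam n ^ δ)

end

end HetUbiquity

namespace HetUbiquity

open scoped ENNReal NNReal

variable {d : ℕ} {c : ℕ}

/-! ### Geometry of the `c`-adic boxes -/

/-! Write `β` for the value of the Legendre transform at `α`. The two inequalities are independent
of each other. The sequence `ε` is fixed by the lower bound, while the upper bound holds for every
positive sequence converging to `0`; hence one `ε` serves all `δ`.

Upper bound. Since `β` is an infimum over `q`, some `q` satisfies `∑ μ(I)^q ≤ |I|^(αq - β - η)` at
all large generations (`exists_sum_rpow_le`). A ball of radius `λ_n^ρ` with exponent close to `α`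
forces a nearby box `I` of comparable size with `μ(I)^q` at least about `|I|^(αq)`, whatever the
sign of `q` (`exists_box_rpow_le`). Markov's inequality then leaves about `2^(jρβ)` places of size
`2^(-jρ)` for the selected points with `λ_n` of order `2^(-j)` (`exists_cover_scaleSet`). Covering
by these places gives the bound `β`. By weak redundancy and a volume count, each place contains
about `2^(jd(1-ρ))` of the points, up to a subexponential factor, and covering by the balls `B(x_n,
λ_n^δ)` themselves gives the other bound.

Lower bound. The limsup set contains an intersection of open sets `G N`, each a union of open balls.
Mass redistribution, `le_dimH_iInter`, reduces the claim to one estimate: every box of large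
generation `g` carries a probability measure with bounded density, concentrated on a compact part of
`G N`, whose mass on smaller boxes `I` is at most `C |I|^s c^(gt)` for some `t < d`. The bounded
density of the measure from the previous step gives mass `O(c^(-gd))` to the box, which beats
`c^(gt)`; so the estimate `ν(I) ≤ |I|^s` is passed on with constant `1`. No limit measure is taken:
compactness turns a countable cover of the limit set into a cover of one of the stages.

The measure on a box comes from `exists_measure_near`. Condition (4') gives a normalized version of
`m^L` with a power law of exponent just below `β` around the points of a good set
(`eventually_exists_normalized`). Near almost every good point, ubiquity at a scale `j` provides
about `c^(jd(1-ρ))` separated points `x_n` within distance `c^(-ρj)`. The mass of a box of side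
about `c^(-ρj)`, namely `c^(-jρβ)`, is shared equally among balls of radius `c^(-jδ)` around these
points. Each receives about `c^(-j(d(1-ρ) + ρβ))`, and this is the origin of the quotient by `δ`.
The local exponents of `μ` at the good point transfer to the balls of radius `λ_n^ρ`
(`eventually_hasBallExponent`), so these `x_n` satisfy the condition that defines the limsup set. -/

lemma side_pos (hc : 2 ≤ c) (j : ℕ) : 0 < side c j := by
  unfold side; positivity

lemma side_le_one (hc : 2 ≤ c) (j : ℕ) : side c j ≤ 1 := by
  unfold side
  exact inv_le_one_of_one_le₀ (one_le_pow₀ (by exact_mod_cast (by omega : 1 ≤ c)))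

lemma side_zero : side c 0 = 1 := by simp [side]

lemma side_add (i j : ℕ) : side c (i + j) = side c i * side c j := by
  simp [side, pow_add, mul_comm]

lemma side_anti (hc : 2 ≤ c) : Antitone (side c) := by
  intro i j hij
  obtain ⟨l, rfl⟩ := Nat.exists_eq_add_of_le hij
  rw [side_add]
  exact mul_le_of_le_one_right (side_pos hc i).le (side_le_one hc l)

lemma side_eq_rpow (j : ℕ) : side c j = (c : ℝ) ^ (-(j : ℝ)) := by
  rw [side, Real.rpow_neg (by positivity), Real.rpow_natCast]

lemma side_rpow (j : ℕ) (s : ℝ) : side c j ^ s = (c : ℝ) ^ (-(j * s)) := by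
  rw [side_eq_rpow, ← Real.rpow_mul (by positivity), neg_mul]

lemma tendsto_side (hc : 2 ≤ c) : Tendsto (side c) atTop (𝓝 0) := by
  have h : side c = fun j => ((c : ℝ)⁻¹) ^ j := by funext j; simp [side]
  rw [h]
  apply tendsto_pow_atTop_nhds_zero_of_lt_one (by positivity)
  exact inv_lt_one_of_one_lt₀ (by exact_mod_cast (by omega : 1 < c))

lemma mem_cadicBox_iff (hc : 2 ≤ c) {j : ℕ} {k : Fin d → ℕ} {x : Fin d → ℝ} :
    x ∈ cadicBox c j k ↔ (∀ i, 0 ≤ x i) ∧ indexOf c j x = k := by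
  have hp : (0 : ℝ) < (c : ℝ) ^ j := by positivity
  constructor
  · intro h
    have h0 : ∀ i, 0 ≤ x i := fun i => le_trans (by positivity) (h i).1
    refine ⟨h0, funext fun i => ?_⟩
    rw [indexOf, Nat.floor_eq_iff (mul_nonneg hp.le (h0 i))]
    have := h i
    rw [div_le_iff₀ hp, lt_div_iff₀ hp] at this
    constructor <;> linarith [this.1, this.2]
  · rintro ⟨h0, rfl⟩ i
    rw [div_le_iff₀ hp, lt_div_iff₀ hp, mul_comm]
    exact ⟨Nat.floor_le (mul_nonneg hp.le (h0 i)), Nat.lt_floor_add_one _⟩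

lemma mem_cadicBox_indexOf (hc : 2 ≤ c) (j : ℕ) {x : Fin d → ℝ} (hx : ∀ i, 0 ≤ x i) :
    x ∈ cadicBox c j (indexOf c j x) := (mem_cadicBox_iff hc).2 ⟨hx, rfl⟩

lemma cadicBox_eq_pi (j : ℕ) (k : Fin d → ℕ) : cadicBox c j k =
    Set.pi univ fun i => Ico ((k i : ℝ) / (c : ℝ) ^ j) (((k i : ℝ) + 1) / (c : ℝ) ^ j) := by
  ext x; simp [cadicBox]

lemma measurableSet_cadicBox (j : ℕ) (k : Fin d → ℕ) : MeasurableSet (cadicBox c j k) := by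
  rw [cadicBox_eq_pi]
  exact MeasurableSet.univ_pi fun i => measurableSet_Ico

lemma volume_cadicBox (hc : 2 ≤ c) (j : ℕ) (k : Fin d → ℕ) :
    volume (cadicBox c j k) = ENNReal.ofReal (side c j ^ d) := by
  rw [cadicBox_eq_pi, Real.volume_pi_Ico]
  have : ∀ i, ((k i : ℝ) + 1) / (c : ℝ) ^ j - (k i : ℝ) / (c : ℝ) ^ j = side c j := by
    intro i; rw [side]; ring
  simp only [this, Finset.prod_const, Finset.card_univ, Fintype.card_fin]
  rw [ENNReal.ofReal_pow (side_pos hc j).le]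

lemma disjoint_cadicBox (hc : 2 ≤ c) {j : ℕ} {k k' : Fin d → ℕ} (h : k ≠ k') :
    Disjoint (cadicBox c j k) (cadicBox c j k') := by
  rw [Set.disjoint_left]
  intro x hx hx'
  rw [mem_cadicBox_iff hc] at hx hx'
  exact h (hx.2.symm.trans hx'.2)

/-- Passing to a coarser generation drops the last `l` base-`c` digits of the index. All nesting of
boxes is deduced from this arithmetic form. -/
lemma indexOf_add (hc : 2 ≤ c) (j l : ℕ) (x : Fin d → ℝ) :
    indexOf c j x = fun i => indexOf c (j + l) x i / c ^ l := by
  funext i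
  have := Nat.floor_div_natCast ((c : ℝ) ^ (j + l) * x i) (c ^ l)
  rw [indexOf, indexOf, ← this]
  congr 1
  have : (c : ℝ) ^ l ≠ 0 := by positivity
  push_cast
  field_simp
  ring

/-- The index of the box of generation `i` containing the box of index `k` of generation `j ≥ i`. -/
def ancestor (c i j : ℕ) (k : Fin d → ℕ) : Fin d → ℕ := fun l => k l / c ^ (j - i)

lemma ancestor_indexOf (hc : 2 ≤ c) {i j : ℕ} (hij : i ≤ j) (x : Fin d → ℝ) :
    ancestor c i j (indexOf c j x) = indexOf c i x := by
  rw [indexOf_add hc i (j - i) x, Nat.add_sub_cancel' hij]; rfl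

lemma cadicBox_subset_ancestor (hc : 2 ≤ c) {i j : ℕ} (hij : i ≤ j) (k : Fin d → ℕ) :
    cadicBox c j k ⊆ cadicBox c i (ancestor c i j k) := by
  intro x hx
  rw [mem_cadicBox_iff hc] at hx ⊢
  exact ⟨hx.1, by rw [← hx.2, ancestor_indexOf hc hij]⟩

lemma cadicBox_subset_of_mem (hc : 2 ≤ c) {i j : ℕ} (hij : i ≤ j) {k k' : Fin d → ℕ}
    {x : Fin d → ℝ} (hx : x ∈ cadicBox c i k) (hx' : x ∈ cadicBox c j k') :
    cadicBox c j k' ⊆ cadicBox c i k := by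
  rw [mem_cadicBox_iff hc] at hx hx'
  convert! cadicBox_subset_ancestor hc hij k'
  rw [← hx'.2, ancestor_indexOf hc hij, hx.2]

lemma cadicBox_zero : cadicBox c 0 (0 : Fin d → ℕ) = {x | ∀ i, 0 ≤ x i ∧ x i < 1} := by
  ext x; simp [cadicBox]

lemma isIndex_indexOf (hc : 2 ≤ c) (j : ℕ) {x : Fin d → ℝ}
    (hx : x ∈ cadicBox c 0 (0 : Fin d → ℕ)) : IsIndex c j (indexOf c j x) := by
  rw [cadicBox_zero] at hx
  intro i
  rw [indexOf, Nat.floor_lt (mul_nonneg (by positivity) (hx i).1)]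
  push_cast
  exact mul_lt_of_lt_one_right (by positivity) (hx i).2

lemma IsIndex.subset (hc : 2 ≤ c) {j : ℕ} {k : Fin d → ℕ} (hk : IsIndex c j k) :
    cadicBox c j k ⊆ cadicBox c 0 (0 : Fin d → ℕ) := by
  have h0 : ancestor c 0 j k = 0 := by
    funext i; simp only [ancestor, Nat.sub_zero, Pi.zero_apply]; exact Nat.div_eq_of_lt (hk i)
  have := cadicBox_subset_ancestor hc (Nat.zero_le j) k
  rwa [h0] at this

lemma isIndex_of_mem (hc : 2 ≤ c) {j : ℕ} {k : Fin d → ℕ} {x : Fin d → ℝ}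
    (hx : x ∈ cadicBox c 0 (0 : Fin d → ℕ)) (hx' : x ∈ cadicBox c j k) : IsIndex c j k := by
  rw [mem_cadicBox_iff hc] at hx'
  rw [← hx'.2]
  exact isIndex_indexOf hc j hx

/-- The finite set of the indices of generation `j`. -/
noncomputable def indices (d c j : ℕ) : Finset (Fin d → ℕ) :=
  Fintype.piFinset fun _ : Fin d => Finset.range (c ^ j)

lemma mem_indices {j : ℕ} {k : Fin d → ℕ} : k ∈ indices d c j ↔ IsIndex c j k := by
  simp [indices, IsIndex]

lemma cadicBox_zero_eq_biUnion (hc : 2 ≤ c) (j : ℕ) :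
    cadicBox c 0 (0 : Fin d → ℕ) = ⋃ k ∈ indices d c j, cadicBox c j k := by
  ext x
  simp only [mem_iUnion, exists_prop, mem_indices]
  constructor
  · intro hx
    exact ⟨_, isIndex_indexOf hc j hx,
      mem_cadicBox_indexOf hc j ((mem_cadicBox_iff hc).1 hx).1⟩
  · rintro ⟨k, hk, hx⟩
    exact hk.subset hc hx

lemma cadicBox_nonempty (hc : 2 ≤ c) (j : ℕ) (k : Fin d → ℕ) : (cadicBox c j k).Nonempty := by
  refine ⟨fun i => (k i : ℝ) / (c : ℝ) ^ j, fun i => ⟨le_rfl, ?_⟩⟩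
  have hp : (0 : ℝ) < (c : ℝ) ^ j := by positivity
  show (k i : ℝ) / (c : ℝ) ^ j < ((k i : ℝ) + 1) / (c : ℝ) ^ j
  rw [div_lt_div_iff_of_pos_right hp]
  linarith

lemma dist_le_side (hc : 2 ≤ c) {j : ℕ} {k : Fin d → ℕ} {x y : Fin d → ℝ}
    (hx : x ∈ cadicBox c j k) (hy : y ∈ cadicBox c j k) : dist x y ≤ side c j := by
  rw [dist_pi_le_iff (side_pos hc j).le]
  intro i
  have h1 := hx i
  have h2 := hy i
  have h3 : ((k i : ℝ) + 1) / (c : ℝ) ^ j = (k i : ℝ) / (c : ℝ) ^ j + side c j := by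
    rw [side]; ring
  rw [Real.dist_eq, abs_le]
  constructor <;> linarith [h1.1, h1.2, h2.1, h2.2]

/-- Points at distance at most `M` sides have indices at distance at most `M`. -/
lemma abs_indexOf_sub_le (hc : 2 ≤ c) {j M : ℕ} {x y : Fin d → ℝ} (hx : ∀ i, 0 ≤ x i)
    (hy : ∀ i, 0 ≤ y i) (h : dist x y ≤ M * side c j) (i : Fin d) :
    |(indexOf c j x i : ℤ) - indexOf c j y i| ≤ M := by
  have hp : (0 : ℝ) < (c : ℝ) ^ j := by positivity
  have key : ∀ u v : Fin d → ℝ, (∀ i, 0 ≤ u i) → (∀ i, 0 ≤ v i) → dist u v ≤ M * side c j →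
      indexOf c j u i ≤ indexOf c j v i + M := by
    intro u v hu hv huv
    have h1 : |u i - v i| ≤ M * side c j := (dist_le_pi_dist u v i).trans huv
    have h2 : u i ≤ v i + M * side c j := by linarith [(abs_le.1 h1).2]
    have h3 : (c : ℝ) ^ j * u i ≤ (c : ℝ) ^ j * v i + M := by
      have := mul_le_mul_of_nonneg_left h2 hp.le
      rw [side, mul_add] at this
      rwa [mul_comm (M : ℝ), mul_inv_cancel_left₀ hp.ne'] at this
    rw [indexOf, indexOf, ← Nat.floor_add_natCast (mul_nonneg hp.le (hv i))]
    exact Nat.floor_le_floor h3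
  have h1 := key x y hx hy h
  have h2 := key y x hy hx (by rwa [dist_comm])
  rw [abs_le]
  constructor <;> omega

lemma areNeighbours_indexOf (hc : 2 ≤ c) {j : ℕ} {x y : Fin d → ℝ} (hx : ∀ i, 0 ≤ x i)
    (hy : ∀ i, 0 ≤ y i) (h : dist x y ≤ side c j) :
    AreNeighbours (indexOf c j x) (indexOf c j y) := by
  intro i
  have := abs_indexOf_sub_le hc (M := 1) hx hy (by simpa using h) i
  simpa using this

/-- The indices at distance at most `M` from `k`. -/
noncomputable def nearIndices (M : ℕ) (k : Fin d → ℕ) : Finset (Fin d → ℕ) :=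
  Fintype.piFinset fun i => Finset.Icc (k i - M) (k i + M)

lemma mem_nearIndices {M : ℕ} {k k' : Fin d → ℕ} :
    k' ∈ nearIndices M k ↔ ∀ i, |(k' i : ℤ) - k i| ≤ M := by
  simp only [nearIndices, Fintype.mem_piFinset, Finset.mem_Icc]
  refine forall_congr' fun i => ?_
  rw [abs_le]
  omega

lemma card_nearIndices_le (M : ℕ) (k : Fin d → ℕ) :
    (nearIndices M k).card ≤ (2 * M + 1) ^ d := by
  rw [nearIndices, Fintype.card_piFinset]
  calc ∏ i, (Finset.Icc (k i - M) (k i + M)).card ≤ ∏ _i : Fin d, (2 * M + 1) := by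
        apply Finset.prod_le_prod' ; intro i _; rw [Nat.card_Icc]; omega
    _ = _ := by simp

/-! ### Redistribution of mass and lower bounds for the Hausdorff dimension -/

/-- A probability measure with bounded density on the unit cube, concentrated on a compact subset of
`O`, whose mass on the boxes is at most the power `s` of their sides. -/
structure IsSpread (c : ℕ) (s : ℝ) (ν : Measure (Fin d → ℝ)) (O : Set (Fin d → ℝ)) : Prop where
  univ_eq : ν univ = 1
  density : ∃ D : ℝ≥0, ν ≤ D • (volume : Measure (Fin d → ℝ))
  cube : ν (cadicBox c 0 (0 : Fin d → ℕ))ᶜ = 0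
  compact : ∃ A, IsCompact A ∧ A ⊆ O ∧ ν Aᶜ = 0
  box : ∀ i k, ν (cadicBox c i k) ≤ ENNReal.ofReal (side c i ^ s)

lemma isSpread_volume (hc : 2 ≤ c) {s : ℝ} (hsd : s ≤ d) :
    IsSpread c s (volume.restrict (cadicBox c 0 (0 : Fin d → ℕ))) univ where
  univ_eq := by simp [volume_cadicBox hc, side_zero]
  density := ⟨1, by rw [one_smul]; exact Measure.restrict_le_self⟩
  cube := by
    rw [Measure.restrict_apply (measurableSet_cadicBox _ _).compl]; simp
  compact := by
    refine ⟨Icc 0 1, isCompact_Icc, subset_univ _, ?_⟩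
    rw [Measure.restrict_apply isCompact_Icc.isClosed.measurableSet.compl]
    convert! measure_empty (μ := (volume : Measure (Fin d → ℝ)))
    rw [cadicBox_zero]
    rw [← disjoint_iff_inter_eq_empty, disjoint_compl_left_iff_subset]
    exact fun x hx => ⟨fun i => (hx i).1, fun i => (hx i).2.le⟩
  box := fun i k => by
    refine (Measure.restrict_le_self _).trans ?_
    rw [volume_cadicBox hc, ← Real.rpow_natCast]
    exact ENNReal.ofReal_le_ofReal
      (Real.rpow_le_rpow_of_exponent_ge (side_pos hc i) (side_le_one hc i) hsd)

/-- Frostman's estimate: for `R < 1`, a set of diameter at most `R` meets at most `3 ^ d` boxes of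
the generation whose side is between `R` and `c R`; for `R ≥ 1` the total mass suffices, the
constant being at least `1`. A separate bound `R > 0` avoids singling out sets of diameter `0`. -/
lemma IsSpread.measure_le (hc : 2 ≤ c) {s : ℝ} (hs : 0 < s) {ν : Measure (Fin d → ℝ)}
    {O : Set (Fin d → ℝ)} (h : IsSpread c s ν O) (U : Set (Fin d → ℝ)) {R : ℝ≥0∞}
    (hR : 0 < R) (hU : Metric.ediam U ≤ R) :
    ν U ≤ ENNReal.ofReal (3 ^ d * (c : ℝ) ^ s) * R ^ s := by
  have hc1 : (1 : ℝ) < c := by exact_mod_cast (by omega : 1 < c)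
  have hC1 : (1 : ℝ) ≤ 3 ^ d * (c : ℝ) ^ s :=
    one_le_mul_of_one_le_of_one_le (one_le_pow₀ (by norm_num)) (Real.one_le_rpow hc1.le hs.le)
  rcases le_or_gt 1 R with h1 | h1
  · calc ν U ≤ ν univ := measure_mono (subset_univ _)
      _ = 1 := h.univ_eq
      _ = 1 * 1 := by simp
      _ ≤ _ := by
        gcongr
        · rw [← ENNReal.ofReal_one]; exact ENNReal.ofReal_le_ofReal hC1
        · exact ENNReal.one_le_rpow h1 hs
  · have hfin : R ≠ ⊤ := (h1.trans ENNReal.one_lt_top).ne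
    set r := R.toReal with hr
    have hr0 : 0 < r := ENNReal.toReal_pos hR.ne' hfin
    have hr1 : r < 1 := by
      rw [hr, ← ENNReal.toReal_one]; exact (ENNReal.toReal_lt_toReal hfin ENNReal.one_ne_top).2 h1
    obtain ⟨i, hi1, hi2⟩ := exists_nat_pow_near_of_lt_one hr0 hr1.le
      (y := (c : ℝ)⁻¹) (by positivity) (inv_lt_one_of_one_lt₀ hc1)
    have hsi : ∀ j, side c j = (c : ℝ)⁻¹ ^ j := fun j => by simp [side]
    rw [← hsi] at hi1 hi2
    by_cases hne : (U ∩ cadicBox c 0 (0 : Fin d → ℕ)).Nonempty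
    · obtain ⟨u, huU, hu⟩ := hne
      have hu0 := ((mem_cadicBox_iff hc).1 hu).1
      have hsub : U ∩ cadicBox c 0 (0 : Fin d → ℕ) ⊆
          ⋃ k ∈ nearIndices 1 (indexOf c i u), cadicBox c i k := by
        rintro v ⟨hvU, hv⟩
        have hv0 := ((mem_cadicBox_iff hc).1 hv).1
        have hd : dist v u ≤ side c i := by
          refine le_trans ?_ hi2
          rw [hr, dist_edist]
          exact ENNReal.toReal_mono hfin ((Metric.edist_le_ediam_of_mem hvU huU).trans hU)
        simp only [mem_iUnion, exists_prop]
        refine ⟨indexOf c i v, ?_, mem_cadicBox_indexOf hc i hv0⟩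
        rw [mem_nearIndices]
        simpa [AreNeighbours] using areNeighbours_indexOf hc hv0 hu0 hd
      calc ν U ≤ ν (U ∩ cadicBox c 0 (0 : Fin d → ℕ)) := by
            rw [measure_inter_conull h.cube]
        _ ≤ ν (⋃ k ∈ nearIndices 1 (indexOf c i u), cadicBox c i k) := measure_mono hsub
        _ ≤ ∑ k ∈ nearIndices 1 (indexOf c i u), ν (cadicBox c i k) :=
            measure_biUnion_finset_le _ _
        _ ≤ ∑ k ∈ nearIndices 1 (indexOf c i u), ENNReal.ofReal (side c i ^ s) :=
            Finset.sum_le_sum fun k _ => h.box i k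
        _ ≤ ENNReal.ofReal (3 ^ d * side c i ^ s) := by
            rw [Finset.sum_const, nsmul_eq_mul, ENNReal.ofReal_mul (by positivity)]
            gcongr
            rw [← ENNReal.ofReal_natCast]
            apply ENNReal.ofReal_le_ofReal
            exact_mod_cast card_nearIndices_le 1 _
        _ ≤ ENNReal.ofReal (3 ^ d * (c : ℝ) ^ s * r ^ s) := by
            apply ENNReal.ofReal_le_ofReal
            rw [mul_assoc, ← Real.mul_rpow (by positivity) hr0.le]
            have : side c i ≤ c * r := by
              rw [side_add] at hi1
              have h2 : side c 1 = (c : ℝ)⁻¹ := by simp [side]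
              rw [h2, ← div_eq_mul_inv, div_lt_iff₀ (by positivity)] at hi1
              linarith
            gcongr
            exact (side_pos hc i).le
        _ = _ := by
            rw [ENNReal.ofReal_mul (by positivity), ← ENNReal.ofReal_rpow_of_pos hr0, hr,
              ENNReal.ofReal_toReal hfin]
    · have : ν U = 0 := by
        rw [← measure_inter_conull h.cube, not_nonempty_iff_eq_empty.1 hne, measure_empty]
      rw [this]; exact zero_le

/-- The boxes of generation `g` carry measures which satisfy the estimates that allow to redistribute
the mass of a measure with bounded density. -/
def IsRedistribution (c : ℕ) (s t C : ℝ) (G : Set (Fin d → ℝ)) (g : ℕ) (K : Fin d → ℕ)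
    (θ : Measure (Fin d → ℝ)) : Prop :=
  (∃ D : ℝ≥0, θ ≤ D • (volume : Measure (Fin d → ℝ))) ∧ θ univ = 1 ∧
    (∃ A, IsCompact A ∧ A ⊆ G ∩ cadicBox c g K ∧ θ Aᶜ = 0) ∧
    ∀ i k, g ≤ i → θ (cadicBox c i k) ≤ ENNReal.ofReal (C * side c i ^ s * (c : ℝ) ^ (g * t))

/-- One step of the construction. Inside every box of a large generation `g`, the mass of `ν` is
rearranged according to `θ`. Boxes coarser than `g` keep at most their old mass. For finer boxes,
the density bound `D` gives `D C side_g ^ (d - t) * side_i ^ s`, and `g` is taken so large that the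
prefactor is at most `1`. The bound `s` is therefore inherited without any loss of constant. -/
lemma IsSpread.redistribute (hc : 2 ≤ c) {s t C : ℝ} (htd : t < d)
    {ν : Measure (Fin d → ℝ)} {O G : Set (Fin d → ℝ)} (hν : IsSpread c s ν O) (hO : IsOpen O)
    (hG : IsOpen G)
    (h : ∀ᶠ g in atTop, ∀ K, IsIndex c g K → ∃ θ, IsRedistribution c s t C G g K θ) :
    ∃ ν' O', IsSpread c s ν' O' ∧ IsOpen O' ∧ IsCompact (closure O') ∧ closure O' ⊆ O ∧ O' ⊆ G := by
  obtain ⟨D, hD⟩ := hν.density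
  obtain ⟨A, hA, hAO, hνA⟩ := hν.compact
  obtain ⟨ε, hε, hεO⟩ := hA.exists_cthickening_subset_open hO hAO
  have hlim : Tendsto (fun g : ℕ => D * C * side c g ^ ((d : ℝ) - t)) atTop (𝓝 (D * C * 0)) := by
    refine Tendsto.const_mul _ ?_
    have := (tendsto_side hc).rpow_const (p := (d : ℝ) - t) (Or.inr (by linarith))
    rwa [Real.zero_rpow (by linarith)] at this
  rw [mul_zero] at hlim
  obtain ⟨g, hg, hgε, hgD⟩ := (h.and (((tendsto_side hc).eventually_lt_const hε).and
    (hlim.eventually_le_const one_pos))).exists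
  choose! θ hθ using hg
  choose! Dθ hDθ using fun K hK => (hθ K hK).1
  choose! Aθ hAθ using fun K hK => (hθ K hK).2.2.1
  have hone : ∀ K, IsIndex c g K → θ K univ = 1 := fun K hK => (hθ K hK).2.1
  have hout : ∀ K, IsIndex c g K → θ K (cadicBox c g K)ᶜ = 0 := fun K hK =>
    measure_mono_null (compl_subset_compl.2 ((hAθ K hK).2.1.trans inter_subset_right))
      (hAθ K hK).2.2
  set ν' : Measure (Fin d → ℝ) := ∑ K ∈ indices d c g, ν (cadicBox c g K) • θ K with hν'
  have happ : ∀ S, ν' S = ∑ K ∈ indices d c g, ν (cadicBox c g K) * θ K S := by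
    intro S; simp [hν', Measure.finsetSum_apply]
  have hdisj : ∀ K K' S, IsIndex c g K → S ⊆ cadicBox c g K' → K ≠ K' → θ K S = 0 := by
    intro K K' S hK hS hne
    refine measure_mono_null ?_ (hout K hK)
    exact hS.trans (disjoint_cadicBox hc hne).symm.subset_compl_right
  have hνle : ∀ K, ν (cadicBox c g K) ≤ 1 := fun K => hν.univ_eq ▸ measure_mono (subset_univ _)
  refine ⟨ν', Metric.thickening ε A ∩ G, ⟨?_, ?_, ?_, ?_, ?_⟩,
    Metric.isOpen_thickening.inter hG, ?_, ?_, inter_subset_right⟩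
  · rw [happ, Finset.sum_congr rfl fun K hK => by rw [hone K (mem_indices.1 hK), mul_one],
      ← measure_biUnion_finset (fun K _ K' _ hne => disjoint_cadicBox hc hne)
        (fun K _ => measurableSet_cadicBox _ _), ← cadicBox_zero_eq_biUnion hc,
      ← hν.univ_eq, ← measure_inter_conull (s := univ) hν.cube, univ_inter]
  · refine ⟨∑ K ∈ indices d c g, Dθ K, Measure.le_iff.2 fun S _ => ?_⟩
    rw [happ, Measure.smul_apply, Finset.sum_smul]
    refine Finset.sum_le_sum fun K hK => ?_
    calc ν (cadicBox c g K) * θ K S ≤ 1 * θ K S := by gcongr; exact hνle K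
      _ ≤ _ := by rw [one_mul]; exact hDθ K (mem_indices.1 hK) S
  · rw [happ]
    refine Finset.sum_eq_zero fun K hK => ?_
    rw [measure_mono_null (compl_subset_compl.2 ((mem_indices.1 hK).subset hc))
      (hout K (mem_indices.1 hK)), mul_zero]
  · classical
    -- Boxes of zero `ν`-mass are discarded. The others meet `A` and have side less than `ε`, so
    -- their compact sets stay in the `ε`-thickening of `A`.
    refine ⟨⋃ K ∈ (indices d c g).filter fun K => ν (cadicBox c g K) ≠ 0, Aθ K,
      Finset.isCompact_biUnion _ fun K hK => (hAθ K (mem_indices.1 (Finset.mem_filter.1 hK).1)).1,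
      ?_, ?_⟩
    · refine iUnion₂_subset fun K hK => ?_
      rw [Finset.mem_filter] at hK
      have hA' := (hAθ K (mem_indices.1 hK.1)).2.1
      refine subset_inter ?_ (hA'.trans inter_subset_left)
      intro z hz
      have : (cadicBox c g K ∩ A).Nonempty := by
        apply nonempty_of_measure_ne_zero (μ := ν)
        rw [measure_inter_conull hνA]
        exact hK.2
      obtain ⟨a, haK, ha⟩ := this
      exact Metric.mem_thickening_iff.2
        ⟨a, ha, (dist_le_side hc (hA' hz).2 haK).trans_lt hgε⟩
    · rw [happ]
      refine Finset.sum_eq_zero fun K hK => ?_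
      by_cases h0 : ν (cadicBox c g K) = 0
      · rw [h0, zero_mul]
      · rw [measure_mono_null _ (hAθ K (mem_indices.1 hK)).2.2, mul_zero]
        exact compl_subset_compl.2
          (subset_biUnion_of_mem (u := Aθ) (Finset.mem_coe.2 (Finset.mem_filter.2 ⟨hK, h0⟩)))
  · intro i k
    rcases le_total i g with hi | hi
    · refine le_trans ?_ (hν.box i k)
      rw [happ]
      classical
      calc ∑ K ∈ indices d c g, ν (cadicBox c g K) * θ K (cadicBox c i k)
          ≤ ∑ K ∈ indices d c g with cadicBox c g K ⊆ cadicBox c i k, ν (cadicBox c g K) := by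
            rw [Finset.sum_filter]
            refine Finset.sum_le_sum fun K hK => ?_
            split_ifs with hsub
            · calc _ ≤ ν (cadicBox c g K) * θ K univ := by gcongr; exact subset_univ _
                _ = _ := by rw [hone K (mem_indices.1 hK), mul_one]
            · rw [measure_mono_null _ (hout K (mem_indices.1 hK)), mul_zero]
              intro z hz hz'
              exact hsub (cadicBox_subset_of_mem hc hi hz hz')
        _ = ν (⋃ K ∈ (indices d c g).filter fun K => cadicBox c g K ⊆ cadicBox c i k,
              cadicBox c g K) :=
            (measure_biUnion_finset (fun K _ K' _ hne => disjoint_cadicBox hc hne)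
              (fun K _ => measurableSet_cadicBox _ _)).symm
        _ ≤ _ := measure_mono (iUnion₂_subset fun K hK => (Finset.mem_filter.1 hK).2)
    · rw [happ, Finset.sum_eq_single (ancestor c g i k)]
      · by_cases hK : IsIndex c g (ancestor c g i k)
        · calc _ ≤ (D * ENNReal.ofReal (side c g ^ d)) *
                ENNReal.ofReal (C * side c i ^ s * (c : ℝ) ^ (g * t)) := by
                gcongr
                · rw [← volume_cadicBox hc g (ancestor c g i k)]
                  exact hD _
                · exact (hθ _ hK).2.2.2 i k hi
            _ = ENNReal.ofReal (D * C * side c g ^ ((d : ℝ) - t) * side c i ^ s) := by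
                have hs0 := side_pos hc g
                rw [← ENNReal.ofReal_coe_nnreal, ← ENNReal.ofReal_mul NNReal.zero_le_coe,
                  ← ENNReal.ofReal_mul (by positivity)]
                congr 1
                rw [Real.rpow_sub hs0, Real.rpow_natCast, side_rpow g t,
                  Real.rpow_neg (by positivity), div_inv_eq_mul]
                ring
            _ ≤ _ := by
                apply ENNReal.ofReal_le_ofReal
                exact mul_le_of_le_one_left (Real.rpow_nonneg (side_pos hc i).le _) hgD
        · have : ν (cadicBox c g (ancestor c g i k)) = 0 := by
            refine measure_mono_null ?_ hν.cube
            intro z hz hz'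
            exact hK (isIndex_of_mem hc hz' hz)
          rw [this, zero_mul]; exact zero_le
      · intro K hK hne
        rw [hdisj K _ _ (mem_indices.1 hK) (cadicBox_subset_ancestor hc hi k) hne, mul_zero]
      · intro hK
        have : ν (cadicBox c g (ancestor c g i k)) = 0 := by
          refine measure_mono_null ?_ hν.cube
          intro z hz hz'
          exact hK (mem_indices.2 (isIndex_of_mem hc hz' hz))
        rw [this, zero_mul]
  · refine (hA.cthickening (r := ε)).of_isClosed_subset isClosed_closure ?_
    exact (closure_mono inter_subset_left).trans (Metric.closure_thickening_subset_cthickening _ _)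
  · exact ((closure_mono inter_subset_left).trans
      (Metric.closure_thickening_subset_cthickening _ _)).trans hεO

/-- A slight thickening of `T` changes the power of its diameter by less than `ε`. The point is that
`U` depends on `T` only, so it can be fixed before the stage whose measure will be used is known. -/
lemma exists_isOpen_measure_le (hc : 2 ≤ c) {s : ℝ} (hs : 0 < s) (T : Set (Fin d → ℝ))
    {ε : ℝ≥0∞} (hε : ε ≠ 0) :
    ∃ U, IsOpen U ∧ T ⊆ U ∧ ∀ (ν : Measure (Fin d → ℝ)) O, IsSpread c s ν O →
      ν U ≤ ENNReal.ofReal (3 ^ d * (c : ℝ) ^ s) *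
        ((⨆ _ : T.Nonempty, Metric.ediam T ^ s) + ε) := by
  have hC0 : ENNReal.ofReal (3 ^ d * (c : ℝ) ^ s) ≠ 0 := by
    rw [Ne, ENNReal.ofReal_eq_zero, not_le]; positivity
  rcases T.eq_empty_or_nonempty with rfl | hT
  · exact ⟨∅, isOpen_empty, subset_rfl, fun ν O _ => by simp⟩
  simp only [hT, ciSup_pos]
  by_cases hfin : Metric.ediam T = ⊤
  · refine ⟨univ, isOpen_univ, subset_univ _, fun ν O _ => ?_⟩
    rw [hfin, ENNReal.top_rpow_of_pos hs, top_add, ENNReal.mul_top hC0]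
    exact le_top
  · have hcont : Tendsto (fun δ : ℝ≥0 => (Metric.ediam T + 2 * (δ : ℝ≥0∞)) ^ s) (𝓝[>] 0)
        (𝓝 (Metric.ediam T ^ s)) := by
      have h1 : Tendsto (fun δ : ℝ≥0 => Metric.ediam T + 2 * (δ : ℝ≥0∞)) (𝓝 0)
          (𝓝 (Metric.ediam T + 2 * ((0 : ℝ≥0) : ℝ≥0∞))) :=
        tendsto_const_nhds.add (ENNReal.Tendsto.const_mul
          (ENNReal.tendsto_coe.2 tendsto_id) (Or.inr (by simp)))
      simp only [ENNReal.coe_zero, mul_zero, add_zero] at h1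
      exact ((ENNReal.continuous_rpow_const.tendsto _).comp h1).mono_left nhdsWithin_le_nhds
    have hlt : Metric.ediam T ^ s < Metric.ediam T ^ s + ε :=
      ENNReal.lt_add_right (ENNReal.rpow_ne_top_of_nonneg hs.le hfin) hε
    obtain ⟨δ, hδ, hδ0⟩ := ((hcont.eventually_lt_const hlt).and self_mem_nhdsWithin).exists
    have hδ0' : (0 : ℝ) < δ := hδ0
    refine ⟨Metric.thickening δ T, Metric.isOpen_thickening,
      Metric.self_subset_thickening hδ0' T, fun ν O hν => ?_⟩
    refine (hν.measure_le hc hs _ (R := Metric.ediam T + 2 * δ) ?_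
      (Metric.ediam_thickening_le δ)).trans ?_
    · refine lt_of_lt_of_le ?_ le_add_self
      exact ENNReal.mul_pos two_ne_zero (by simpa using hδ0'.ne')
    · gcongr

/-- A lower bound for the Hausdorff dimension of an intersection of open sets in which mass can be
redistributed inside all small boxes. -/
theorem le_dimH_iInter (hc : 2 ≤ c) {s t C : ℝ} (hs : 0 < s) (hsd : s ≤ d) (htd : t < d)
    (G : ℕ → Set (Fin d → ℝ)) (hG : ∀ N, IsOpen (G N))
    (h : ∀ N, ∀ᶠ g in atTop, ∀ K, IsIndex c g K → ∃ θ, IsRedistribution c s t C (G N) g K θ) :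
    ENNReal.ofReal s ≤ dimH (⋂ N, G N) := by
  let P := {p : Measure (Fin d → ℝ) × Set (Fin d → ℝ) // IsSpread c s p.1 p.2 ∧ IsOpen p.2}
  have hstep : ∀ (N : ℕ) (p : P), ∃ q : P, IsCompact (closure q.1.2) ∧ closure q.1.2 ⊆ p.1.2 ∧
      q.1.2 ⊆ G N := by
    intro N p
    obtain ⟨ν', O', h1, h2, h3, h4, h5⟩ := p.2.1.redistribute hc htd p.2.2 (hG N) (h N)
    exact ⟨⟨(ν', O'), h1, h2⟩, h3, h4, h5⟩
  choose f hf1 hf2 hf3 using hstep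
  let p : ℕ → P := fun n => Nat.rec (f 0 ⟨(_, univ), isSpread_volume hc hsd, isOpen_univ⟩)
    (fun n q => f (n + 1) q) n
  have hp : ∀ n, p (n + 1) = f (n + 1) (p n) := fun n => rfl
  have hcomp : ∀ n, IsCompact (closure (p n).1.2) := by
    rintro (_ | n)
    · exact hf1 _ _
    · exact hf1 _ _
  have hsub : ∀ n, (p n).1.2 ⊆ G n := by
    rintro (_ | n)
    · exact hf3 _ _
    · exact hf3 _ _
  have hnest : ∀ n, closure (p (n + 1)).1.2 ⊆ (p n).1.2 := fun n => hf2 _ _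
  have hanti : Antitone fun n => closure (p n).1.2 :=
    antitone_nat_of_succ_le fun n => (hnest n).trans subset_closure
  have hKG : (⋂ n, closure (p n).1.2) ⊆ ⋂ N, G N :=
    subset_iInter fun N => (iInter_subset _ (N + 1)).trans ((hnest N).trans (hsub N))
  have hfull : ∀ n U, (p n).1.2 ⊆ U → 1 ≤ (p n).1.1 U := by
    intro n U hU
    obtain ⟨A, -, hA, hA0⟩ := (p n).2.1.compact
    rw [← (p n).2.1.univ_eq, ← measure_inter_conull (s := univ) hA0, univ_inter]
    exact measure_mono (hA.trans hU)
  set C₀ := ENNReal.ofReal (3 ^ d * (c : ℝ) ^ s) with hC₀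
  have hC₀0 : C₀ ≠ 0 := by
    rw [hC₀, Ne, ENNReal.ofReal_eq_zero, not_le]; positivity
  -- The mass distribution principle without a limit measure: open enlargements of the `T n` cover
  -- the nested compact intersection, hence already one of the closures, and the measure of that
  -- stage has total mass `1`.
  have key : ∀ T : ℕ → Set (Fin d → ℝ), (⋂ n, closure (p n).1.2) ⊆ ⋃ n, T n →
      1 ≤ C₀ * ∑' n, ⨆ _ : (T n).Nonempty, Metric.ediam (T n) ^ s := by
    intro T hT
    refine ENNReal.le_of_forall_pos_le_add fun ε hε _ => ?_
    have hε' : (ε : ℝ≥0∞) / C₀ ≠ 0 :=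
      (ENNReal.div_pos (by simpa using hε.ne') ENNReal.ofReal_ne_top).ne'
    obtain ⟨e, he, hesum⟩ := ENNReal.exists_pos_sum_of_countable' hε' ℕ
    choose U hUo hTU hU using fun n => exists_isOpen_measure_le hc hs (T n) (he n).ne'
    obtain ⟨n, hn⟩ := exists_subset_nhds_of_isCompact' hanti.directed_ge hcomp
      (fun _ => isClosed_closure) (U := ⋃ n, U n) fun x hx =>
        (isOpen_iUnion hUo).mem_nhds (iUnion_mono hTU (hT hx))
    calc 1 ≤ (p n).1.1 (⋃ n, U n) := hfull n _ (subset_closure.trans hn)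
      _ ≤ ∑' i, (p n).1.1 (U i) := measure_iUnion_le _
      _ ≤ ∑' i, C₀ * ((⨆ _ : (T i).Nonempty, Metric.ediam (T i) ^ s) + e i) :=
          ENNReal.tsum_le_tsum fun i => hU i _ _ (p n).2.1
      _ = C₀ * (∑' i, ⨆ _ : (T i).Nonempty, Metric.ediam (T i) ^ s) + C₀ * ∑' i, e i := by
          rw [ENNReal.tsum_mul_left, ENNReal.tsum_add, mul_add]
      _ ≤ _ := by
          gcongr
          calc C₀ * ∑' i, e i ≤ C₀ * (ε / C₀) := by gcongr
            _ ≤ ε := ENNReal.mul_div_le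
  have hpos : μH[((s.toNNReal : ℝ≥0) : ℝ)] (⋂ N, G N) ≠ 0 := by
    refine fun h0 => ?_
    have h1 := measure_mono_null hKG h0
    rw [Real.coe_toNNReal _ hs.le, Measure.hausdorffMeasure_apply] at h1
    have h2 : C₀⁻¹ ≤ 0 := by
      rw [← h1]
      refine le_iSup₂_of_le 1 one_pos (le_iInf fun T => le_iInf₂ fun hT _ => ?_)
      rw [ENNReal.inv_le_iff_le_mul (fun _ => hC₀0) (fun h => absurd h ENNReal.ofReal_ne_top)]
      exact key T hT
    exact ENNReal.inv_ne_zero.2 ENNReal.ofReal_ne_top (le_antisymm h2 zero_le)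
  exact le_dimH_of_hausdorffMeasure_ne_zero hpos

/-! ### Packing and uniform measures on unions of balls -/

/-- Comparison of volumes: the disjoint balls all lie in the ball of radius `R + r`. -/
lemma card_le_of_pairwiseDisjoint_closedBall {ι : Type*} (F : Finset ι) (x : ι → Fin d → ℝ)
    {r R : ℝ} (hr : 0 < r) (hR : 0 ≤ R) (p : Fin d → ℝ)
    (hdisj : (F : Set ι).PairwiseDisjoint fun n => Metric.closedBall (x n) r)
    (hF : ∀ n ∈ F, x n ∈ Metric.closedBall p R) : (F.card : ℝ) ≤ ((R + r) / r) ^ d := by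
  have h1 : volume (⋃ n ∈ F, Metric.closedBall (x n) r) ≤ volume (Metric.closedBall p (R + r)) := by
    refine measure_mono (iUnion₂_subset fun n hn => Metric.closedBall_subset_closedBall' ?_)
    have := hF n hn
    rw [Metric.mem_closedBall] at this
    linarith
  rw [measure_biUnion_finset hdisj fun n _ => Metric.isClosed_closedBall.measurableSet,
    Real.volume_pi_closedBall _ (by positivity),
    Finset.sum_congr rfl fun n _ => Real.volume_pi_closedBall (x n) hr.le, Finset.sum_const,
    nsmul_eq_mul, ← ENNReal.ofReal_natCast, ← ENNReal.ofReal_mul (by positivity),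
    ENNReal.ofReal_le_ofReal_iff (by positivity), Fintype.card_fin] at h1
  rw [div_pow, le_div_iff₀ (by positivity)]
  rw [mul_pow, mul_pow] at h1
  have h2 : (0 : ℝ) < 2 ^ d := by positivity
  nlinarith

/-- The uniform distribution on the balls of radius `r` centred at the points of `F`. -/
noncomputable def unif (F : Finset (Fin d → ℝ)) (r : ℝ) : Measure (Fin d → ℝ) :=
  ENNReal.ofReal ((F.card * (2 * r) ^ d)⁻¹) • ∑ p ∈ F, volume.restrict (Metric.closedBall p r)

lemma unif_apply (F : Finset (Fin d → ℝ)) (r : ℝ) (S : Set (Fin d → ℝ)) :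
    unif F r S = ENNReal.ofReal ((F.card * (2 * r) ^ d)⁻¹) *
      ∑ p ∈ F, volume.restrict (Metric.closedBall p r) S := by
  simp [unif, Measure.finsetSum_apply]

lemma unif_univ {F : Finset (Fin d → ℝ)} {r : ℝ} (hF : F.Nonempty) (hr : 0 < r) :
    unif F r univ = 1 := by
  have hF' : (0 : ℝ) < F.card := by exact_mod_cast hF.card_pos
  rw [unif_apply]
  simp only [Measure.restrict_apply_univ, Real.volume_pi_closedBall _ hr.le, Finset.sum_const,
    nsmul_eq_mul, Fintype.card_fin]
  rw [← ENNReal.ofReal_natCast, ← ENNReal.ofReal_mul hF'.le, ← ENNReal.ofReal_mul (by positivity),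
    inv_mul_cancel₀ (by positivity), ENNReal.ofReal_one]

lemma unif_le (F : Finset (Fin d → ℝ)) (r : ℝ) :
    ∃ D : ℝ≥0, unif F r ≤ D • (volume : Measure (Fin d → ℝ)) := by
  refine ⟨((F.card * (2 * r) ^ d)⁻¹).toNNReal * F.card, Measure.le_iff.2 fun S _ => ?_⟩
  rw [unif_apply, mul_smul, Measure.smul_apply, Measure.smul_apply]
  simp only [ENNReal.smul_def, smul_eq_mul, ENNReal.coe_natCast]
  gcongr
  · exact le_rfl
  calc ∑ p ∈ F, volume.restrict (Metric.closedBall p r) S ≤ ∑ _p ∈ F, volume S :=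
        Finset.sum_le_sum fun p _ => Measure.restrict_le_self S
    _ = _ := by simp

lemma unif_compl (F : Finset (Fin d → ℝ)) (r : ℝ) :
    unif F r (⋃ p ∈ F, Metric.closedBall p r)ᶜ = 0 := by
  rw [unif_apply, Finset.sum_eq_zero, mul_zero]
  intro p hp
  refine measure_mono_null (t := (Metric.closedBall p r)ᶜ) ?_ ?_
  · exact compl_subset_compl.2 (subset_biUnion_of_mem (u := fun p => Metric.closedBall p r) hp)
  · rw [Measure.restrict_apply Metric.isClosed_closedBall.measurableSet.compl]; simp

/-- The first factor bounds the proportion of balls that meet the box, by packing with the larger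
radius `R`. The second bounds the share of a single ball that the box can contain; `s ≤ d` allows
the volume ratio to be replaced by its power `s`. -/
lemma unif_cadicBox_le (hc : 2 ≤ c) {F : Finset (Fin d → ℝ)} {r R s : ℝ} (hr : 0 < r)
    (hrR : r ≤ R) (hF : F.Nonempty) (hs : 0 ≤ s) (hsd : s ≤ d)
    (hdisj : (F : Set (Fin d → ℝ)).PairwiseDisjoint fun p => Metric.closedBall p R) (i : ℕ)
    (k : Fin d → ℕ) :
    unif F r (cadicBox c i k) ≤
      ENNReal.ofReal ((3 * max (side c i) R / R) ^ d / F.card * min 1 ((side c i / r) ^ s)) := by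
  classical
  have hF' : (0 : ℝ) < F.card := by exact_mod_cast hF.card_pos
  have hR : 0 < R := hr.trans_le hrR
  have hsi := side_pos hc i
  obtain ⟨o, ho⟩ := cadicBox_nonempty hc i k
  have hterm : ∀ p, volume.restrict (Metric.closedBall p r) (cadicBox c i k) ≤
      ENNReal.ofReal ((2 * r) ^ d * min 1 ((side c i / r) ^ s)) := by
    intro p
    have h1 : volume.restrict (Metric.closedBall p r) (cadicBox c i k) ≤
        ENNReal.ofReal ((2 * r) ^ d) := by
      rw [Measure.restrict_apply (measurableSet_cadicBox _ _)]
      refine (measure_mono inter_subset_right).trans ?_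
      rw [Real.volume_pi_closedBall _ hr.le, Fintype.card_fin]
    have h2 : volume.restrict (Metric.closedBall p r) (cadicBox c i k) ≤
        ENNReal.ofReal (side c i ^ d) := by
      refine (Measure.restrict_le_self _).trans ?_
      rw [volume_cadicBox hc]
    rcases le_total r (side c i) with h | h
    · rw [min_eq_left (Real.one_le_rpow ((one_le_div hr).2 h) hs), mul_one]
      exact h1
    · have hle1 : side c i / r ≤ 1 := (div_le_one hr).2 h
      rw [min_eq_right (Real.rpow_le_one (by positivity) hle1 hs)]
      refine h2.trans (ENNReal.ofReal_le_ofReal ?_)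
      calc side c i ^ d = r ^ d * (side c i / r) ^ (d : ℝ) := by
            rw [Real.rpow_natCast, div_pow, mul_div_cancel₀ _ (by positivity)]
        _ ≤ (2 * r) ^ d * (side c i / r) ^ s := by
            gcongr ?_ * ?_
            · gcongr; linarith
            · exact Real.rpow_le_rpow_of_exponent_ge (by positivity) hle1 hsd
  set F' := F.filter fun p => (Metric.closedBall p r ∩ cadicBox c i k).Nonempty with hF'def
  have hcard : (F'.card : ℝ) ≤ (3 * max (side c i) R / R) ^ d := by
    refine (card_le_of_pairwiseDisjoint_closedBall F' id hR
      (R := 2 * max (side c i) R) (by positivity) o ?_ ?_).trans ?_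
    · exact hdisj.subset (Finset.coe_subset.2 (Finset.filter_subset _ _))
    · intro p hp
      obtain ⟨z, hz, hzb⟩ := (Finset.mem_filter.1 hp).2
      rw [Metric.mem_closedBall] at hz ⊢
      have h1 := dist_triangle p z o
      have h2 := dist_le_side hc hzb ho
      rw [dist_comm] at hz
      have h3 := le_max_left (side c i) R
      have h4 := le_max_right (side c i) R
      simp only [id]
      linarith
    · have h4 := le_max_right (side c i) R
      gcongr
      linarith
  rw [unif_apply]
  calc _ = ENNReal.ofReal ((F.card * (2 * r) ^ d)⁻¹) *
        ∑ p ∈ F', volume.restrict (Metric.closedBall p r) (cadicBox c i k) := by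
        congr 1
        refine (Finset.sum_subset (Finset.filter_subset _ _) fun p hp hp' => ?_).symm
        rw [Measure.restrict_apply (measurableSet_cadicBox _ _)]
        have : ¬ (Metric.closedBall p r ∩ cadicBox c i k).Nonempty := fun h =>
          hp' (Finset.mem_filter.2 ⟨hp, h⟩)
        rw [inter_comm, not_nonempty_iff_eq_empty.1 this, measure_empty]
    _ ≤ ENNReal.ofReal ((F.card * (2 * r) ^ d)⁻¹) *
        ∑ p ∈ F', ENNReal.ofReal ((2 * r) ^ d * min 1 ((side c i / r) ^ s)) := by
        gcongr; exact hterm _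
    _ = ENNReal.ofReal ((F.card * (2 * r) ^ d)⁻¹ * (F'.card * ((2 * r) ^ d *
          min 1 ((side c i / r) ^ s)))) := by
        rw [Finset.sum_const, nsmul_eq_mul, ← ENNReal.ofReal_natCast,
          ← ENNReal.ofReal_mul (by positivity), ← ENNReal.ofReal_mul (by positivity)]
    _ ≤ _ := by
        apply ENNReal.ofReal_le_ofReal
        have : ((F.card : ℝ) * (2 * r) ^ d)⁻¹ * (F'.card * ((2 * r) ^ d *
          min 1 ((side c i / r) ^ s))) = F'.card / F.card * min 1 ((side c i / r) ^ s) := by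
          field_simp
        rw [this]
        have : 0 ≤ min 1 ((side c i / r) ^ s) := le_min zero_le_one (by positivity)
        gcongr

/-- The numerical estimate behind the mass of the boxes that are smaller than the box `Q` of
generation `h` around a point at which the system is ubiquitous at the scale `j`. -/
lemma rpow_estimate (hc : 2 ≤ c) {ρ δ s₁ s₂ κ N : ℝ} {i j h : ℕ} (hs₁ : 0 ≤ s₁)
    (hs₁d : s₁ ≤ d) (hs₂d : s₂ ≤ d) (hs₂ : 0 ≤ s₂)
    (hκ : κ ≤ ρ * (s₁ - s₂)) (hδ : δ * s₂ ≤ d * (1 - ρ) + ρ * s₁ - κ) (hi : h < i)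
    (hh : ρ * j ≤ h + 2) (hN : (c : ℝ) ^ (j * (d * (1 - ρ) - κ)) ≤ N) :
    side c h ^ s₁ * ((3 * max (side c i) (side c j) / side c j) ^ d / N *
      min 1 ((side c i / (c : ℝ) ^ (-(j * δ))) ^ s₂)) ≤
      3 ^ d * (c : ℝ) ^ (3 * (d : ℝ)) * side c i ^ s₂ := by
  have hc1 : (1 : ℝ) < c := by exact_mod_cast (by omega : 1 < c)
  have hc0 : (0 : ℝ) < c := by positivity
  have hi' : (h : ℝ) + 1 ≤ i := by exact_mod_cast hi
  have hN0 : 0 < (c : ℝ) ^ (j * (d * (1 - ρ) - κ)) := by positivity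
  have hmin0 : 0 ≤ min 1 ((side c i / (c : ℝ) ^ (-(j * δ))) ^ s₂) :=
    le_min zero_le_one (Real.rpow_nonneg (div_nonneg (side_pos hc i).le (by positivity)) _)
  have hsi := side_pos hc i
  have hsj := side_pos hc j
  have hsh := side_pos hc h
  have hjs : 0 ≤ (j : ℝ) := by positivity
  have hm : (3 * max (side c i) (side c j) / side c j) ^ d =
      3 ^ d * (max (side c i) (side c j) / side c j) ^ d := by rw [mul_div_assoc, mul_pow]
  have hstep : side c h ^ s₁ * ((3 * max (side c i) (side c j) / side c j) ^ d / N *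
      min 1 ((side c i / (c : ℝ) ^ (-(j * δ))) ^ s₂)) ≤
      side c h ^ s₁ * (3 ^ d * (max (side c i) (side c j) / side c j) ^ d /
        (c : ℝ) ^ (j * (d * (1 - ρ) - κ)) *
      min 1 ((side c i / (c : ℝ) ^ (-(j * δ))) ^ s₂)) := by
    rw [hm]; gcongr
  refine hstep.trans ?_
  -- For boxes larger than the separation `c ^ (-j)` the number of balls met is what matters, and
  -- `hκ` makes the exponents fit. For smaller boxes essentially one ball is met, its share matters,
  -- and `hδ` is the relevant inequality.
  rcases le_total i j with hij | hij
  · rw [max_eq_left (side_anti hc hij)]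
    have hij' : (i : ℝ) ≤ j := by exact_mod_cast hij
    calc _ ≤ side c h ^ s₁ * (3 ^ d * (side c i / side c j) ^ d /
        (c : ℝ) ^ (j * (d * (1 - ρ) - κ)) * 1) := by gcongr; exact min_le_left _ _
      _ = 3 ^ d * (c : ℝ) ^ (-(h * s₁) + (-i + j) * d - j * (d * (1 - ρ) - κ)) := by
        rw [side_rpow, side_eq_rpow i, side_eq_rpow j, ← Real.rpow_sub hc0,
          ← Real.rpow_natCast ((c : ℝ) ^ (-(i : ℝ) - -(j : ℝ))) d,
          ← Real.rpow_mul hc0.le, mul_one, Real.rpow_sub hc0, Real.rpow_add hc0,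
          show (-(i : ℝ) - -(j : ℝ)) * (d : ℝ) = (-i + j) * d by ring]
        ring
      _ ≤ 3 ^ d * (c : ℝ) ^ (3 * (d : ℝ) + -(i * s₂)) := by
        refine mul_le_mul_of_nonneg_left (Real.rpow_le_rpow_of_exponent_le hc1.le ?_)
          (by positivity)
        nlinarith
      _ = _ := by rw [Real.rpow_add hc0, side_rpow]; ring
  · rw [max_eq_right (side_anti hc hij), div_self hsj.ne']
    calc _ ≤ side c h ^ s₁ * (3 ^ d * 1 ^ d /
        (c : ℝ) ^ (j * (d * (1 - ρ) - κ)) * (side c i / (c : ℝ) ^ (-(j * δ))) ^ s₂) := by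
          gcongr; exact min_le_right _ _
      _ = 3 ^ d * (c : ℝ) ^ (-(h * s₁) - j * (d * (1 - ρ) - κ) + (-i - -(j * δ)) * s₂) := by
        rw [side_rpow, side_eq_rpow i, ← Real.rpow_sub hc0,
          ← Real.rpow_mul hc0.le, Real.rpow_add hc0, Real.rpow_sub hc0]
        ring
      _ ≤ 3 ^ d * (c : ℝ) ^ (3 * (d : ℝ) + -(i * s₂)) := by
        refine mul_le_mul_of_nonneg_left (Real.rpow_le_rpow_of_exponent_le hc1.le ?_)
          (by positivity)
        nlinarith
      _ = _ := by rw [Real.rpow_add hc0, side_rpow]; ring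

/-! ### Construction of a measure near a set from the points of the system -/

/-- Near `y` there are many points, at mutual distances greater than `c ^ (-j)`, that are centres
of balls of radius `c ^ (-j δ)` contained in `G`. -/
def HasManyBalls (c : ℕ) (ρ δ κ : ℝ) (G : Set (Fin d → ℝ)) (y : Fin d → ℝ) (j : ℕ) : Prop :=
  ∃ F : Finset (Fin d → ℝ), (c : ℝ) ^ (j * (d * (1 - ρ) - κ)) ≤ F.card ∧
    (∀ p ∈ F, dist p y ≤ (c : ℝ) ^ (-(ρ * j)) ∧ Metric.closedBall p ((c : ℝ) ^ (-(j * δ))) ⊆ G) ∧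
    (F : Set (Fin d → ℝ)).PairwiseDisjoint fun p => Metric.closedBall p (side c j)

/-- A family of boxes contains a subfamily of pairwise disjoint boxes with the same union. -/
lemma exists_disjoint_boxes (hc : 2 ≤ c) (Q : Set (ℕ × (Fin d → ℕ))) :
    ∃ T ⊆ Q, (T.PairwiseDisjoint fun q => cadicBox c q.1 q.2) ∧
      ∀ q ∈ Q, cadicBox c q.1 q.2 ⊆ ⋃ q' ∈ T, cadicBox c q'.1 q'.2 := by
  classical
  -- The maximal boxes: those with no strict ancestor in `Q`.
  refine ⟨{q | q ∈ Q ∧ ∀ h < q.1, (h, ancestor c h q.1 q.2) ∉ Q}, fun q hq => hq.1, ?_, ?_⟩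
  · have key : ∀ q q' : ℕ × (Fin d → ℕ), q ∈ Q → (∀ h < q'.1, (h, ancestor c h q'.1 q'.2) ∉ Q) →
        ∀ z ∈ cadicBox c q.1 q.2, z ∈ cadicBox c q'.1 q'.2 → ¬ q.1 < q'.1 := by
      intro q q' hq hq' z hz hz' hlt
      apply hq' q.1 hlt
      rw [mem_cadicBox_iff hc] at hz hz'
      rwa [← hz'.2, ancestor_indexOf hc hlt.le, hz.2]
    intro q hq q' hq' hne
    refine Set.disjoint_left.2 fun z hz hz' => hne ?_
    have h1 := key q q' hq.1 hq'.2 z hz hz'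
    have h2 := key q' q hq'.1 hq.2 z hz' hz
    have h3 : q.1 = q'.1 := by omega
    dsimp only at hz hz'
    rw [mem_cadicBox_iff hc] at hz hz'
    exact Prod.ext h3 (by rw [← hz.2, ← hz'.2, h3])
  · intro q hq z hz
    have hz0 := ((mem_cadicBox_iff hc).1 hz).1
    have hex : ∃ h, (h, indexOf c h z) ∈ Q := ⟨q.1, by rw [((mem_cadicBox_iff hc).1 hz).2]; exact hq⟩
    simp only [mem_iUnion, exists_prop]
    refine ⟨(Nat.find hex, indexOf c (Nat.find hex) z), ⟨Nat.find_spec hex, fun h hlt => ?_⟩,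
      mem_cadicBox_indexOf hc _ hz0⟩
    dsimp only at hlt ⊢
    rw [ancestor_indexOf hc hlt.le]
    exact Nat.find_min hex hlt

/-- The union of the boxes around the points of `E`, up to a sufficiently large generation, carries
half of the mass of `E`. -/
lemma exists_finite_boxes (hc : 2 ≤ c) {π : Measure (Fin d → ℝ)} {E : Set (Fin d → ℝ)}
    (hE : E ⊆ cadicBox c 0 (0 : Fin d → ℕ)) (hπE : 1 ≤ π E) (h : (Fin d → ℝ) → ℕ) :
    ∃ T : Finset (ℕ × (Fin d → ℕ)),
      (∀ q ∈ T, ∃ y ∈ E, q = (h y, indexOf c (h y) y)) ∧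
      ((T : Set (ℕ × (Fin d → ℕ))).PairwiseDisjoint fun q => cadicBox c q.1 q.2) ∧
      ENNReal.ofReal (1 / 2) ≤ ∑ q ∈ T, π (cadicBox c q.1 q.2) := by
  -- The generations `h y` may be unbounded on `E`. Truncation at `h y ≤ H` leaves finitely many
  -- boxes and, by continuity from below, more than half of the guaranteed mass.
  have hmono : Monotone fun H => E ∩ {y | h y ≤ H} := fun H H' hH =>
    inter_subset_inter_right _ fun y hy => le_trans hy hH
  have hU : (⋃ H, E ∩ {y | h y ≤ H}) = E := by
    rw [← inter_iUnion]
    exact inter_eq_left.2 fun y _ => mem_iUnion.2 ⟨h y, le_refl (h y)⟩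
  have hlim := tendsto_measure_iUnion_atTop (μ := π) hmono
  rw [hU] at hlim
  have hlt : ENNReal.ofReal (1 / 2) < π E := by
    refine lt_of_lt_of_le ?_ hπE
    rw [← ENNReal.ofReal_one]
    exact (ENNReal.ofReal_lt_ofReal_iff one_pos).2 (by norm_num)
  obtain ⟨H, hH⟩ := (hlim.eventually_const_lt hlt).exists
  dsimp only [Function.comp] at hH
  obtain ⟨T, hTQ, hTd, hTc⟩ := exists_disjoint_boxes hc
    ((fun y => (h y, indexOf c (h y) y)) '' (E ∩ {y | h y ≤ H}))
  have hfin : T.Finite := by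
    refine Set.Finite.subset (((Finset.range (H + 1)).finite_toSet.prod
      (Fintype.piFinset fun _ : Fin d => Finset.range (c ^ H)).finite_toSet)) fun q hq => ?_
    obtain ⟨y, ⟨hyE, hy⟩, rfl⟩ := hTQ hq
    have hy' : h y ≤ H := hy
    refine ⟨by simpa using Nat.lt_succ_of_le hy', ?_⟩
    refine Finset.mem_coe.2 (Fintype.mem_piFinset.2 fun i => Finset.mem_range.2 ?_)
    exact (isIndex_indexOf hc (h y) (hE hyE) i).trans_le (Nat.pow_le_pow_right (by omega) hy')
  refine ⟨hfin.toFinset, fun q hq => ?_, by rwa [hfin.coe_toFinset], hH.le.trans ?_⟩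
  · obtain ⟨y, ⟨hyE, -⟩, rfl⟩ := hTQ (hfin.mem_toFinset.1 hq)
    exact ⟨y, hyE, rfl⟩
  · rw [← measure_biUnion_finset (by rwa [hfin.coe_toFinset])
      fun q _ => measurableSet_cadicBox _ _]
    refine measure_mono fun y hy => ?_
    have := hTc _ (mem_image_of_mem _ hy)
      (mem_cadicBox_indexOf hc (h y) ((mem_cadicBox_iff hc).1 (hE hy.1)).1)
    simpa using this

lemma tendsto_mul_side_rpow (hc : 2 ≤ c) {a : ℝ} (ha : 0 < a) (A : ℝ) :
    Tendsto (fun i : ℕ => A * (i * side c i ^ a)) atTop (𝓝 0) := by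
  have hc1 : (1 : ℝ) < c := by exact_mod_cast (by omega : 1 < c)
  have h : ∀ i : ℕ, side c i ^ a = ((c : ℝ) ^ (-a)) ^ i := by
    intro i
    rw [side_rpow, ← Real.rpow_natCast, ← Real.rpow_mul (by positivity)]
    congr 1; ring
  simp only [h]
  rw [← mul_zero A]
  refine Tendsto.const_mul _ (tendsto_self_mul_const_pow_of_lt_one (by positivity) ?_)
  exact Real.rpow_lt_one_of_one_lt_of_neg hc1 (by linarith)

/-- Each chosen `y` has a box `Q` of side comparable to `c ^ (-ρ j)`, where `j` is a scale at which
there are many balls near `y`; finitely many disjoint `Q` carry half of the mass, and `π(Q)`,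
normalized, is spread uniformly over these balls. A box is tested separately against the `Q` that
are no larger than it, where `π` itself decides, and against the larger ones, where `rpow_estimate`
does. The gap `s < s₂` pays for the number of generations of larger `Q`. -/
theorem exists_measure_near (hc : 2 ≤ c) {ρ δ s s₁ s₂ κ : ℝ} (hρ0 : 0 < ρ) (hρ1 : ρ ≤ 1)
    (hδ : 1 ≤ δ) (hs : 0 ≤ s) (hss₂ : s < s₂) (hs₁ : s₂ ≤ s₁) (hs₁d : s₁ ≤ d)
    (hκ : κ ≤ ρ * (s₁ - s₂)) (hδs : δ * s₂ ≤ d * (1 - ρ) + ρ * s₁ - κ)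
    {π : Measure (Fin d → ℝ)} {E : Set (Fin d → ℝ)} (hE : E ⊆ cadicBox c 0 (0 : Fin d → ℕ))
    (hπE : 1 ≤ π E) {B : ℝ} (hB : 1 ≤ B)
    (hbox : ∀ i k, (E ∩ cadicBox c i k).Nonempty →
      π (cadicBox c i k) ≤ ENNReal.ofReal (B * side c i ^ s₁))
    {G : Set (Fin d → ℝ)} (hG : ∀ y ∈ E, ∃ᶠ j in atTop, HasManyBalls c ρ δ κ G y j)
    {r₀ : ℝ} (hr₀ : 0 < r₀) :
    ∃ θ : Measure (Fin d → ℝ), (∃ D : ℝ≥0, θ ≤ D • (volume : Measure (Fin d → ℝ))) ∧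
      θ univ = 1 ∧ (∃ A, IsCompact A ∧ A ⊆ G ∧ (∀ z ∈ A, ∃ y ∈ E, dist z y ≤ r₀) ∧ θ Aᶜ = 0) ∧
      ∀ i k, θ (cadicBox c i k) ≤ ENNReal.ofReal (3 * 3 ^ d * B * side c i ^ s) := by
  classical
  have hc1 : (1 : ℝ) < c := by exact_mod_cast (by omega : 1 < c)
  have hc0 : (0 : ℝ) < c := by positivity
  have hc2 : (2 : ℝ) ≤ c := by exact_mod_cast hc
  -- the choice of the scales
  set M := 3 ^ d * (c : ℝ) ^ (3 * (d : ℝ)) with hM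
  -- From generation `i₀` on, the gain `side c i ^ (s₂ - s)` absorbs all constants and the factor `i
  -- * 3 ^ d`, the largest possible number of relevant boxes `Q` coarser than `i`.
  obtain ⟨i₀, hi₀⟩ := eventually_atTop.1 ((tendsto_mul_side_rpow hc (sub_pos.2 hss₂)
    (3 ^ d * (2 * B * M))).eventually_le_const one_pos)
  have hρlim : Tendsto (fun j : ℕ => ρ * j) atTop atTop :=
    tendsto_natCast_atTop_atTop.const_mul_atTop hρ0
  obtain ⟨R, hR⟩ := eventually_atTop.1 (hρlim.eventually_ge_atTop ((i₀ : ℝ) + 2))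
  have hside : ∀ᶠ j : ℕ in atTop, side c (⌊ρ * j⌋₊ - 1) ≤ r₀ := by
    have h1 : Tendsto (fun j : ℕ => ⌊ρ * j⌋₊ - 1) atTop atTop :=
      (tendsto_sub_atTop_nat 1).comp (tendsto_nat_floor_atTop.comp hρlim)
    exact ((tendsto_side hc).comp h1).eventually_le_const hr₀
  obtain ⟨R', hR'⟩ := eventually_atTop.1 hside
  have hsel : ∀ y, ∃ j, y ∈ E → max R R' ≤ j ∧ HasManyBalls c ρ δ κ G y j := by
    intro y
    by_cases hy : y ∈ E
    · obtain ⟨j, h1, h2⟩ := ((hG y hy).and_eventually (eventually_ge_atTop (max R R'))).exists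
      exact ⟨j, fun _ => ⟨h2, h1⟩⟩
    · exact ⟨0, fun h => absurd h hy⟩
  choose j hj using hsel
  -- The `- 1` leaves a factor `c ≥ 2`: the distance from `y` to a centre and the radius of the ball
  -- are each at most `c ^ (-ρ j)`, and their sum is at most `side c (h y)`.
  set h : (Fin d → ℝ) → ℕ := fun y => ⌊ρ * j y⌋₊ - 1 with hh
  have hfl : ∀ y ∈ E, (i₀ : ℝ) + 2 ≤ ρ * j y := fun y hy =>
    hR _ ((le_max_left _ _).trans (hj y hy).1)
  have hh1 : ∀ y ∈ E, (h y : ℝ) + 1 ≤ ρ * j y ∧ ρ * j y ≤ h y + 2 ∧ i₀ ≤ h y := by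
    intro y hy
    have h1 := hfl y hy
    have h2 : i₀ + 2 ≤ ⌊ρ * j y⌋₊ := Nat.le_floor (by push_cast; exact h1)
    have h3 : (h y : ℝ) + 1 = ⌊ρ * j y⌋₊ := by
      have : h y + 1 = ⌊ρ * j y⌋₊ := by simp only [hh]; omega
      exact_mod_cast this
    have h4 := Nat.floor_le (a := ρ * j y) (by positivity)
    have h5 := Nat.lt_floor_add_one (ρ * j y)
    refine ⟨by linarith, by linarith, by simp only [hh]; omega⟩
  have hhr : ∀ y ∈ E, side c (h y) ≤ r₀ := fun y hy =>
    hR' _ ((le_max_right _ _).trans (hj y hy).1)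
  have hF : ∀ y, ∃ F : Finset (Fin d → ℝ), y ∈ E →
      (c : ℝ) ^ (j y * (d * (1 - ρ) - κ)) ≤ F.card ∧
      (∀ p ∈ F, dist p y ≤ (c : ℝ) ^ (-(ρ * j y)) ∧
        Metric.closedBall p ((c : ℝ) ^ (-(j y * δ))) ⊆ G) ∧
      (F : Set (Fin d → ℝ)).PairwiseDisjoint fun p => Metric.closedBall p (side c (j y)) := by
    intro y
    by_cases hy : y ∈ E
    · obtain ⟨F, hF⟩ := (hj y hy).2
      exact ⟨F, fun _ => hF⟩
    · exact ⟨∅, fun h => absurd h hy⟩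
  choose F hF using hF
  set r : (Fin d → ℝ) → ℝ := fun y => (c : ℝ) ^ (-(j y * δ)) with hr
  have hr0 : ∀ y, 0 < r y := fun y => by simp only [hr]; positivity
  have hFne : ∀ y ∈ E, (F y).Nonempty := by
    intro y hy
    rw [← Finset.card_pos]
    have : (0 : ℝ) < (F y).card := lt_of_lt_of_le (by positivity) (hF y hy).1
    exact_mod_cast this
  have hnear : ∀ y ∈ E, ∀ p ∈ F y, ∀ z ∈ Metric.closedBall p (r y), dist z y ≤ side c (h y) := by
    intro y hy p hp z hz
    have h1 := ((hF y hy).2.1 p hp).1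
    have h2 : r y ≤ (c : ℝ) ^ (-(ρ * j y)) := by
      simp only [hr]
      apply Real.rpow_le_rpow_of_exponent_le hc1.le
      have : (0 : ℝ) ≤ j y := by positivity
      nlinarith
    have h3 : 2 * (c : ℝ) ^ (-(ρ * j y)) ≤ side c (h y) := by
      calc 2 * (c : ℝ) ^ (-(ρ * j y)) ≤ (c : ℝ) ^ (1 : ℝ) * (c : ℝ) ^ (-(ρ * j y)) := by
            rw [Real.rpow_one]; gcongr
        _ = (c : ℝ) ^ (1 + -(ρ * j y)) := (Real.rpow_add hc0 _ _).symm
        _ ≤ side c (h y) := by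
            rw [side_eq_rpow]
            apply Real.rpow_le_rpow_of_exponent_le hc1.le
            linarith [(hh1 y hy).1]
    have h4 := dist_triangle z p y
    rw [Metric.mem_closedBall] at hz
    linarith
  obtain ⟨T, hTE, hTd, hTm⟩ := exists_finite_boxes hc hE hπE h
  have hTE' : ∀ q, ∃ y, q ∈ T → y ∈ E ∧ q = (h y, indexOf c (h y) y) := by
    intro q
    by_cases hq : q ∈ T
    · obtain ⟨y, hy⟩ := hTE q hq
      exact ⟨y, fun _ => hy⟩
    · exact ⟨0, fun h => absurd h hq⟩
  choose Y hY using hTE'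
  have hYE : ∀ q ∈ T, Y q ∈ E := fun q hq => (hY q hq).1
  have hq1 : ∀ q ∈ T, q.1 = h (Y q) := fun q hq => congrArg Prod.fst (hY q hq).2
  have hq2 : ∀ q ∈ T, q.2 = indexOf c q.1 (Y q) := fun q hq => by
    rw [hq1 q hq]; exact congrArg Prod.snd (hY q hq).2
  have hY0 : ∀ q ∈ T, ∀ i, 0 ≤ Y q i := fun q hq =>
    ((mem_cadicBox_iff hc).1 (hE (hYE q hq))).1
  have hYbox : ∀ q ∈ T, Y q ∈ cadicBox c q.1 q.2 := fun q hq => by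
    rw [hq2 q hq]; exact mem_cadicBox_indexOf hc _ (hY0 q hq)
  -- the weights
  set W := ∑ q ∈ T, π (cadicBox c q.1 q.2) with hW
  have hπfin : ∀ q ∈ T, π (cadicBox c q.1 q.2) ≠ ⊤ := fun q hq =>
    ((hbox q.1 q.2 ⟨Y q, hYE q hq, hYbox q hq⟩).trans_lt ENNReal.ofReal_lt_top).ne
  have hWfin : W ≠ ⊤ := ENNReal.sum_ne_top.2 hπfin
  have hW0 : W ≠ 0 := by
    intro h0
    rw [h0] at hTm
    have := ENNReal.ofReal_eq_zero.1 (le_antisymm hTm zero_le)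
    norm_num at this
  have hWinv : W⁻¹ ≤ 2 := by
    rw [ENNReal.inv_le_iff_inv_le]
    refine le_trans (le_of_eq ?_) hTm
    rw [one_div, ENNReal.ofReal_inv_of_pos two_pos]; simp
  set v : ℕ × (Fin d → ℕ) → ℝ≥0∞ := fun q => W⁻¹ * π (cadicBox c q.1 q.2) with hv
  have hv2 : ∀ q, v q ≤ 2 * π (cadicBox c q.1 q.2) := fun q => by simp only [hv]; gcongr
  have hvsum : ∑ q ∈ T, v q = 1 := by
    simp only [hv]
    rw [← Finset.mul_sum, ← hW, ENNReal.inv_mul_cancel hW0 hWfin]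
  have hv1 : ∀ q ∈ T, v q ≤ 1 := fun q hq => hvsum ▸ Finset.single_le_sum (fun _ _ => zero_le) hq
  set θ : Measure (Fin d → ℝ) := ∑ q ∈ T, v q • unif (F (Y q)) (r (Y q)) with hθ
  have happ : ∀ S, θ S = ∑ q ∈ T, v q * unif (F (Y q)) (r (Y q)) S := by
    intro S; simp [hθ, Measure.finsetSum_apply]
  have hunif1 : ∀ q ∈ T, unif (F (Y q)) (r (Y q)) univ = 1 := fun q hq =>
    unif_univ (hFne _ (hYE q hq)) (hr0 _)
  choose D hD using fun q : ℕ × (Fin d → ℕ) => unif_le (F (Y q)) (r (Y q))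
  refine ⟨θ, ⟨∑ q ∈ T, D q, Measure.le_iff.2 fun S _ => ?_⟩, ?_,
    ⟨⋃ q ∈ T, ⋃ p ∈ F (Y q), Metric.closedBall p (r (Y q)), ?_, ?_, ?_, ?_⟩, ?_⟩
  · rw [happ, Measure.smul_apply, Finset.sum_smul]
    refine Finset.sum_le_sum fun q hq => ?_
    calc _ ≤ 1 * unif (F (Y q)) (r (Y q)) S := by gcongr; exact hv1 q hq
      _ ≤ _ := by rw [one_mul]; exact hD q S
  · rw [happ, Finset.sum_congr rfl fun q hq => by rw [hunif1 q hq, mul_one], hvsum]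
  · exact Finset.isCompact_biUnion _ fun q _ => Finset.isCompact_biUnion _ fun p _ =>
      isCompact_closedBall _ _
  · exact iUnion₂_subset fun q hq => iUnion₂_subset fun p hp =>
      ((hF _ (hYE q hq)).2.1 p hp).2
  · intro z hz
    simp only [mem_iUnion, exists_prop] at hz
    obtain ⟨q, hq, p, hp, hz⟩ := hz
    exact ⟨Y q, hYE q hq, (hnear _ (hYE q hq) p hp z hz).trans (hhr _ (hYE q hq))⟩
  · rw [happ]
    refine Finset.sum_eq_zero fun q hq => ?_
    rw [measure_mono_null _ (unif_compl (F (Y q)) (r (Y q))), mul_zero]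
    exact compl_subset_compl.2 (subset_biUnion_of_mem
      (u := fun q => ⋃ p ∈ F (Y q), Metric.closedBall p (r (Y q))) hq)
  intro i k
  have hmeet : ∀ q ∈ T, unif (F (Y q)) (r (Y q)) (cadicBox c i k) ≠ 0 →
      ∃ z ∈ cadicBox c i k, dist z (Y q) ≤ side c q.1 := by
    intro q hq hne
    have : (cadicBox c i k ∩ ⋃ p ∈ F (Y q), Metric.closedBall p (r (Y q))).Nonempty := by
      apply nonempty_of_measure_ne_zero (μ := unif (F (Y q)) (r (Y q)))
      rwa [measure_inter_conull (unif_compl _ _)]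
    obtain ⟨z, hz, hz'⟩ := this
    simp only [mem_iUnion, exists_prop] at hz'
    obtain ⟨p, hp, hz'⟩ := hz'
    exact ⟨z, hz, hq1 q hq ▸ hnear _ (hYE q hq) p hp z hz'⟩
  set T₀ := T.filter fun q => unif (F (Y q)) (r (Y q)) (cadicBox c i k) ≠ 0 with hT₀
  have hsplit : θ (cadicBox c i k) =
      ∑ q ∈ T₀ with i ≤ q.1, v q * unif (F (Y q)) (r (Y q)) (cadicBox c i k) +
      ∑ q ∈ T₀ with ¬ i ≤ q.1, v q * unif (F (Y q)) (r (Y q)) (cadicBox c i k) := by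
    rw [Finset.sum_filter_add_sum_filter_not, happ]
    refine (Finset.sum_subset (Finset.filter_subset _ _) fun q hq hq' => ?_).symm
    have : unif (F (Y q)) (r (Y q)) (cadicBox c i k) = 0 := by
      by_contra hne
      exact hq' (Finset.mem_filter.2 ⟨hq, hne⟩)
    rw [this, mul_zero]
  have hsi := side_pos hc i
  -- Boxes `Q` no larger than the tested box: if their balls meet it, they lie in its neighbours.
  -- They are disjoint, so their total mass is controlled by `π` on those neighbours that meet `E`.
  have hpart1 : ∑ q ∈ T₀ with i ≤ q.1, v q * unif (F (Y q)) (r (Y q)) (cadicBox c i k) ≤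
      ENNReal.ofReal (2 * 3 ^ d * B * side c i ^ s) := by
    set T₁ := T₀.filter fun q => i ≤ q.1 with hT₁
    have hT₁T : T₁ ⊆ T := (Finset.filter_subset _ _).trans (Finset.filter_subset _ _)
    calc _ ≤ ∑ q ∈ T₁, 2 * π (cadicBox c q.1 q.2) := by
          refine Finset.sum_le_sum fun q hq => ?_
          calc _ ≤ v q * unif (F (Y q)) (r (Y q)) univ := by gcongr; exact subset_univ _
            _ ≤ _ := by rw [hunif1 q (hT₁T hq), mul_one]; exact hv2 q
      _ = 2 * π (⋃ q ∈ T₁, cadicBox c q.1 q.2) := by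
          rw [← Finset.mul_sum, measure_biUnion_finset
            (hTd.subset (Finset.coe_subset.2 hT₁T)) fun q _ => measurableSet_cadicBox _ _]
      _ ≤ 2 * π (⋃ k' ∈ (nearIndices 1 k).filter fun k' => (E ∩ cadicBox c i k').Nonempty,
            cadicBox c i k') := by
          gcongr
          refine iUnion₂_subset fun q hq => ?_
          have hq' := Finset.mem_filter.1 hq
          have hqT := hT₁T hq
          obtain ⟨z, hz, hzY⟩ := hmeet q hqT (Finset.mem_filter.1 hq'.1).2
          have hzi := (mem_cadicBox_iff hc).1 hz
          have hYi := mem_cadicBox_indexOf hc i (hY0 q hqT)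
          refine (cadicBox_subset_of_mem hc hq'.2 hYi (hYbox q hqT)).trans ?_
          refine subset_biUnion_of_mem (u := fun k' => cadicBox c i k') ?_
          refine Finset.mem_coe.2 (Finset.mem_filter.2 ⟨?_, ⟨Y q, hYE q hqT, hYi⟩⟩)
          rw [mem_nearIndices, ← hzi.2]
          refine abs_indexOf_sub_le hc (M := 1) (hY0 q hqT) hzi.1 ?_
          rw [dist_comm, Nat.cast_one, one_mul]
          exact hzY.trans (side_anti hc hq'.2)
      _ ≤ 2 * ∑ k' ∈ (nearIndices 1 k).filter fun k' => (E ∩ cadicBox c i k').Nonempty,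
            ENNReal.ofReal (B * side c i ^ s₁) := by
          gcongr
          refine (measure_biUnion_finset_le _ _).trans (Finset.sum_le_sum fun k' hk' => ?_)
          exact hbox i k' (Finset.mem_filter.1 hk').2
      _ ≤ 2 * (ENNReal.ofReal (3 ^ d) * ENNReal.ofReal (B * side c i ^ s)) := by
          rw [Finset.sum_const, nsmul_eq_mul]
          gcongr 2 * (?_ * ?_)
          · rw [← ENNReal.ofReal_natCast]
            apply ENNReal.ofReal_le_ofReal
            exact_mod_cast (Finset.card_filter_le _ _).trans (card_nearIndices_le 1 k)
          · apply ENNReal.ofReal_le_ofReal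
            gcongr ?_ * ?_
            exact Real.rpow_le_rpow_of_exponent_ge hsi (side_le_one hc i) (by linarith)
      _ = _ := by
          rw [← ENNReal.ofReal_mul (by positivity), ← ENNReal.ofReal_ofNat,
            ← ENNReal.ofReal_mul (by positivity)]
          congr 1; ring
  -- Boxes `Q` larger than the tested box: at each generation at most `3 ^ d` of them are close
  -- enough, and each contributes at most a constant times `side c i ^ s₂`.
  have hpart2 : ∑ q ∈ T₀ with ¬ i ≤ q.1, v q * unif (F (Y q)) (r (Y q)) (cadicBox c i k) ≤
      ENNReal.ofReal (3 ^ d * B * side c i ^ s) := by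
    set T₂ := T₀.filter fun q => ¬ i ≤ q.1 with hT₂
    have hT₂T : T₂ ⊆ T := (Finset.filter_subset _ _).trans (Finset.filter_subset _ _)
    rcases T₂.eq_empty_or_nonempty with h0 | ⟨q₀, hq₀⟩
    · rw [h0, Finset.sum_empty]; exact zero_le
    have hi : i₀ ≤ i := by
      have h1 := (hh1 _ (hYE q₀ (hT₂T hq₀))).2.2
      have h2 := (Finset.mem_filter.1 hq₀).2
      rw [hq1 q₀ (hT₂T hq₀)] at h2
      omega
    have hterm : ∀ q ∈ T₂, v q * unif (F (Y q)) (r (Y q)) (cadicBox c i k) ≤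
        ENNReal.ofReal (2 * B * M * side c i ^ s₂) := by
      intro q hq
      have hqT := hT₂T hq
      have hqi : q.1 < i := not_le.1 (Finset.mem_filter.1 hq).2
      have hyE := hYE q hqT
      have hrR : r (Y q) ≤ side c (j (Y q)) := by
        rw [side_eq_rpow]
        apply Real.rpow_le_rpow_of_exponent_le hc1.le
        have : (0 : ℝ) ≤ j (Y q) := by positivity
        nlinarith
      have hu := unif_cadicBox_le hc (hr0 (Y q)) hrR (hFne _ hyE) (s := s₂) (by linarith)
        (by linarith) (hF _ hyE).2.2 i k
      have hest := rpow_estimate hc (s₁ := s₁) (s₂ := s₂) (N := (F (Y q)).card) (i := i)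
        (j := j (Y q)) (h := q.1) (by linarith) hs₁d (by linarith) (by linarith) hκ hδs hqi
        (by rw [hq1 q hqT]; exact (hh1 _ hyE).2.1) (hF _ hyE).1
      calc _ ≤ (2 * ENNReal.ofReal (B * side c q.1 ^ s₁)) * _ := by
            refine mul_le_mul' ((hv2 q).trans ?_) hu
            gcongr
            exact hbox q.1 q.2 ⟨Y q, hyE, hYbox q hqT⟩
        _ = ENNReal.ofReal (2 * B * (side c q.1 ^ s₁ *
            ((3 * max (side c i) (side c (j (Y q))) / side c (j (Y q))) ^ d / (F (Y q)).card *
              min 1 ((side c i / r (Y q)) ^ s₂)))) := by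
            have := side_pos hc q.1
            rw [← ENNReal.ofReal_ofNat, ← ENNReal.ofReal_mul (by positivity),
              ← ENNReal.ofReal_mul (by positivity)]
            congr 1; ring
        _ ≤ _ := by
            apply ENNReal.ofReal_le_ofReal
            rw [mul_assoc (2 * B) M]
            gcongr
    have hcard : T₂.card ≤ i * 3 ^ d := by
      have hsub : T₂ ⊆ (Finset.range i).biUnion fun h =>
          (nearIndices 1 (ancestor c h i k)).image fun k' => (h, k') := by
        intro q hq
        have hqT := hT₂T hq
        have hqi : q.1 < i := not_le.1 (Finset.mem_filter.1 hq).2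
        obtain ⟨z, hz, hzY⟩ := hmeet q hqT
          (Finset.mem_filter.1 (Finset.mem_filter.1 hq).1).2
        have hzi := (mem_cadicBox_iff hc).1 hz
        simp only [Finset.mem_biUnion, Finset.mem_range, Finset.mem_image]
        refine ⟨q.1, hqi, q.2, ?_, rfl⟩
        rw [mem_nearIndices, ← hzi.2, ancestor_indexOf hc hqi.le, hq2 q hqT]
        refine abs_indexOf_sub_le hc (M := 1) (hY0 q hqT) hzi.1 ?_
        rwa [dist_comm, Nat.cast_one, one_mul]
      refine (Finset.card_le_card hsub).trans (Finset.card_biUnion_le.trans ?_)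
      refine (Finset.sum_le_card_nsmul _ _ (3 ^ d) fun h _ => ?_).trans (by simp)
      exact Finset.card_image_le.trans (card_nearIndices_le 1 _)
    calc _ ≤ ∑ q ∈ T₂, ENNReal.ofReal (2 * B * M * side c i ^ s₂) := Finset.sum_le_sum hterm
      _ ≤ ENNReal.ofReal (i * 3 ^ d) * ENNReal.ofReal (2 * B * M * side c i ^ s₂) := by
          rw [Finset.sum_const, nsmul_eq_mul]
          gcongr
          rw [← ENNReal.ofReal_natCast]
          apply ENNReal.ofReal_le_ofReal
          exact_mod_cast hcard
      _ = ENNReal.ofReal (3 ^ d * (2 * B * M) * (i * side c i ^ (s₂ - s)) * side c i ^ s) := by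
          rw [← ENNReal.ofReal_mul (by positivity)]
          congr 1
          have : side c i ^ s₂ = side c i ^ (s₂ - s) * side c i ^ s := by
            rw [← Real.rpow_add hsi]; congr 1; ring
          rw [this]; ring
      _ ≤ _ := by
          apply ENNReal.ofReal_le_ofReal
          have h1 := hi₀ i hi
          have h2 : (1 : ℝ) ≤ 3 ^ d * B :=
            one_le_mul_of_one_le_of_one_le (one_le_pow₀ (by norm_num)) hB
          have h3 : 0 ≤ side c i ^ s := by positivity
          exact mul_le_mul_of_nonneg_right (h1.trans h2) h3
  calc θ (cadicBox c i k) ≤ ENNReal.ofReal (2 * 3 ^ d * B * side c i ^ s) +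
        ENNReal.ofReal (3 ^ d * B * side c i ^ s) := by
        rw [hsplit]; exact add_le_add hpart1 hpart2
    _ = _ := by
        rw [← ENNReal.ofReal_add (by positivity) (by positivity)]
        congr 1; ring

/-! ### Corrections -/

lemma IsCorrection.nonneg {f : ℝ → ℝ} (hf : IsCorrection f) {r : ℝ} (hr : 0 ≤ r) : 0 ≤ f r := by
  rw [← hf.zero]
  exact hf.monotone (mem_Ici.2 le_rfl) (mem_Ici.2 hr) hr

lemma IsCorrection.tendsto {f : ℝ → ℝ} (hf : IsCorrection f) {ι : Type*} {l : Filter ι}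
    {u : ι → ℝ} (hu : Tendsto u l (𝓝 0)) (hu0 : ∀ i, 0 ≤ u i) :
    Tendsto (fun i => f (u i)) l (𝓝 0) := by
  have h1 : Tendsto f (𝓝[Ici 0] 0) (𝓝 0) := by
    have := hf.continuous 0 (mem_Ici.2 le_rfl)
    rwa [ContinuousWithinAt, hf.zero] at this
  exact h1.comp (tendsto_nhdsWithin_iff.2 ⟨hu, Eventually.of_forall hu0⟩)

/-- Near `0` the exponent is nonnegative because `f` tends to `0`; away from `0` it is at least `-f
1` by monotonicity. -/
lemma IsCorrection.exists_rpow_le {f : ℝ → ℝ} (hf : IsCorrection f) {η : ℝ} (hη : 0 < η) :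
    ∃ C, 1 ≤ C ∧ ∀ r, 0 < r → r ≤ 1 → r ^ (η - f r) ≤ C := by
  have h1 : ∀ᶠ r in 𝓝[>] (0 : ℝ), f r ≤ η := by
    have : Tendsto f (𝓝[>] 0) (𝓝 0) := by
      have := (hf.continuous 0 (mem_Ici.2 le_rfl)).mono Ioi_subset_Ici_self
      rwa [ContinuousWithinAt, hf.zero] at this
    exact this.eventually_le_const hη
  obtain ⟨a, ha, ha'⟩ := mem_nhdsGT_iff_exists_Ioo_subset.1 h1
  have ha0 : (0 : ℝ) < a := ha
  refine ⟨max 1 (a ^ (-f 1)), le_max_left _ _, fun r hr hr1 => ?_⟩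
  rcases lt_or_ge r a with h | h
  · have : f r ≤ η := ha' ⟨hr, h⟩
    exact (Real.rpow_le_one hr.le hr1 (by linarith)).trans (le_max_left _ _)
  · refine le_trans ?_ (le_max_right _ _)
    have h2 : f r ≤ f 1 := hf.monotone (mem_Ici.2 hr.le) (mem_Ici.2 zero_le_one) hr1
    calc r ^ (η - f r) ≤ r ^ (-f 1) :=
          Real.rpow_le_rpow_of_exponent_ge hr hr1 (by linarith)
      _ ≤ a ^ (-f 1) := Real.rpow_le_rpow_of_nonpos ha0 h
          (neg_nonpos.2 (hf.nonneg zero_le_one))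

/-! ### The measures on the boxes -/

lemma measurable_boxChart (J : ℕ) (K : Fin d → ℕ) : Measurable (boxChart c J K) := by
  unfold boxChart; fun_prop

lemma goodSet_mono (β : ℝ) (φ : ℝ → ℝ) (J : ℕ) (K : Fin d → ℕ) (mL : Measure (Fin d → ℝ)) :
    Monotone (goodSet c β φ J K mL) := fun n n' h z hz =>
  ⟨hz.1, fun j hj k hk hk' => hz.2 j (by omega) k hk hk'⟩

lemma side_div_side (hc : 2 ≤ c) (J l : ℕ) : side c (J + l) / side c J = side c l := by
  rw [side_add, mul_div_cancel_left₀ _ (side_pos hc J).ne']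

/-- Almost every point of the box lies in one of the sets of good points. -/
lemma ae_mem_iUnion_goodSet (hc : 2 ≤ c) {β : ℝ} {φ : ℝ → ℝ} {J : ℕ} {K : Fin d → ℕ}
    {m mL : Measure (Fin d → ℝ)} [IsFiniteMeasure mL]
    (hac : mL ≪ m.restrict (cadicBox c J K))
    (hloc : HasLocalMassBound c (mL.map (boxChart c J K)) β φ) :
    ∀ᵐ z ∂mL, z ∈ ⋃ n, goodSet c β φ J K mL n := by
  have h1 : ∀ᵐ z ∂mL, z ∈ cadicBox c J K :=
    hac.ae_le (ae_restrict_mem (measurableSet_cadicBox _ _))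
  have h0 : mL (cadicBox c J K)ᶜ = 0 := h1
  filter_upwards [h1, ae_of_ae_map (measurable_boxChart J K).aemeasurable hloc] with z hzL hz
  obtain ⟨j₀, hj₀⟩ := hz
  refine mem_iUnion.2 ⟨j₀, hzL, fun j hj k hk hkz => ?_⟩
  obtain ⟨l, rfl⟩ := Nat.exists_eq_add_of_le (by omega : J ≤ j)
  rw [side_div_side hc]
  have hzi := (mem_cadicBox_iff hc).1 hzL
  -- A neighbour of the box of `z` may lie outside `L`, where `mL` vanishes. Inside `L` the bound is
  -- transported by the chart, which subtracts `K i * c ^ l` from the indices.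
  by_cases hanc : ancestor c J (J + l) k = K
  · have hck : ∀ i, k i / c ^ l = K i := fun i => by
      have := congrFun hanc i
      rwa [ancestor, Nat.add_sub_cancel_left] at this
    have hcl : 0 < c ^ l := by positivity
    have hle : ∀ i, K i * c ^ l ≤ k i := fun i => by
      rw [← hck i]; exact Nat.div_mul_le_self _ _
    have hcJ : (0 : ℝ) < (c : ℝ) ^ J := by positivity
    have hchart : indexOf c l (boxChart c J K z) = fun i => indexOf c (J + l) z i - K i * c ^ l := by
      funext i
      rw [indexOf, indexOf, boxChart, ← Nat.floor_sub_natCast]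
      congr 1
      push_cast
      rw [pow_add]; ring
    have hzle : ∀ i, K i * c ^ l ≤ indexOf c (J + l) z i := fun i => by
      have := congrFun (indexOf_add hc J l z) i
      rw [hzi.2] at this
      rw [this]; exact Nat.div_mul_le_self _ _
    refine le_trans ?_ (hj₀ l (by omega) (fun i => k i - K i * c ^ l) ?_ ?_)
    · have hmp : (mL.map (boxChart c J K)).real (cadicBox c l fun i => k i - K i * c ^ l) =
          mL.real (boxChart c J K ⁻¹' cadicBox c l fun i => k i - K i * c ^ l) := by
        rw [Measure.real, Measure.map_apply (measurable_boxChart J K) (measurableSet_cadicBox _ _),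
          Measure.real]
      rw [hmp]
      refine measureReal_mono fun x hx i => ?_
      have hxi := hx i
      have hcl' : (0 : ℝ) < (c : ℝ) ^ l := by positivity
      rw [Nat.cast_sub (hle i), boxChart, div_le_iff₀ hcl', lt_div_iff₀ hcl']
      rw [pow_add, div_le_iff₀ (by positivity), lt_div_iff₀ (by positivity)] at hxi
      push_cast
      constructor <;> nlinarith [hxi.1, hxi.2]
    · intro i
      have h2 : k i < (K i + 1) * c ^ l := by
        rw [← hck i]; exact Nat.lt_mul_of_div_lt (Nat.lt_succ_self _) hcl
      have := hle i
      dsimp only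
      rw [add_mul, one_mul] at h2
      omega
    · intro i
      rw [hchart]
      have h1 := hkz i
      have h2 := hle i
      have h3 := hzle i
      rw [abs_le] at h1 ⊢
      dsimp only
      push_cast [Nat.cast_sub h2, Nat.cast_sub h3]
      constructor <;> linarith [h1.1, h1.2]
  · have : mL (cadicBox c (J + l) k) = 0 := by
      refine measure_mono_null ?_ h0
      refine (cadicBox_subset_ancestor hc (Nat.le_add_right J l) k).trans ?_
      exact (disjoint_cadicBox hc hanc).subset_compl_right
    rw [Measure.real, this, ENNReal.toReal_zero]
    exact Real.rpow_nonneg (side_pos hc l).le _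

/-- The infimum is attained only if its set is non-empty, since `sInf ∅ = 0` in `ℕ`. Non-emptiness
holds because the good sets increase to almost all of `L`. -/
lemma growthIndex_spec (hc : 2 ≤ c) {β : ℝ} {φ : ℝ → ℝ} {J : ℕ} {K : Fin d → ℕ}
    {m mL : Measure (Fin d → ℝ)} [IsFiniteMeasure mL]
    (hac : mL ≪ m.restrict (cadicBox c J K))
    (hloc : HasLocalMassBound c (mL.map (boxChart c J K)) β φ) (hpos : 0 < mL.real univ) :
    mL.real univ / 2 ≤ mL.real (goodSet c β φ J K mL (growthIndex c β φ J K mL)) := by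
  have h1 : mL (⋃ n, goodSet c β φ J K mL n) = mL univ :=
    measure_congr (eventuallyEq_univ.2 (ae_mem_iUnion_goodSet hc hac hloc))
  have h2 := tendsto_measure_iUnion_atTop (μ := mL) (goodSet_mono (c := c) β φ J K mL)
  rw [h1] at h2
  have h3 : Tendsto (fun n => mL.real (goodSet c β φ J K mL n)) atTop (𝓝 (mL.real univ)) :=
    (ENNReal.tendsto_toReal (measure_ne_top _ _)).comp h2
  obtain ⟨n, hn, hn1⟩ := ((h3.eventually_const_le (half_lt_self hpos)).and
    (eventually_ge_atTop 1)).exists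
  have hne : {n | 1 ≤ n ∧ mL.real univ / 2 ≤ mL.real (goodSet c β φ J K mL n)}.Nonempty :=
    ⟨n, hn1, hn⟩
  exact (Nat.sInf_mem hne).2

/-- The measures on the boxes, normalized, have the power law `s₁ < β` around the points of a set of
measure one, up to a factor that is barely larger than the power `-s₁` of the side of the box. -/
theorem eventually_exists_normalized (hc : 2 ≤ c) {β s₁ t : ℝ} {φ : ℝ → ℝ}
    (hφ : IsCorrection φ) {m : Measure (Fin d → ℝ)}
    {mL : ℕ → (Fin d → ℕ) → Measure (Fin d → ℝ)}
    (h3 : ∀ (J : ℕ) (K : Fin d → ℕ), IsIndex c J K →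
      IsFiniteMeasure (mL J K) ∧ mL J K ≪ m.restrict (cadicBox c J K) ∧
      HasLocalMassBound c ((mL J K).map (boxChart c J K)) β φ)
    (h4 : ∃ Jm : ℕ, ∀ J ≥ Jm, ∀ K : Fin d → ℕ, IsIndex c J K →
      (growthIndex c β φ J K (mL J K) : ℝ) ≤ (J : ℝ) * φ (side c J) ∧
      side c J ^ φ (side c J) ≤ (mL J K).real univ)
    (hs₁ : 0 ≤ s₁) (hs₁β : s₁ < β) (ht : s₁ < t) :
    ∀ᶠ J in atTop, ∀ K, IsIndex c J K → ∃ (π : Measure (Fin d → ℝ)) (E : Set (Fin d → ℝ)),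
      π ≪ m ∧ 1 ≤ π E ∧ E ⊆ cadicBox c J K ∧ ∀ i k, (E ∩ cadicBox c i k).Nonempty →
        π (cadicBox c i k) ≤ ENNReal.ofReal ((c : ℝ) ^ (J * t) * side c i ^ s₁) := by
  have hc1 : (1 : ℝ) < c := by exact_mod_cast (by omega : 1 < c)
  have hc0 : (0 : ℝ) < c := by positivity
  obtain ⟨C, hC1, hC⟩ := hφ.exists_rpow_le (sub_pos.2 hs₁β)
  obtain ⟨Jm, hJm⟩ := h4
  have hφ0 : Tendsto (fun J : ℕ => φ (side c J)) atTop (𝓝 0) :=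
    hφ.tendsto (tendsto_side hc) fun j => (side_pos hc j).le
  -- the exponents that have to dominate constants
  have hlim : Tendsto (fun J : ℕ => (c : ℝ) ^ (J * (t - s₁ - φ (side c J) * (1 + s₁)))) atTop
      atTop := by
    refine (tendsto_rpow_atTop_of_base_gt_one _ hc1).comp ?_
    refine Tendsto.atTop_mul_pos (C := t - s₁) (by linarith) tendsto_natCast_atTop_atTop ?_
    have := (tendsto_const_nhds (x := t - s₁)).sub (hφ0.mul_const (1 + s₁))
    simpa using this
  filter_upwards [eventually_ge_atTop Jm, hlim.eventually_ge_atTop (2 * C)] with J hJ hJC K hK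
  obtain ⟨hfin, hac, hloc⟩ := h3 J K hK
  obtain ⟨hn, hmass⟩ := hJm J hJ K hK
  have hφJ : 0 ≤ φ (side c J) := hφ.nonneg (side_pos hc J).le
  have hJ0 : (0 : ℝ) ≤ J := by positivity
  have hpos : 0 < (mL J K).real univ :=
    lt_of_lt_of_le (Real.rpow_pos_of_pos (side_pos hc J) _) hmass
  have hspec := growthIndex_spec hc hac hloc hpos
  set n := growthIndex c β φ J K (mL J K) with hndef
  -- The factor `2` compensates for the good set having only half of the mass. Condition (4') bounds
  -- the normalization by `2 * c ^ (J * φ (side c J))`, a small power of the side.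
  set w := 2 / (mL J K).real univ with hw
  have hw0 : 0 < w := by positivity
  have hwle : w ≤ 2 * (c : ℝ) ^ (J * φ (side c J)) := by
    rw [hw, div_le_iff₀ hpos]
    rw [side_rpow, Real.rpow_neg hc0.le, inv_le_iff_one_le_mul₀' (by positivity)] at hmass
    linarith
  refine ⟨ENNReal.ofReal w • mL J K, goodSet c β φ J K (mL J K) n, ?_, ?_, fun z hz => hz.1, ?_⟩
  · exact Measure.smul_absolutelyContinuous.trans
      (hac.trans Measure.restrict_le_self.absolutelyContinuous)
  · rw [Measure.smul_apply, smul_eq_mul, ← ofReal_measureReal, ← ENNReal.ofReal_mul hw0.le,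
      ← ENNReal.ofReal_one]
    apply ENNReal.ofReal_le_ofReal
    calc (1 : ℝ) = w * ((mL J K).real univ / 2) := by rw [hw]; field_simp
      _ ≤ _ := by gcongr
  · rintro i k ⟨z, hz, hzk⟩
    rw [Measure.smul_apply, smul_eq_mul, ← ofReal_measureReal, ← ENNReal.ofReal_mul hw0.le]
    apply ENNReal.ofReal_le_ofReal
    have hz0 := hK.subset hc hz.1
    -- At generations past `n + J` the definition of the good set applies. The coarser ones are
    -- handled by the total mass `2`: since `n ≤ J * φ (side c J)`, their sides are not much smaller
    -- than that of `L`, and `t > s₁` makes the right-hand side large.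
    rcases le_or_gt (n + J) i with hi | hi
    · obtain ⟨l, rfl⟩ := Nat.exists_eq_add_of_le (by omega : J ≤ i)
      have hmk := hz.2 (J + l) hi k (isIndex_of_mem hc hz0 hzk) (by
        rw [((mem_cadicBox_iff hc).1 hzk).2]; intro i; simp)
      rw [side_div_side hc] at hmk
      have hsl := side_pos hc l
      calc w * (mL J K).real (cadicBox c (J + l) k)
          ≤ (2 * (c : ℝ) ^ (J * φ (side c J))) * side c l ^ (β - φ (side c l)) := by gcongr
        _ = (2 * (c : ℝ) ^ (J * φ (side c J))) *
            (side c l ^ (β - s₁ - φ (side c l)) * side c l ^ s₁) := by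
            rw [← Real.rpow_add hsl]; congr 2; ring
        _ ≤ (2 * (c : ℝ) ^ (J * φ (side c J))) * (C * side c l ^ s₁) := by
            gcongr
            exact hC _ hsl (side_le_one hc l)
        _ = (2 * C) * ((c : ℝ) ^ (J * φ (side c J)) * side c l ^ s₁) := by ring
        _ ≤ (c : ℝ) ^ (J * (t - s₁ - φ (side c J) * (1 + s₁))) *
            ((c : ℝ) ^ (J * φ (side c J)) * side c l ^ s₁) := by gcongr
        _ ≤ _ := by
            rw [side_rpow, side_rpow, ← Real.rpow_add hc0, ← Real.rpow_add hc0,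
              ← Real.rpow_add hc0]
            apply Real.rpow_le_rpow_of_exponent_le hc1.le
            push_cast
            nlinarith [mul_nonneg hJ0 (mul_nonneg hφJ hs₁)]
    · have hi' : (i : ℝ) ≤ J * φ (side c J) + J := by
        have : (i : ℝ) ≤ n + J := by exact_mod_cast hi.le
        linarith
      calc w * (mL J K).real (cadicBox c i k) ≤ w * (mL J K).real univ := by
            exact mul_le_mul_of_nonneg_left
              (measureReal_mono (subset_univ _) (measure_ne_top _ _)) hw0.le
        _ = 2 := by rw [hw]; field_simp
        _ ≤ 2 * C := by linarith
        _ ≤ (c : ℝ) ^ (J * (t - s₁ - φ (side c J) * (1 + s₁))) := hJC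
        _ ≤ _ := by
            rw [side_rpow, ← Real.rpow_add hc0]
            apply Real.rpow_le_rpow_of_exponent_le hc1.le
            nlinarith [mul_le_mul_of_nonneg_right hi' hs₁, mul_nonneg hJ0 hφJ]

/-! ### Transfer of the local exponents to the balls of the system -/

/-- The mass of the ball of radius `l ^ ρ` around `p` is comparable to the power `ρ α` of `l`, up to
an error `e` on the exponent. -/
def HasBallExponent (μ : Measure (Fin d → ℝ)) (ρ α : ℝ) (p : Fin d → ℝ) (l e : ℝ) : Prop :=
  l ^ (ρ * (α + e)) ≤ μ.real (Metric.closedBall p (l ^ ρ)) ∧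
    μ.real (Metric.closedBall p (l ^ ρ)) ≤ l ^ (ρ * (α - e))

lemma HasBallExponent.mono {μ : Measure (Fin d → ℝ)} {ρ α : ℝ} {p : Fin d → ℝ} {l e e' : ℝ}
    (hρ : 0 ≤ ρ) (hl0 : 0 < l) (hl1 : l ≤ 1) (hee' : e ≤ e') (h : HasBallExponent μ ρ α p l e) :
    HasBallExponent μ ρ α p l e' :=
  ⟨(Real.rpow_le_rpow_of_exponent_ge hl0 hl1 (by nlinarith)).trans h.1,
    h.2.trans (Real.rpow_le_rpow_of_exponent_ge hl0 hl1 (by nlinarith))⟩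

/-- The local exponents around `y` hold for all generations larger than `u`. -/
def HasExponentFrom (c : ℕ) (μ : Measure (Fin d → ℝ)) (α : ℝ) (ψ : ℝ → ℝ) (y : Fin d → ℝ)
    (u : ℝ) : Prop :=
  ∀ i : ℕ, u ≤ i → ∀ k : Fin d → ℕ, IsIndex c i k → AreNeighbours k (indexOf c i y) →
    side c i ^ (α + ψ (side c i)) ≤ μ.real (cadicBox c i k) ∧
    μ.real (cadicBox c i k) ≤ side c i ^ (α - ψ (side c i))

/-- After division by `j`, the two sides are controlled by quantities tending to `ρ α` and `ρ (α +
e)`. -/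
lemma eventually_lower_exponent {ρ α e : ℝ} {ψ χ : ℝ → ℝ} (hc : 2 ≤ c) (hρ : 0 < ρ) (he : 0 < e)
    (hα : 0 < α) (hψ : IsCorrection ψ) (hχ : IsCorrection χ) (a : ℕ) :
    ∀ᶠ j : ℕ in atTop, ((⌈ρ * j⌉₊ + a : ℕ) : ℝ) * (α + ψ (side c (⌈ρ * j⌉₊ + a))) ≤
      j * (1 - χ (side c j)) * (ρ * (α + e)) := by
  have hρlim : Tendsto (fun j : ℕ => ρ * j) atTop atTop :=
    tendsto_natCast_atTop_atTop.const_mul_atTop hρ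
  have hi : Tendsto (fun j : ℕ => ⌈ρ * j⌉₊ + a) atTop atTop :=
    (tendsto_add_atTop_nat a).comp (tendsto_nat_ceil_atTop.comp hρlim)
  have h1 : Tendsto (fun j : ℕ => ψ (side c (⌈ρ * j⌉₊ + a))) atTop (𝓝 0) :=
    hψ.tendsto ((tendsto_side hc).comp hi) fun j => (side_pos hc _).le
  have h2 : Tendsto (fun j : ℕ => χ (side c j)) atTop (𝓝 0) :=
    hχ.tendsto (tendsto_side hc) fun j => (side_pos hc _).le
  have h3 : Tendsto (fun j : ℕ => (ρ + (1 + a) / (j : ℝ)) * (α + ψ (side c (⌈ρ * j⌉₊ + a)))) atTop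
      (𝓝 ((ρ + 0) * (α + 0))) :=
    (tendsto_const_nhds.add (tendsto_const_div_atTop_nhds_zero_nat _)).mul
      (tendsto_const_nhds.add h1)
  have h4 : Tendsto (fun j : ℕ => (1 - χ (side c j)) * (ρ * (α + e))) atTop
      (𝓝 ((1 - 0) * (ρ * (α + e)))) := (tendsto_const_nhds.sub h2).mul_const _
  have h5 : (ρ + 0) * (α + 0) < (1 - 0) * (ρ * (α + e)) := by nlinarith
  filter_upwards [h3.eventually_lt h4 h5, eventually_gt_atTop 0] with j hj hj0
  have hj0' : (0 : ℝ) < j := by exact_mod_cast hj0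
  have h6 : (0 : ℝ) ≤ ψ (side c (⌈ρ * j⌉₊ + a)) := hψ.nonneg (side_pos hc _).le
  have h7 : ((⌈ρ * j⌉₊ + a : ℕ) : ℝ) ≤ j * (ρ + (1 + a) / (j : ℝ)) := by
    have := (Nat.ceil_lt_add_one (a := ρ * j) (by positivity)).le
    have h8 : j * (ρ + (1 + a) / (j : ℝ)) = ρ * j + (1 + a) := by field_simp
    rw [h8]; push_cast; linarith
  calc _ ≤ j * (ρ + (1 + a) / (j : ℝ)) * (α + ψ (side c (⌈ρ * j⌉₊ + a))) := by gcongr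
    _ = j * ((ρ + (1 + a) / (j : ℝ)) * (α + ψ (side c (⌈ρ * j⌉₊ + a)))) := by ring
    _ ≤ j * ((1 - χ (side c j)) * (ρ * (α + e))) := by gcongr
    _ = _ := by ring

/-- The two sides of the last inequality differ to first order by `ρ e j`, which absorbs the
constant `D`; it will be the logarithm of the number `3 ^ d` of neighbours. The generation is
eventually at least `ρ j / 2`, so the local exponents at `y` may be used. -/
lemma eventually_upper_exponent {ρ α e : ℝ} {ψ χ : ℝ → ℝ} (hc : 2 ≤ c) (hρ : 0 < ρ) (he : 0 < e)
    (hα : 0 < α) (hψ : IsCorrection ψ) (hχ : IsCorrection χ) (D : ℝ) :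
    ∀ᶠ j : ℕ in atTop, ρ * j / 2 ≤ ((⌊ρ * j * (1 - χ (side c j))⌋₊ - 1 : ℕ) : ℝ) ∧
      ((⌊ρ * j * (1 - χ (side c j))⌋₊ - 1 : ℕ) : ℝ) + 1 ≤ ρ * j * (1 - χ (side c j)) ∧
      D + j * (ρ * (α - e)) ≤ ((⌊ρ * j * (1 - χ (side c j))⌋₊ - 1 : ℕ) : ℝ) *
        (α - ψ (side c (⌊ρ * j * (1 - χ (side c j))⌋₊ - 1))) := by
  have h2 : Tendsto (fun j : ℕ => χ (side c j)) atTop (𝓝 0) :=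
    hχ.tendsto (tendsto_side hc) fun j => (side_pos hc _).le
  have hlin : ∀ (f : ℕ → ℝ) (b : ℝ), 0 < b → Tendsto f atTop (𝓝 b) →
      Tendsto (fun j : ℕ => (j : ℝ) * f j) atTop atTop := fun f b hb hf =>
    tendsto_natCast_atTop_atTop.atTop_mul_pos hb hf
  have hρlim : Tendsto (fun j : ℕ => ρ * j * (1 - χ (side c j))) atTop atTop := by
    refine (hlin (fun j => ρ * (1 - χ (side c j))) (ρ * (1 - 0)) (by linarith)
      ((tendsto_const_nhds.sub h2).const_mul _)).congr fun j => by ring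
  have hi : Tendsto (fun j : ℕ => ⌊ρ * j * (1 - χ (side c j))⌋₊ - 1) atTop atTop :=
    (tendsto_sub_atTop_nat 1).comp (tendsto_nat_floor_atTop.comp hρlim)
  have h1 : Tendsto (fun j : ℕ => ψ (side c (⌊ρ * j * (1 - χ (side c j))⌋₊ - 1))) atTop (𝓝 0) :=
    hψ.tendsto ((tendsto_side hc).comp hi) fun j => (side_pos hc _).le
  have h3 : Tendsto (fun j : ℕ => (j : ℝ) * ((ρ * (1 - χ (side c j)) - 2 / (j : ℝ)) *
      (α - ψ (side c (⌊ρ * j * (1 - χ (side c j))⌋₊ - 1))) - ρ * (α - e))) atTop atTop := by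
    refine hlin _ ((ρ * (1 - 0) - 0) * (α - 0) - ρ * (α - e)) (by nlinarith) ?_
    exact ((((tendsto_const_nhds.sub h2).const_mul _).sub
      (tendsto_const_div_atTop_nhds_zero_nat _)).mul (tendsto_const_nhds.sub h1)).sub_const _
  have h4 : Tendsto (fun j : ℕ => (j : ℝ) * (ρ * (1 - χ (side c j)) - 2 / (j : ℝ) - ρ / 2)) atTop
      atTop := by
    refine hlin _ (ρ * (1 - 0) - 0 - ρ / 2) (by linarith) ?_
    exact (((tendsto_const_nhds.sub h2).const_mul _).sub
      (tendsto_const_div_atTop_nhds_zero_nat _)).sub_const _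
  filter_upwards [h3.eventually_ge_atTop D, h4.eventually_ge_atTop 0, eventually_gt_atTop 0,
    hρlim.eventually_ge_atTop 1, h1.eventually_le_const hα] with j hj1 hj2 hj0 hj3 hj4
  have hj0' : (0 : ℝ) < j := by exact_mod_cast hj0
  set v := ρ * j * (1 - χ (side c j)) with hv
  have hfl : 1 ≤ ⌊v⌋₊ := Nat.le_floor (by simpa using hj3)
  have hcast : ((⌊v⌋₊ - 1 : ℕ) : ℝ) = ⌊v⌋₊ - 1 := by rw [Nat.cast_sub hfl, Nat.cast_one]
  have hf1 := Nat.floor_le (a := v) (by linarith)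
  have hf2 := Nat.lt_floor_add_one v
  have h8 : j * (ρ * (1 - χ (side c j)) - 2 / (j : ℝ)) = v - 2 := by rw [hv]; field_simp
  rw [mul_sub, h8] at hj2
  refine ⟨by rw [hcast]; linarith, by rw [hcast]; linarith, ?_⟩
  rw [mul_sub, ← mul_assoc, h8] at hj1
  have h9 : v - 2 ≤ ((⌊v⌋₊ - 1 : ℕ) : ℝ) := by rw [hcast]; linarith
  have h10 : 0 ≤ α - ψ (side c (⌊v⌋₊ - 1)) := by linarith
  nlinarith [mul_le_mul_of_nonneg_right h9 h10]

/-- The ball around `p` contains a box of `y` of generation close to `ρ j`, and its part in the cube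
is covered by the neighbours of a slightly larger box of `y`. The threshold on `j` does not depend
on `y`, `p` or `l`; this uniformity is what permits errors indexed by `n` alone. -/
theorem eventually_hasBallExponent (hc : 2 ≤ c) {μ : Measure (Fin d → ℝ)} [IsFiniteMeasure μ]
    (hμ : μ (cadicBox c 0 (0 : Fin d → ℕ))ᶜ = 0) {ρ α e : ℝ} {ψ χ : ℝ → ℝ} (hρ : 0 < ρ)
    (he : 0 < e) (hα : 0 < α) (hψ : IsCorrection ψ) (hχ : IsCorrection χ) :
    ∀ᶠ j : ℕ in atTop, ∀ y ∈ cadicBox c 0 (0 : Fin d → ℕ),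
      HasExponentFrom c μ α ψ y (ρ * j / 2) → ∀ (p : Fin d → ℝ) (l : ℝ),
      dist p y ≤ (c : ℝ) ^ (-(ρ * (j : ℝ))) → (c : ℝ) ^ (-(j : ℝ) + 1) ≤ l →
      l ≤ (c : ℝ) ^ (-((j : ℝ) * (1 - χ (side c j)))) → HasBallExponent μ ρ α p l e := by
  have hc1 : (1 : ℝ) < c := by exact_mod_cast (by omega : 1 < c)
  have hc0 : (0 : ℝ) < c := by positivity
  have hc2 : (2 : ℝ) ≤ c := by exact_mod_cast hc
  have hcρ : 0 < (c : ℝ) ^ ρ - 1 := by linarith [Real.one_lt_rpow hc1 hρ]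
  -- Since `l ≥ c ^ (-j + 1)`, the radius is at least `c ^ ρ * c ^ (-ρ j)`. The excess over the
  -- distance from `p` to `y` has room for a box `a` generations below `ρ j`.
  obtain ⟨a, ha⟩ := ((tendsto_side hc).eventually_le_const hcρ).exists
  -- Keeps `α - e'` nonnegative, so that the last power is non-decreasing in `l`.
  set e' := min e α with he'
  have he'0 : 0 < e' := lt_min he hα
  filter_upwards [eventually_lower_exponent hc hρ he'0 hα hψ hχ a,
    eventually_upper_exponent hc hρ he'0 hα hψ hχ (Real.logb c (3 ^ d)), eventually_gt_atTop 0]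
    with j hlow hup hj0 y hy hexp p l hpy hl1 hl2
  obtain ⟨hu1, hu2, hu3⟩ := hup
  have hj0' : (0 : ℝ) < j := by exact_mod_cast hj0
  have hy0 := ((mem_cadicBox_iff hc).1 hy).1
  have hχ0 : 0 ≤ χ (side c j) := hχ.nonneg (side_pos hc j).le
  have hl0 : 0 < l := lt_of_lt_of_le (by positivity) hl1
  have hj1 : 0 ≤ (j : ℝ) * (1 - χ (side c j)) := by
    have : 0 ≤ ρ * ((j : ℝ) * (1 - χ (side c j))) := by
      rw [← mul_assoc]; exact le_trans (by positivity) hu2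
    exact (mul_nonneg_iff_of_pos_left hρ).1 this
  have hlle : l ≤ 1 := hl2.trans (Real.rpow_le_one_of_one_le_of_nonpos hc1.le (by linarith))
  refine HasBallExponent.mono hρ.le hl0 hlle (min_le_left e α) ?_
  refine ⟨?_, ?_⟩
  · set i := ⌈ρ * j⌉₊ + a with hi
    have hceil := Nat.le_ceil (ρ * j)
    have hib : ρ * j / 2 ≤ i := by
      have : (0 : ℝ) ≤ ρ * j := by positivity
      rw [hi]; push_cast
      have h3 : (0 : ℝ) ≤ a := by positivity
      linarith
    have hsub : cadicBox c i (indexOf c i y) ⊆ Metric.closedBall p (l ^ ρ) := by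
      intro z hz
      have h1 := dist_le_side hc hz (mem_cadicBox_indexOf hc i hy0)
      have h2 : side c i ≤ (c : ℝ) ^ (-(ρ * (j : ℝ))) * ((c : ℝ) ^ ρ - 1) := by
        rw [hi, side_add]
        refine mul_le_mul ?_ ha (side_pos hc _).le (by positivity)
        rw [side_eq_rpow]
        exact Real.rpow_le_rpow_of_exponent_le hc1.le (by linarith)
      have h3 : (c : ℝ) ^ (-(ρ * (j : ℝ))) * (c : ℝ) ^ ρ ≤ l ^ ρ := by
        calc _ = ((c : ℝ) ^ (-(j : ℝ) + 1)) ^ ρ := by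
              rw [← Real.rpow_add hc0, ← Real.rpow_mul hc0.le]; congr 1; ring
          _ ≤ _ := by gcongr
      rw [Metric.mem_closedBall]
      have h4 := dist_triangle z y p
      rw [dist_comm p y] at hpy
      linarith
    calc l ^ (ρ * (α + e')) ≤ ((c : ℝ) ^ (-((j : ℝ) * (1 - χ (side c j))))) ^ (ρ * (α + e')) := by
          gcongr
      _ = (c : ℝ) ^ (-(j * (1 - χ (side c j)) * (ρ * (α + e')))) := by
          rw [← Real.rpow_mul hc0.le, neg_mul]
      _ ≤ side c i ^ (α + ψ (side c i)) := by
          rw [side_rpow i]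
          exact Real.rpow_le_rpow_of_exponent_le hc1.le (neg_le_neg hlow)
      _ ≤ μ.real (cadicBox c i (indexOf c i y)) :=
          (hexp i hib _ (isIndex_indexOf hc i hy) fun _ => by simp).1
      _ ≤ _ := measureReal_mono hsub
  · classical
    set i := ⌊ρ * j * (1 - χ (side c j))⌋₊ - 1 with hi
    have hsub : Metric.closedBall p (l ^ ρ) ∩ cadicBox c 0 (0 : Fin d → ℕ) ⊆
        ⋃ k ∈ (nearIndices 1 (indexOf c i y)).filter fun k => IsIndex c i k, cadicBox c i k := by
      rintro z ⟨hz, hzc⟩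
      have hz0 := ((mem_cadicBox_iff hc).1 hzc).1
      have h1 : l ^ ρ ≤ (c : ℝ) ^ (-(ρ * j * (1 - χ (side c j)))) := by
        calc l ^ ρ ≤ ((c : ℝ) ^ (-((j : ℝ) * (1 - χ (side c j))))) ^ ρ := by gcongr
          _ = _ := by rw [← Real.rpow_mul hc0.le]; congr 1; ring
      have h2 : (c : ℝ) ^ (-(ρ * (j : ℝ))) ≤ (c : ℝ) ^ (-(ρ * j * (1 - χ (side c j)))) := by
        apply Real.rpow_le_rpow_of_exponent_le hc1.le
        have : 0 ≤ ρ * j * χ (side c j) := by positivity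
        linarith
      have h3 : 2 * (c : ℝ) ^ (-(ρ * j * (1 - χ (side c j)))) ≤ side c i := by
        calc _ ≤ (c : ℝ) ^ (1 : ℝ) * (c : ℝ) ^ (-(ρ * j * (1 - χ (side c j)))) := by
              rw [Real.rpow_one]; gcongr
          _ = (c : ℝ) ^ (1 + -(ρ * j * (1 - χ (side c j)))) := (Real.rpow_add hc0 _ _).symm
          _ ≤ _ := by
              rw [side_eq_rpow i]
              apply Real.rpow_le_rpow_of_exponent_le hc1.le
              linarith
      have h4 : dist z y ≤ side c i := by
        have := dist_triangle z p y
        rw [Metric.mem_closedBall] at hz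
        linarith
      simp only [mem_iUnion, exists_prop]
      refine ⟨indexOf c i z, Finset.mem_filter.2 ⟨?_, isIndex_indexOf hc i hzc⟩,
        mem_cadicBox_indexOf hc i hz0⟩
      rw [mem_nearIndices]
      simpa [AreNeighbours] using areNeighbours_indexOf hc hz0 hy0 h4
    calc μ.real (Metric.closedBall p (l ^ ρ))
        = μ.real (Metric.closedBall p (l ^ ρ) ∩ cadicBox c 0 (0 : Fin d → ℕ)) := by
          rw [Measure.real, Measure.real, measure_inter_conull hμ]
      _ ≤ μ.real (⋃ k ∈ (nearIndices 1 (indexOf c i y)).filter fun k => IsIndex c i k,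
            cadicBox c i k) := measureReal_mono hsub (measure_ne_top _ _)
      _ ≤ ∑ k ∈ (nearIndices 1 (indexOf c i y)).filter fun k => IsIndex c i k,
            μ.real (cadicBox c i k) := measureReal_biUnion_finset_le _ _
      _ ≤ ∑ k ∈ (nearIndices 1 (indexOf c i y)).filter fun k => IsIndex c i k,
            side c i ^ (α - ψ (side c i)) := by
          refine Finset.sum_le_sum fun k hk => ?_
          rw [Finset.mem_filter, mem_nearIndices] at hk
          exact (hexp i hu1 k hk.2 (by simpa [AreNeighbours] using hk.1)).2
      _ ≤ 3 ^ d * side c i ^ (α - ψ (side c i)) := by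
          rw [Finset.sum_const, nsmul_eq_mul]
          have := Real.rpow_nonneg (side_pos hc i).le (α - ψ (side c i))
          gcongr
          exact_mod_cast (Finset.card_filter_le _ _).trans (card_nearIndices_le 1 _)
      _ = (c : ℝ) ^ (Real.logb c (3 ^ d) + -(i * (α - ψ (side c i)))) := by
          rw [Real.rpow_add hc0, Real.rpow_logb hc0 hc1.ne' (by positivity), side_rpow]
      _ ≤ (c : ℝ) ^ (-(j : ℝ) * (ρ * (α - e'))) := by
          apply Real.rpow_le_rpow_of_exponent_le hc1.le
          linarith
      _ = ((c : ℝ) ^ (-(j : ℝ))) ^ (ρ * (α - e')) := Real.rpow_mul hc0.le _ _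
      _ ≤ l ^ (ρ * (α - e')) := by
          have h1 : 0 ≤ ρ * (α - e') := mul_nonneg hρ.le (sub_nonneg.2 (min_le_right _ _))
          have h2 : (c : ℝ) ^ (-(j : ℝ)) ≤ l :=
            (Real.rpow_le_rpow_of_exponent_le hc1.le (by linarith)).trans hl1
          gcongr

/-- A property that holds eventually for every positive error, and is preserved when the error
increases, holds eventually for errors that converge to `0`. -/
lemma exists_tendsto_zero_of_eventually {P : ℕ → ℝ → Prop}
    (hmono : ∀ᶠ n in atTop, ∀ e e', e ≤ e' → P n e → P n e')
    (h : ∀ e > 0, ∀ᶠ n in atTop, P n e) :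
    ∃ ε : ℕ → ℝ, (∀ n, 0 < ε n) ∧ Tendsto ε atTop (𝓝 0) ∧ ∀ᶠ n in atTop, P n (ε n) := by
  have hbdd : ∀ n, BddBelow {e | 0 < e ∧ P n e} := fun n => ⟨0, fun e he => he.1.le⟩
  have hnn : ∀ n, 0 ≤ sInf {e | 0 < e ∧ P n e} := fun n => Real.sInf_nonneg fun e he => he.1.le
  -- The added `1 / (n + 1)` makes the value positive and strictly larger than the infimum, so
  -- monotonicity applies even if the infimum is not attained.
  refine ⟨fun n => sInf {e | 0 < e ∧ P n e} + 1 / ((n : ℝ) + 1), fun n =>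
    add_pos_of_nonneg_of_pos (hnn n) Nat.one_div_pos_of_nat, ?_, ?_⟩
  · have h0 : Tendsto (fun n => sInf {e | 0 < e ∧ P n e}) atTop (𝓝 0) := by
      rw [tendsto_order]
      refine ⟨fun a ha => Eventually.of_forall fun n => ha.trans_le (hnn n), fun a ha => ?_⟩
      filter_upwards [h (a / 2) (half_pos ha)] with n hn
      exact (csInf_le (hbdd n) ⟨half_pos ha, hn⟩).trans_lt (half_lt_self ha)
    simpa using h0.add (tendsto_one_div_add_atTop_nhds_zero_nat (𝕜 := ℝ))
  · filter_upwards [hmono, h 1 one_pos] with n hn h1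
    obtain ⟨e, he, hlt⟩ := exists_lt_of_csInf_lt (s := {e | 0 < e ∧ P n e}) ⟨1, one_pos, h1⟩
      (lt_add_of_pos_right _ (Nat.one_div_pos_of_nat (α := ℝ) (n := n)))
    exact hn _ _ hlt.le he.2

/-! ### The lower bound -/

/-- The points of the system selected by the ubiquity condition at a point where the local exponents
hold have good balls, for errors that converge to `0`. -/
theorem exists_error_sequence (hc : 2 ≤ c) {μ : Measure (Fin d → ℝ)} [IsFiniteMeasure μ]
    (hμ : μ (cadicBox c 0 (0 : Fin d → ℕ))ᶜ = 0) {ρ α : ℝ} {ψ χ : ℝ → ℝ} (hρ : 0 < ρ)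
    (hα : 0 < α) (hψ : IsCorrection ψ) (hχ : IsCorrection χ) (x : ℕ → Fin d → ℝ) {lam : ℕ → ℝ}
    (hlam_pos : ∀ n, 0 < lam n) (hlam_lim : Tendsto lam atTop (𝓝 0)) :
    ∃ ε : ℕ → ℝ, (∀ n, 0 < ε n) ∧ Tendsto ε atTop (𝓝 0) ∧ ∀ᶠ n in atTop,
      ∀ j : ℕ, ∀ y ∈ cadicBox c 0 (0 : Fin d → ℕ), HasExponentFrom c μ α ψ y (ρ * j / 2) →
        dist (x n) y ≤ (c : ℝ) ^ (-(ρ * (j : ℝ))) → (c : ℝ) ^ (-(j : ℝ) + 1) ≤ lam n →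
        lam n ≤ (c : ℝ) ^ (-((j : ℝ) * (1 - χ (side c j)))) →
        HasBallExponent μ ρ α (x n) (lam n) (ε n) := by
  have hc1 : (1 : ℝ) < c := by exact_mod_cast (by omega : 1 < c)
  refine exists_tendsto_zero_of_eventually (P := fun n e => ∀ j : ℕ,
      ∀ y ∈ cadicBox c 0 (0 : Fin d → ℕ), HasExponentFrom c μ α ψ y (ρ * j / 2) →
        dist (x n) y ≤ (c : ℝ) ^ (-(ρ * (j : ℝ))) → (c : ℝ) ^ (-(j : ℝ) + 1) ≤ lam n →
        lam n ≤ (c : ℝ) ^ (-((j : ℝ) * (1 - χ (side c j)))) →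
        HasBallExponent μ ρ α (x n) (lam n) e) ?_ ?_
  · filter_upwards [hlam_lim.eventually_le_const one_pos] with n hn e e' hee' h j y hy h1 h2 h3 h4
    exact (h j y hy h1 h2 h3 h4).mono hρ.le (hlam_pos n) hn hee'
  · intro e he
    obtain ⟨j₀, hj₀⟩ := eventually_atTop.1 (eventually_hasBallExponent hc hμ hρ he hα hψ hχ)
    have hpos : (0 : ℝ) < (c : ℝ) ^ (-(j₀ : ℝ) + 1) := by positivity
    filter_upwards [hlam_lim.eventually_lt_const hpos] with n hn j y hy h1 h2 h3 h4
    refine hj₀ j ?_ y hy h1 (x n) (lam n) h2 h3 h4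
    -- A small `lam n` forces the scale `j` to be large, because `lam n ≥ c ^ (-j + 1)`.
    by_contra hlt
    have h5 : (j : ℝ) ≤ j₀ := by exact_mod_cast (not_le.1 hlt).le
    have h6 : (c : ℝ) ^ (-(j₀ : ℝ) + 1) ≤ (c : ℝ) ^ (-(j : ℝ) + 1) :=
      Real.rpow_le_rpow_of_exponent_le hc1.le (by linarith)
    linarith

/-- This descendant two generations below stays at least one of its own sides away from the boundary
of its ancestor, because `c ^ 2 ≥ 4`. Balls that stick out of it by at most one side therefore
remain in the original box. -/
lemma isIndex_child (hc : 2 ≤ c) {g : ℕ} {K : Fin d → ℕ} (hK : IsIndex c g K) :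
    IsIndex c (g + 2) fun i => c ^ 2 * K i + 1 := by
  intro i
  have h1 : K i + 1 ≤ c ^ g := hK i
  have h2 : 4 ≤ c ^ 2 := by nlinarith
  calc c ^ 2 * K i + 1 < c ^ 2 * (K i + 1) := by rw [mul_add]; omega
    _ ≤ c ^ 2 * c ^ g := Nat.mul_le_mul_left _ h1
    _ = _ := by ring

lemma mem_cadicBox_of_dist_child_le (hc : 2 ≤ c) {g : ℕ} {K : Fin d → ℕ} {y z : Fin d → ℝ}
    (hy : y ∈ cadicBox c (g + 2) fun i => c ^ 2 * K i + 1) (hz : dist z y ≤ side c (g + 2)) :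
    z ∈ cadicBox c g K := by
  intro i
  have hp : (0 : ℝ) < (c : ℝ) ^ g := by positivity
  have hp2 : (0 : ℝ) < (c : ℝ) ^ (g + 2) := by positivity
  have hyi := hy i
  have hzi := (abs_le.1 ((dist_le_pi_dist z y i).trans hz))
  have hc2 : (4 : ℝ) ≤ (c : ℝ) ^ 2 := by
    have : (2 : ℝ) ≤ c := by exact_mod_cast hc
    nlinarith
  have hs : side c (g + 2) * (c : ℝ) ^ (g + 2) = 1 := by
    rw [side, inv_mul_cancel₀ hp2.ne']
  rw [div_le_iff₀ hp2, lt_div_iff₀ hp2] at hyi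
  push_cast at hyi
  have h1 := mul_le_mul_of_nonneg_right hzi.1 hp2.le
  have h2 := mul_le_mul_of_nonneg_right hzi.2 hp2.le
  rw [neg_mul, hs, sub_mul] at h1
  rw [hs, sub_mul] at h2
  have h3 : (c : ℝ) ^ (g + 2) = (c : ℝ) ^ 2 * (c : ℝ) ^ g := by ring
  have hcpos : (0 : ℝ) < (c : ℝ) ^ 2 := by positivity
  rw [div_le_iff₀ hp, lt_div_iff₀ hp]
  constructor
  · refine le_of_mul_le_mul_left ?_ hcpos
    rw [h3] at h1 hyi
    nlinarith
  · refine lt_of_mul_lt_mul_left ?_ hcpos.le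
    rw [h3] at h2 hyi
    nlinarith

lemma HasExponentFrom.of_exists {μ : Measure (Fin d → ℝ)} {α ρ : ℝ} {ψ : ℝ → ℝ} {y : Fin d → ℝ}
    (hρ : 0 < ρ)
    (h : ∃ j₀ : ℕ, ∀ j ≥ j₀, ∀ k : Fin d → ℕ, IsIndex c j k → AreNeighbours k (indexOf c j y) →
      side c j ^ (α + ψ (side c j)) ≤ μ.real (cadicBox c j k) ∧
      μ.real (cadicBox c j k) ≤ side c j ^ (α - ψ (side c j))) :
    ∀ᶠ j : ℕ in atTop, HasExponentFrom c μ α ψ y (ρ * j / 2) := by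
  obtain ⟨j₀, hj₀⟩ := h
  have : Tendsto (fun j : ℕ => ρ * j / 2) atTop atTop :=
    (tendsto_natCast_atTop_atTop.const_mul_atTop hρ).atTop_div_const two_pos
  filter_upwards [this.eventually_ge_atTop (j₀ : ℝ)] with j hj i hi
  exact hj₀ i (by exact_mod_cast hj.trans hi)

/-- The normalized box measure lives on the interior descendant of each box, and
`exists_measure_near` moves it onto the balls of the system that satisfy the mass condition. The
resulting measures are those required by `le_dimH_iInter`. -/
theorem le_dimH_condLimsupSet (hc : 2 ≤ c) {μ m : Measure (Fin d → ℝ)}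
    {mL : ℕ → (Fin d → ℕ) → Measure (Fin d → ℝ)} {ρ α β δ : ℝ} {φ ψ χ : ℝ → ℝ}
    {x : ℕ → Fin d → ℝ} {lam ε : ℕ → ℝ} (hρ0 : 0 < ρ) (hρ1 : ρ < 1) (hβd : β ≤ d) (hδ : 1 ≤ δ)
    (hφ : IsCorrection φ) (hχ : IsCorrection χ)
    (hlam_pos : ∀ n, 0 < lam n) (hlam_anti : Antitone lam)
    (hmany : ∀ᵐ y ∂m, {j : ℕ | HasManyDisjointPairs c x lam ρ χ y j}.Infinite)
    (hexp : HasLocalExponent c μ m α ψ)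
    (h3 : ∀ (J : ℕ) (K : Fin d → ℕ), IsIndex c J K →
      IsFiniteMeasure (mL J K) ∧ mL J K ≪ m.restrict (cadicBox c J K) ∧
      HasLocalMassBound c ((mL J K).map (boxChart c J K)) β φ)
    (h4 : ∃ Jm : ℕ, ∀ J ≥ Jm, ∀ K : Fin d → ℕ, IsIndex c J K →
      (growthIndex c β φ J K (mL J K) : ℝ) ≤ (J : ℝ) * φ (side c J) ∧
      side c J ^ φ (side c J) ≤ (mL J K).real univ)
    (hε : ∀ᶠ n in atTop,
      ∀ j : ℕ, ∀ y ∈ cadicBox c 0 (0 : Fin d → ℕ), HasExponentFrom c μ α ψ y (ρ * j / 2) →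
        dist (x n) y ≤ (c : ℝ) ^ (-(ρ * (j : ℝ))) → (c : ℝ) ^ (-(j : ℝ) + 1) ≤ lam n →
        lam n ≤ (c : ℝ) ^ (-((j : ℝ) * (1 - χ (side c j)))) →
        HasBallExponent μ ρ α (x n) (lam n) (ε n))
    {s : ℝ} (hs : 0 < s) (hs1 : s < (d * (1 - ρ) + ρ * β) / δ) (hs2 : s < β) :
    ENNReal.ofReal s ≤ dimH (condLimsupSet μ x lam ρ δ α ε) := by
  classical
  have hc1 : (1 : ℝ) < c := by exact_mod_cast (by omega : 1 < c)
  have hc0 : (0 : ℝ) < c := by positivity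
  rw [lt_div_iff₀ (by linarith)] at hs1
  -- the exponents
  obtain ⟨u, hu0, hu1, hu2⟩ : ∃ u, 0 < u ∧ 3 * u ≤ β - s ∧
      u * (δ + 2 * ρ) ≤ d * (1 - ρ) + ρ * β - s * δ := by
    refine ⟨min ((β - s) / 3) ((d * (1 - ρ) + ρ * β - s * δ) / (δ + 2 * ρ)),
      lt_min (by linarith) (div_pos (by linarith) (by linarith)), ?_, ?_⟩
    · linarith [min_le_left ((β - s) / 3) ((d * (1 - ρ) + ρ * β - s * δ) / (δ + 2 * ρ))]
    · rw [← le_div_iff₀ (by linarith)]; exact min_le_right _ _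
  -- The exponents are `s < s + u ≤ β - u < β`. The bound `3 * u ≤ β - s` gives `κ ≤ ρ * (s₁ - s₂)`,
  -- and the bound on `u * (δ + 2 * ρ)` is the inequality required of `δ * s₂`.
  set κ := ρ * u with hκ
  have hκ0 : 0 < κ := by positivity
  set t := (β - u + d) / 2 with ht
  -- Open balls replace the closed ones, because the redistribution takes place in open sets.
  set G : ℕ → Set (Fin d → ℝ) := fun N =>
    ⋃ n ∈ {n : ℕ | N ≤ n ∧ HasBallExponent μ ρ α (x n) (lam n) (ε n)},
      Metric.ball (x n) (lam n ^ δ) with hG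
  have hGS : (⋂ N, G N) ⊆ condLimsupSet μ x lam ρ δ α ε :=
    iInter_mono fun N => iUnion₂_mono fun n _ => Metric.ball_subset_closedBall
  refine le_trans ?_ (dimH_mono hGS)
  refine le_dimH_iInter hc (t := t) (C := 3 * 3 ^ d * (c : ℝ) ^ (2 * t)) hs (by linarith)
    (by linarith) G
    (fun N => isOpen_biUnion fun n _ => Metric.isOpen_ball) fun N => ?_
  have hnorm := (tendsto_add_atTop_nat 2).eventually
    (eventually_exists_normalized hc hφ h3 h4 (s₁ := β - u) (t := t) (by linarith)
      (by linarith) (by linarith))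
  filter_upwards [hnorm] with g hg K hK
  obtain ⟨π, E₀, hπm, hπE, hE₀, hbox⟩ := hg _ (isIndex_child hc hK)
  have hE₀c := hE₀.trans ((isIndex_child hc hK).subset hc)
  set E := E₀ ∩ {y | {j : ℕ | HasManyDisjointPairs c x lam ρ χ y j}.Infinite ∧
    ∀ᶠ j : ℕ in atTop, HasExponentFrom c μ α ψ y (ρ * j / 2)} with hE
  have hπE' : 1 ≤ π E := by
    rw [hE, measure_inter_conull]
    · exact hπE
    · refine hπm.ae_le ?_
      filter_upwards [hmany, hexp] with y h1 h2
      exact ⟨h1, HasExponentFrom.of_exists hρ0 h2⟩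
  have hballs : ∀ y ∈ E, ∃ᶠ j in atTop, HasManyBalls c ρ δ κ (G N) y j := by
    rintro y ⟨hy₀, hyinf, hyexp⟩
    obtain ⟨n₀, hn₀⟩ := eventually_atTop.1 hε
    have hχlim : Tendsto (fun j : ℕ => χ (side c j)) atTop (𝓝 0) :=
      hχ.tendsto (tendsto_side hc) fun j => (side_pos hc j).le
    have hsmall : ∀ᶠ j : ℕ in atTop,
        (c : ℝ) ^ (-((j : ℝ) * (1 - χ (side c j)))) < lam (max N n₀) := by
      have h1 : Tendsto (fun j : ℕ => (j : ℝ) * (1 - χ (side c j))) atTop atTop := by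
        refine tendsto_natCast_atTop_atTop.atTop_mul_pos (C := 1 - 0) (by norm_num) ?_
        exact tendsto_const_nhds.sub hχlim
      exact ((tendsto_rpow_atBot_of_base_gt_one _ hc1).comp
        (tendsto_neg_atTop_atBot.comp h1)).eventually_lt_const (hlam_pos _)
    refine ((Nat.frequently_atTop_iff_infinite.2 hyinf).and_eventually
      (hyexp.and (hsmall.and (hχlim.eventually_le_const hκ0)))).mono ?_
    rintro j ⟨⟨F, hFcard, hF, hFdisj⟩, hjexp, hjsmall, hjκ⟩
    have hj0 : (0 : ℝ) ≤ j := by positivity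
    -- The margin of one generation in `lam n ≥ c ^ (-j + 1)` makes the inequality strict, and
    -- closed balls of radius `c ^ (-j δ)` then fit into the open balls that form `G N`.
    have hside : ∀ n ∈ F, side c j < lam n := fun n hn => by
      refine lt_of_lt_of_le ?_ (hF n hn).2.1
      rw [side_eq_rpow]
      exact Real.rpow_lt_rpow_of_exponent_lt hc1 (by linarith)
    have hinj : Set.InjOn x (F : Set ℕ) := by
      intro n hn n' hn' heq
      by_contra hne
      refine Set.disjoint_left.1 (hFdisj hn hn' hne)
        (Metric.mem_closedBall_self (hlam_pos n).le) ?_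
      rw [heq]; exact Metric.mem_closedBall_self (hlam_pos n').le
    refine ⟨F.image x, ?_, ?_, ?_⟩
    · rw [Finset.card_image_of_injOn hinj]
      refine le_trans ?_ hFcard
      apply Real.rpow_le_rpow_of_exponent_le hc1.le
      gcongr
    · intro p hp
      obtain ⟨n, hn, rfl⟩ := Finset.mem_image.1 hp
      obtain ⟨hn1, hn2, hn3⟩ := hF n hn
      refine ⟨hn1, ?_⟩
      -- The points selected at a fine scale have large indices, because `lam` is non-increasing and
      -- `lam n` is below its value at `max N n₀`.
      have hnlarge : max N n₀ ≤ n := by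
        by_contra hlt
        have := hlam_anti (not_le.1 hlt).le
        linarith
      have hexpn := hn₀ n ((le_max_right _ _).trans hnlarge) j y (hE₀c hy₀) hjexp hn1 hn2 hn3
      refine subset_trans ?_ (subset_biUnion_of_mem (u := fun n => Metric.ball (x n) (lam n ^ δ))
        (show n ∈ {n : ℕ | N ≤ n ∧ HasBallExponent μ ρ α (x n) (lam n) (ε n)} from
          ⟨(le_max_left _ _).trans hnlarge, hexpn⟩))
      refine Metric.closedBall_subset_ball ?_
      calc (c : ℝ) ^ (-(j * δ)) = side c j ^ δ := (side_rpow j δ).symm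
        _ < lam n ^ δ := Real.rpow_lt_rpow (side_pos hc j).le (hside n hn) (by linarith)
    · intro p hp p' hp' hne
      obtain ⟨n, hn, rfl⟩ := Finset.mem_image.1 (Finset.mem_coe.1 hp)
      obtain ⟨n', hn', rfl⟩ := Finset.mem_image.1 (Finset.mem_coe.1 hp')
      exact (hFdisj hn hn' fun h => hne (congrArg x h)).mono
        (Metric.closedBall_subset_closedBall (hside n hn).le)
        (Metric.closedBall_subset_closedBall (hside n' hn').le)
  have hB : (1 : ℝ) ≤ (c : ℝ) ^ (((g + 2 : ℕ) : ℝ) * t) :=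
    Real.one_le_rpow hc1.le (mul_nonneg (by positivity) (by linarith))
  obtain ⟨θ, hθD, hθ1, ⟨A, hA, hAG, hAE, hA0⟩, hθbox⟩ := exists_measure_near hc hρ0 hρ1.le hδ hs.le
    (s₂ := s + u) (s₁ := β - u) (κ := κ) (by linarith) (by linarith) (by linarith)
    (by rw [hκ]; gcongr; linarith) (by rw [hκ]; linarith) (inter_subset_left.trans hE₀c) hπE' hB
    (fun i k hik => hbox i k (hik.mono (inter_subset_inter_left _ inter_subset_left))) hballs
    (side_pos hc (g + 2))
  refine ⟨θ, hθD, hθ1, ⟨A, hA, fun z hz => ⟨hAG hz, ?_⟩, hA0⟩, fun i k _ => ?_⟩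
  · obtain ⟨y, hy, hzy⟩ := hAE z hz
    exact mem_cadicBox_of_dist_child_le hc (hE₀ hy.1) hzy
  · refine (hθbox i k).trans (le_of_eq ?_)
    congr 1
    have : (c : ℝ) ^ (((g + 2 : ℕ) : ℝ) * t) = (c : ℝ) ^ (2 * t) * (c : ℝ) ^ (g * t) := by
      rw [← Real.rpow_add hc0]; congr 1; push_cast; ring
    rw [this]; ring

/-! ### Multinomial measures -/

lemma sum_digits (b n j : ℕ) : ∑ s : Fin j, n / b ^ (s : ℕ) % b * b ^ (s : ℕ) = n % b ^ j := by
  induction j with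
  | zero => simp [Nat.mod_one]
  | succ j ih =>
    rw [Fin.sum_univ_castSucc]
    simp only [Fin.val_castSucc, Fin.val_last]
    rw [ih, Nat.mod_pow_succ, mul_comm]

lemma IsMultinomial.measure_compl_cube {μ : Measure (Fin d → ℝ)} (hμ : IsMultinomial μ) :
    μ univ = 1 ∧ μ (cadicBox c 0 (0 : Fin d → ℕ))ᶜ = 0 := by
  obtain ⟨b, p, -, -, -, h1, h2⟩ := hμ
  have : IsProbabilityMeasure μ := ⟨h1⟩
  refine ⟨h1, ?_⟩
  have h3 := h2 0 Fin.elim0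
  simp only [Finset.univ_eq_empty, Finset.sum_empty, Finset.prod_empty, ENNReal.ofReal_one] at h3
  rw [prob_compl_eq_zero_iff (measurableSet_cadicBox _ _), cadicBox_zero, ← cadicBox_zero (c := b)]
  exact h3

/-- The bases `b` and `c` are unrelated, but a sufficiently small `b`-adic box around the centre
fits into the `c`-adic box. Positivity is needed for negative powers of the masses. -/
lemma IsMultinomial.measure_cadicBox_pos (hc : 2 ≤ c) {μ : Measure (Fin d → ℝ)}
    (hμ : IsMultinomial μ) {i : ℕ} {k : Fin d → ℕ} (hk : IsIndex c i k) :
    0 < μ.real (cadicBox c i k) := by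
  obtain ⟨b, p, hb, hp, -, h1, h2⟩ := hμ
  have : IsProbabilityMeasure μ := ⟨h1⟩
  have hsi := side_pos hc i
  obtain ⟨j, hj⟩ := ((tendsto_side hb).eventually_lt_const (half_pos hsi)).exists
  have hcp : (0 : ℝ) < (c : ℝ) ^ i := by positivity
  set y : Fin d → ℝ := fun l => (k l : ℝ) / (c : ℝ) ^ i + side c i / 2 with hy
  have hupper : ∀ l, ((k l : ℝ) + 1) / (c : ℝ) ^ i = (k l : ℝ) / (c : ℝ) ^ i + side c i := by
    intro l; rw [side]; ring
  have hyk : y ∈ cadicBox c i k := fun l => by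
    rw [hupper]; constructor <;> simp only [hy] <;> linarith
  have hyc := hk.subset hc hyk
  have hy0 := ((mem_cadicBox_iff hc).1 hyc).1
  have hyc' : y ∈ cadicBox b 0 (0 : Fin d → ℕ) := by rwa [cadicBox_zero] at hyc ⊢
  have hidx := isIndex_indexOf hb j hyc'
  have hsub : cadicBox b j (indexOf b j y) ⊆ cadicBox c i k := by
    intro z hz l
    have h3 := (dist_le_pi_dist z y l).trans (dist_le_side hb hz (mem_cadicBox_indexOf hb j hy0))
    rw [Real.dist_eq, abs_le] at h3
    rw [hupper]
    simp only [hy] at h3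
    constructor <;> linarith [h3.1, h3.2]
  have hw := h2 j fun s l => ⟨indexOf b j y l / b ^ (s : ℕ) % b, Nat.mod_lt _ (by omega)⟩
  have hdig : (fun l => ∑ s : Fin j, indexOf b j y l / b ^ (s : ℕ) % b * b ^ (s : ℕ)) =
      indexOf b j y := by
    funext l; rw [sum_digits, Nat.mod_eq_of_lt (hidx l)]
  simp only [hdig] at hw
  rw [measureReal_def]
  refine ENNReal.toReal_pos (ne_of_gt ?_) (measure_ne_top _ _)
  refine lt_of_lt_of_le ?_ (measure_mono hsub)
  rw [hw, ENNReal.ofReal_pos]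
  exact Finset.prod_pos fun s _ => hp _

/-! ### Consequences of the value of the Legendre transform -/

/-- Take `q = 0`: all boxes are counted, so `τ(0) = -d`. -/
lemma le_of_legendre_eq (hc : 2 ≤ c) {μ : Measure (Fin d → ℝ)} {α β : ℝ}
    (h : legendre (tau c μ) α = (β : EReal)) : β ≤ d := by
  have hc1 : (1 : ℝ) < c := by exact_mod_cast (by omega : 1 < c)
  have htau : tau c μ 0 = ((-(d : ℝ) : ℝ) : EReal) := by
    refine Tendsto.liminf_eq (tendsto_const_nhds.congr' ?_)
    filter_upwards [eventually_gt_atTop 0] with j hj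
    have hj' : (j : ℝ) ≠ 0 := by exact_mod_cast hj.ne'
    simp only [Real.rpow_zero, Finset.sum_const, nsmul_eq_mul, mul_one, Fintype.card_piFinset,
      Finset.card_range, Finset.prod_const, Finset.card_univ, Fintype.card_fin]
    congr 1
    rw [← pow_mul, Nat.cast_pow, Real.logb_pow, Real.logb_self_eq_one hc1]
    push_cast
    field_simp
  have h1 : legendre (tau c μ) α ≤ ((α * 0 : ℝ) : EReal) - tau c μ 0 := iInf_le _ 0
  rw [h, htau, ← EReal.coe_sub, EReal.coe_le_coe_iff] at h1
  linarith

/-- Some `q` nearly attains the infimum, that is `τ(q) > α q - β - η`, and a lower bound on the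
liminf holds eventually for the sums themselves. -/
lemma exists_sum_rpow_le (hc : 2 ≤ c) {μ : Measure (Fin d → ℝ)} {α β η : ℝ} (hη : 0 < η)
    (h : legendre (tau c μ) α = (β : EReal)) :
    ∃ q : ℝ, ∀ᶠ i : ℕ in atTop, ∑ k ∈ indices d c i, μ.real (cadicBox c i k) ^ q ≤
      side c i ^ (α * q - β - η) := by
  have hc1 : (1 : ℝ) < c := by exact_mod_cast (by omega : 1 < c)
  have h1 : legendre (tau c μ) α < ((β + η : ℝ) : EReal) := by
    rw [h, EReal.coe_lt_coe_iff]; linarith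
  obtain ⟨q, hq⟩ := iInf_lt_iff.1 h1
  have h2 : ((α * q - β - η : ℝ) : EReal) < tau c μ q := by
    by_contra hle
    have h3 : ((α * q : ℝ) : EReal) - ((α * q - β - η : ℝ) : EReal) ≤
        ((α * q : ℝ) : EReal) - tau c μ q := EReal.sub_le_sub le_rfl (not_lt.1 hle)
    rw [← EReal.coe_sub] at h3
    have h4 := h3.trans_lt hq
    rw [EReal.coe_lt_coe_iff] at h4
    linarith
  refine ⟨q, ?_⟩
  filter_upwards [eventually_lt_of_lt_liminf h2, eventually_gt_atTop 0] with i hi hi0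
  rw [EReal.coe_lt_coe_iff] at hi
  have hi0' : (0 : ℝ) < i := by exact_mod_cast hi0
  have hS0 : 0 ≤ ∑ k ∈ indices d c i, μ.real (cadicBox c i k) ^ q :=
    Finset.sum_nonneg fun k _ => Real.rpow_nonneg measureReal_nonneg _
  change _ < -(i : ℝ)⁻¹ * Real.logb c (∑ k ∈ indices d c i, μ.real (cadicBox c i k) ^ q) at hi
  rcases hS0.eq_or_lt with h0 | hpos
  · rw [← h0]; exact Real.rpow_nonneg (side_pos hc i).le _
  · rw [side_rpow, ← Real.logb_le_iff_le_rpow hc1 hpos]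
    have h5 := mul_lt_mul_of_pos_left hi hi0'
    rw [neg_mul, mul_neg, mul_inv_cancel_left₀ hi0'.ne'] at h5
    linarith

/-! ### Coverings and upper bounds for the Hausdorff dimension -/

/-- For `s > a / b` the tails of the geometric series of ratio `2 ^ (a - s * b)` bound the Hausdorff
sums and tend to `0`, which rules out infinite `s`-dimensional measure. -/
theorem dimH_le_of_covers {ι : Type*} (𝒞 : ℕ → Finset ι)
    (A : ℕ → ι → Set (Fin d → ℝ))
    {a b C : ℝ} (ha : 0 ≤ a) (hb : 0 < b) (hC : 0 < C)
    (hcard : ∀ᶠ j : ℕ in atTop, ((𝒞 j).card : ℝ) ≤ C * 2 ^ (j * a))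
    (hdiam : ∀ᶠ j : ℕ in atTop, ∀ p ∈ 𝒞 j,
      Metric.ediam (A j p) ≤ ENNReal.ofReal (C * 2 ^ (-(j * b))))
    {S : Set (Fin d → ℝ)} (hS : ∀ y ∈ S, ∃ᶠ j in atTop, ∃ p ∈ 𝒞 j, y ∈ A j p) :
    dimH S ≤ ENNReal.ofReal (a / b) := by
  refine dimH_le fun s hs => ?_
  by_contra hlt
  rw [not_le, ENNReal.ofReal_lt_coe_iff (div_nonneg ha hb.le), div_lt_iff₀ hb] at hlt
  set u : ℝ := 2 ^ (a - s * b) with hu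
  have hu0 : 0 < u := by positivity
  have hu1 : u < 1 := Real.rpow_lt_one_of_one_lt_of_neg one_lt_two (by linarith)
  set M : ℝ := C * C ^ (s : ℝ) with hM
  have hr : Tendsto (fun n : ℕ => ENNReal.ofReal (C * 2 ^ (-(n * b)))) atTop (𝓝 0) := by
    rw [← ENNReal.ofReal_zero]
    refine (ENNReal.continuous_ofReal.tendsto 0).comp ?_
    rw [← mul_zero C]
    refine Tendsto.const_mul _ ((tendsto_rpow_atBot_of_base_gt_one _ one_lt_two).comp ?_)
    exact tendsto_neg_atTop_atBot.comp (tendsto_natCast_atTop_atTop.atTop_mul_const hb)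
  obtain ⟨j₁, hj₁⟩ := eventually_atTop.1 (hcard.and hdiam)
  have hbound := Measure.hausdorffMeasure_le_liminf_tsum (ι := fun n : ℕ => Σ i : ℕ, 𝒞 (n + i))
    (s : ℝ) S (l := atTop) (fun n : ℕ => ENNReal.ofReal (C * 2 ^ (-(n * b)))) hr
    (fun n q => A (n + q.1) q.2) ?_ ?_
  · have hsum : ∀ n ≥ j₁, ∑' q : (Σ i : ℕ, 𝒞 (n + i)), Metric.ediam (A (n + q.1) q.2) ^ (s : ℝ) ≤
        ENNReal.ofReal (M * u ^ n) * (1 - ENNReal.ofReal u)⁻¹ := by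
      intro n hn
      rw [ENNReal.tsum_sigma', ← ENNReal.tsum_geometric, ← ENNReal.tsum_mul_left]
      refine ENNReal.tsum_le_tsum fun i => ?_
      obtain ⟨h1, h2⟩ := hj₁ (n + i) (by omega)
      rw [tsum_fintype]
      calc ∑ p : 𝒞 (n + i), Metric.ediam (A (n + i) p) ^ (s : ℝ)
          ≤ ∑ _p : 𝒞 (n + i), ENNReal.ofReal (C * 2 ^ (-(((n + i : ℕ) : ℝ) * b))) ^ (s : ℝ) := by
            refine Finset.sum_le_sum fun p _ => ?_
            exact ENNReal.rpow_le_rpow (h2 p p.2) s.2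
        _ = ENNReal.ofReal ((𝒞 (n + i)).card * (C * 2 ^ (-(((n + i : ℕ) : ℝ) * b))) ^ (s : ℝ)) := by
            rw [Finset.sum_const, nsmul_eq_mul, Finset.card_univ, Fintype.card_coe,
              ENNReal.ofReal_rpow_of_pos (by positivity), ENNReal.ofReal_mul (by positivity),
              ENNReal.ofReal_natCast]
        _ ≤ ENNReal.ofReal (C * 2 ^ (((n + i : ℕ) : ℝ) * a) *
              (C * 2 ^ (-(((n + i : ℕ) : ℝ) * b))) ^ (s : ℝ)) := by
            apply ENNReal.ofReal_le_ofReal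
            gcongr
        _ = ENNReal.ofReal (M * u ^ n * u ^ i) := by
            congr 1
            rw [Real.mul_rpow hC.le (by positivity), ← Real.rpow_mul two_pos.le, mul_assoc M,
              ← pow_add, hu, ← Real.rpow_natCast, ← Real.rpow_mul two_pos.le, hM,
              show (a - s * b) * ((n + i : ℕ) : ℝ) = ((n + i : ℕ) : ℝ) * a +
                -(((n + i : ℕ) : ℝ) * b) * s by ring, Real.rpow_add two_pos]
            ring
        _ = _ := by
            rw [ENNReal.ofReal_mul (by positivity), ENNReal.ofReal_pow hu0.le]
    have hlim : Tendsto (fun n : ℕ => ENNReal.ofReal (M * u ^ n) * (1 - ENNReal.ofReal u)⁻¹) atTop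
        (𝓝 0) := by
      have h1 : Tendsto (fun n : ℕ => ENNReal.ofReal (M * u ^ n)) atTop (𝓝 0) := by
        rw [← ENNReal.ofReal_zero]
        refine (ENNReal.continuous_ofReal.tendsto 0).comp ?_
        rw [← mul_zero M]
        exact (tendsto_pow_atTop_nhds_zero_of_lt_one hu0.le hu1).const_mul _
      have h2 : (1 - ENNReal.ofReal u)⁻¹ ≠ ⊤ := by
        rw [ENNReal.inv_ne_top]
        refine (tsub_pos_of_lt ?_).ne'
        rwa [ENNReal.ofReal_lt_one]
      simpa using ENNReal.Tendsto.mul_const h1 (Or.inr h2)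
    have hzero : liminf (fun n => ∑' q : (Σ i : ℕ, 𝒞 (n + i)),
        Metric.ediam (A (n + q.1) q.2) ^ (s : ℝ)) atTop ≤ 0 := by
      rw [← hlim.liminf_eq]
      exact liminf_le_liminf (eventually_atTop.2 ⟨j₁, hsum⟩)
    rw [hs] at hbound
    exact absurd (hbound.trans hzero) (by simp)
  · refine eventually_atTop.2 ⟨j₁, fun n hn q => ?_⟩
    refine ((hj₁ (n + q.1) (by omega)).2 q.2 q.2.2).trans (ENNReal.ofReal_le_ofReal ?_)
    gcongr
    · exact one_le_two
    · omega
  · refine Eventually.of_forall fun n y hy => ?_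
    obtain ⟨j, hj, p, hp, hyp⟩ := frequently_atTop.1 (hS y hy) n
    obtain ⟨i, rfl⟩ := Nat.exists_eq_add_of_le hj
    exact mem_iUnion.2 ⟨⟨i, p, hp⟩, hyp⟩

/-! ### Counting the balls with a given exponent -/

/-- The generation of the boxes that are compared with the balls of the scale `j`. -/
noncomputable def boxGen (c : ℕ) (ρ : ℝ) (j : ℕ) : ℕ := ⌈(j + 1) * ρ * Real.logb c 2⌉₊ + 1

lemma two_rpow_eq (hc : 2 ≤ c) (u : ℝ) : (2 : ℝ) ^ u = (c : ℝ) ^ (u * Real.logb c 2) := by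
  have hc1 : (1 : ℝ) < c := by exact_mod_cast (by omega : 1 < c)
  rw [mul_comm, Real.rpow_mul (by positivity), Real.rpow_logb (by positivity) hc1.ne' two_pos]

lemma tendsto_boxGen (hc : 2 ≤ c) {ρ : ℝ} (hρ : 0 < ρ) : Tendsto (boxGen c ρ) atTop atTop := by
  have hc1 : (1 : ℝ) < c := by exact_mod_cast (by omega : 1 < c)
  have h1 : Tendsto (fun j : ℕ => ((j : ℝ) + 1) * ρ * Real.logb c 2) atTop atTop :=
    ((tendsto_atTop_add_const_right _ _ tendsto_natCast_atTop_atTop).atTop_mul_const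
      hρ).atTop_mul_const (Real.logb_pos hc1 one_lt_two)
  exact (tendsto_add_atTop_nat 1).comp (tendsto_nat_ceil_atTop.comp h1)

/-- The `+ 1` in `boxGen` gains the factor `2`: a ball of radius `lam n ^ ρ` at scale `j` contains
the whole box of any point of the cube within one side of its centre. -/
lemma two_mul_side_boxGen_le (hc : 2 ≤ c) {ρ : ℝ} (j : ℕ) :
    2 * side c (boxGen c ρ j) ≤ 2 ^ (-((j + 1) * ρ)) := by
  have hc1 : (1 : ℝ) < c := by exact_mod_cast (by omega : 1 < c)
  have hc2 : (2 : ℝ) ≤ c := by exact_mod_cast hc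
  have h1 : side c 1 = (c : ℝ)⁻¹ := by simp [side]
  rw [boxGen, side_add, h1]
  have h2 : side c ⌈(j + 1) * ρ * Real.logb c 2⌉₊ ≤ 2 ^ (-((j + 1) * ρ)) := by
    rw [two_rpow_eq hc, side_eq_rpow]
    apply Real.rpow_le_rpow_of_exponent_le hc1.le
    linarith [Nat.le_ceil ((j + 1) * ρ * Real.logb c 2)]
  have h3 : 2 * (c : ℝ)⁻¹ ≤ 1 := by
    rw [← div_eq_mul_inv]; exact (div_le_one (by positivity)).2 hc2
  have h4 := side_pos hc ⌈(j + 1) * ρ * Real.logb c 2⌉₊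
  nlinarith

lemma two_rpow_le_side_boxGen (hc : 2 ≤ c) {ρ : ℝ} (hρ0 : 0 < ρ) (hρ1 : ρ < 1) (j : ℕ) :
    (2 : ℝ) ^ (-(j * ρ)) ≤ ((2 * c ^ 2 : ℕ) : ℝ) * side c (boxGen c ρ j) := by
  have hc1 : (1 : ℝ) < c := by exact_mod_cast (by omega : 1 < c)
  have hc0 : (0 : ℝ) < c := by positivity
  have hlog := Real.logb_pos hc1 one_lt_two
  have h1 := (Nat.ceil_lt_add_one (a := (j + 1) * ρ * Real.logb c 2) (by positivity)).le
  calc (2 : ℝ) ^ (-(j * ρ)) = 2 ^ ρ * 2 ^ (-((j + 1) * ρ)) := by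
        rw [← Real.rpow_add two_pos]; congr 1; ring
    _ ≤ 2 ^ (1 : ℝ) * 2 ^ (-((j + 1) * ρ)) := by
        gcongr
        exact one_le_two
    _ = 2 * (c : ℝ) ^ (-((j + 1) * ρ) * Real.logb c 2) := by rw [Real.rpow_one, two_rpow_eq hc]
    _ ≤ 2 * (c : ℝ) ^ ((2 : ℝ) + -(boxGen c ρ j : ℝ)) := by
        gcongr
        · exact hc1.le
        · rw [boxGen]; push_cast; linarith
    _ = _ := by
        rw [Real.rpow_add hc0, side_eq_rpow]
        push_cast
        rw [← Real.rpow_natCast (c : ℝ) 2]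
        push_cast; ring

/-- Every point of the closed unit cube is close to points of the half-open cube. -/
lemma exists_mem_cube_dist_le {x : Fin d → ℝ} (hx : x ∈ Icc (0 : Fin d → ℝ) 1) {r : ℝ} (hr : 0 < r)
    (hr1 : r ≤ 1) : ∃ y ∈ cadicBox c 0 (0 : Fin d → ℕ), dist x y ≤ r := by
  refine ⟨fun i => x i * (1 - r), ?_, ?_⟩
  · rw [cadicBox_zero]
    intro i
    have h0 : 0 ≤ x i := hx.1 i
    have h1 : x i ≤ 1 := hx.2 i
    constructor <;> nlinarith
  · rw [dist_pi_le_iff hr.le]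
    intro i
    have h0 : 0 ≤ x i := hx.1 i
    have h1 : x i ≤ 1 := hx.2 i
    rw [Real.dist_eq, abs_le]
    constructor <;> nlinarith

/-- A ball with the exponent `α` has boxes nearby whose masses to the power `q` are bounded below. -/
lemma exists_box_rpow_le (hc : 2 ≤ c) {μ : Measure (Fin d → ℝ)} [IsFiniteMeasure μ]
    (hμ : μ (cadicBox c 0 (0 : Fin d → ℕ))ᶜ = 0)
    (hμpos : ∀ i k, IsIndex c i k → 0 < μ.real (cadicBox c i k)) (M : ℕ) (hM : 1 ≤ M)
    {α q : ℝ} (hα : 0 < α) :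
    ∃ a : ℝ, 0 < a ∧ ∀ (i : ℕ) (e ε r : ℝ) (x : Fin d → ℝ), ∀ y ∈ cadicBox c 0 (0 : Fin d → ℕ),
      dist x y ≤ side c i → 0 < ε → ε ≤ α → |q| * ε ≤ e → 2 * side c i ≤ r → r ≤ M * side c i →
      r ^ (α + ε) ≤ μ.real (Metric.closedBall x r) →
      μ.real (Metric.closedBall x r) ≤ r ^ (α - ε) →
      ∃ k ∈ nearIndices (M + 1) (indexOf c i y), IsIndex c i k ∧
        a * side c i ^ (α * q + e) ≤ μ.real (cadicBox c i k) ^ q := by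
  classical
  have hM' : (1 : ℝ) ≤ M := by exact_mod_cast hM
  -- For `q < 0` the mass of the box must be bounded above, and a box contained in the ball will do.
  -- For `q ≥ 0` it must be bounded below, and the heaviest of the boxes covering the ball will do.
  rcases lt_or_ge q 0 with hq | hq
  · refine ⟨(M : ℝ) ^ (α * q), by positivity, fun i e ε r x y hy hxy hε0 hεα hqε hr1 hr2 _ hup =>
      ⟨indexOf c i y, mem_nearIndices.2 fun l => by
        rw [sub_self, abs_zero]; positivity, isIndex_indexOf hc i hy, ?_⟩⟩
    have hy0 := ((mem_cadicBox_iff hc).1 hy).1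
    have hsi := side_pos hc i
    have hr0 : 0 < r := by linarith
    have hsub : cadicBox c i (indexOf c i y) ⊆ Metric.closedBall x r := by
      intro z hz
      have h1 := dist_le_side hc hz (mem_cadicBox_indexOf hc i hy0)
      have h2 := dist_triangle z y x
      rw [dist_comm y x] at h2
      rw [Metric.mem_closedBall]; linarith
    rw [abs_of_neg hq] at hqε
    calc (M : ℝ) ^ (α * q) * side c i ^ (α * q + e)
        ≤ (M : ℝ) ^ ((α - ε) * q) * side c i ^ ((α - ε) * q) := by
          refine mul_le_mul (Real.rpow_le_rpow_of_exponent_le hM' ?_) ?_ (by positivity)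
            (by positivity)
          · nlinarith
          · exact Real.rpow_le_rpow_of_exponent_ge hsi (side_le_one hc i) (by nlinarith)
      _ = (M * side c i) ^ ((α - ε) * q) := (Real.mul_rpow (by positivity) hsi.le).symm
      _ ≤ r ^ ((α - ε) * q) := Real.rpow_le_rpow_of_nonpos hr0 hr2 (by nlinarith)
      _ = (r ^ (α - ε)) ^ q := Real.rpow_mul hr0.le _ _
      _ ≤ μ.real (cadicBox c i (indexOf c i y)) ^ q :=
          Real.rpow_le_rpow_of_nonpos (hμpos i _ (isIndex_indexOf hc i hy))
            ((measureReal_mono hsub).trans hup) hq.le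
  · set D : ℝ := (((2 * (M + 1) + 1) ^ d : ℕ) : ℝ) with hD
    have hD0 : 0 < D := by rw [hD]; positivity
    refine ⟨D⁻¹ ^ q, by positivity, fun i e ε r x y hy hxy hε0 hεα hqε hr1 hr2 hlow _ => ?_⟩
    have hy0 := ((mem_cadicBox_iff hc).1 hy).1
    have hsi := side_pos hc i
    have hr0 : 0 < r := by linarith
    rw [abs_of_nonneg hq] at hqε
    set 𝒩 := (nearIndices (M + 1) (indexOf c i y)).filter fun k => IsIndex c i k with h𝒩
    have hne : 𝒩.Nonempty := ⟨indexOf c i y, Finset.mem_filter.2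
      ⟨mem_nearIndices.2 fun l => by
        rw [sub_self, abs_zero]; positivity, isIndex_indexOf hc i hy⟩⟩
    have hsub : Metric.closedBall x r ∩ cadicBox c 0 (0 : Fin d → ℕ) ⊆
        ⋃ k ∈ 𝒩, cadicBox c i k := by
      rintro z ⟨hz, hzc⟩
      have hz0 := ((mem_cadicBox_iff hc).1 hzc).1
      simp only [mem_iUnion, exists_prop]
      refine ⟨indexOf c i z, Finset.mem_filter.2 ⟨?_, isIndex_indexOf hc i hzc⟩,
        mem_cadicBox_indexOf hc i hz0⟩
      rw [mem_nearIndices]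
      refine abs_indexOf_sub_le hc hz0 hy0 ?_
      have := dist_triangle z x y
      rw [Metric.mem_closedBall] at hz
      push_cast; linarith
    -- Pigeonhole: the heaviest box has at least the fraction `1 / D` of the mass of the ball.
    obtain ⟨k, hk, hmax⟩ := Finset.exists_max_image 𝒩 (fun k => μ.real (cadicBox c i k)) hne
    obtain ⟨hk1, hk2⟩ := Finset.mem_filter.1 hk
    have hmass : side c i ^ (α + ε) ≤ D * μ.real (cadicBox c i k) := by
      calc side c i ^ (α + ε) ≤ r ^ (α + ε) := by gcongr; linarith
        _ ≤ μ.real (Metric.closedBall x r) := hlow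
        _ = μ.real (Metric.closedBall x r ∩ cadicBox c 0 (0 : Fin d → ℕ)) := by
            rw [Measure.real, Measure.real, measure_inter_conull hμ]
        _ ≤ μ.real (⋃ k ∈ 𝒩, cadicBox c i k) := measureReal_mono hsub (measure_ne_top _ _)
        _ ≤ ∑ k ∈ 𝒩, μ.real (cadicBox c i k) := measureReal_biUnion_finset_le _ _
        _ ≤ 𝒩.card • μ.real (cadicBox c i k) := Finset.sum_le_card_nsmul _ _ _ hmax
        _ ≤ D * μ.real (cadicBox c i k) := by
            rw [nsmul_eq_mul]
            gcongr
            rw [hD]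
            exact_mod_cast (Finset.card_filter_le _ _).trans (card_nearIndices_le (M + 1) _)
    refine ⟨k, hk1, hk2, ?_⟩
    calc D⁻¹ ^ q * side c i ^ (α * q + e) ≤ D⁻¹ ^ q * side c i ^ ((α + ε) * q) := by
          refine mul_le_mul_of_nonneg_left ?_ (by positivity)
          exact Real.rpow_le_rpow_of_exponent_ge hsi (side_le_one hc i) (by linarith)
      _ = (D⁻¹ * side c i ^ (α + ε)) ^ q := by
          rw [Real.mul_rpow (by positivity) (by positivity), Real.rpow_mul hsi.le]
      _ ≤ μ.real (cadicBox c i k) ^ q := by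
          refine Real.rpow_le_rpow (by positivity) ?_ hq
          rw [inv_mul_le_iff₀ hD0]; exact hmass

lemma mem_scaleSet_iff {lam : ℕ → ℝ} {j n : ℕ} :
    n ∈ scaleSet lam j ↔ (2 : ℝ) ^ (-((j : ℝ) + 1)) < lam n ∧ lam n ≤ (2 : ℝ) ^ (-(j : ℝ)) := by
  rw [scaleSet, mem_ofPred_eq, Real.rpow_neg two_pos.le, Real.rpow_neg two_pos.le,
    Real.rpow_natCast, ← Nat.cast_add_one, Real.rpow_natCast]

lemma eventually_scaleSet_ge {lam : ℕ → ℝ} (hlam_pos : ∀ n, 0 < lam n) (hlam_anti : Antitone lam)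
    (n₀ : ℕ) : ∀ᶠ j in atTop, ∀ n ∈ scaleSet lam j, n₀ ≤ n := by
  have h : Tendsto (fun j : ℕ => (2 : ℝ) ^ (-(j : ℝ))) atTop (𝓝 0) :=
    (tendsto_rpow_atBot_of_base_gt_one _ one_lt_two).comp
      (tendsto_neg_atTop_atBot.comp tendsto_natCast_atTop_atTop)
  filter_upwards [h.eventually_lt_const (hlam_pos n₀)] with j hj n hn
  by_contra hlt
  have h1 := hlam_anti (not_le.1 hlt).le
  have h2 := (mem_scaleSet_iff.1 hn).2
  linarith

/-- Markov's inequality for the sum of the `q`-th powers: at most about `side ^ (-(β + η))` boxes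
have a `q`-th power of order at least `side ^ (α * q + η / 2)`, and every selected point is near one
of them. The set `P` consists of the corners of these boxes. -/
theorem exists_cover_scaleSet (hc : 2 ≤ c) {μ : Measure (Fin d → ℝ)} [IsFiniteMeasure μ]
    (hμ : μ (cadicBox c 0 (0 : Fin d → ℕ))ᶜ = 0)
    (hμpos : ∀ i k, IsIndex c i k → 0 < μ.real (cadicBox c i k))
    {ρ α β η : ℝ} (hρ0 : 0 < ρ) (hρ1 : ρ < 1) (hα : 0 < α) (hβ : 0 < β) (hη : 0 < η)
    (hαβ : legendre (tau c μ) α = (β : EReal))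
    {x : ℕ → Fin d → ℝ} (hx : ∀ n, x n ∈ Icc (0 : Fin d → ℝ) 1) {lam ε : ℕ → ℝ}
    (hlam_pos : ∀ n, 0 < lam n) (hlam_anti : Antitone lam)
    (hε0 : ∀ n, 0 < ε n) (hε : Tendsto ε atTop (𝓝 0)) :
    ∃ C : ℝ, 0 < C ∧ ∀ᶠ j : ℕ in atTop, ∃ P : Finset (Fin d → ℝ),
      (P.card : ℝ) ≤ C * 2 ^ (j * (ρ * (β + η))) ∧
      ∀ n ∈ scaleSet lam j, HasBallExponent μ ρ α (x n) (lam n) (ε n) →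
        ∃ p ∈ P, x n ∈ Metric.closedBall p (C * 2 ^ (-(j * ρ))) := by
  classical
  obtain ⟨q, hq⟩ := exists_sum_rpow_le hc (half_pos hη) hαβ
  set M : ℕ := 2 * c ^ 2 with hM
  have hM1 : 1 ≤ M := Nat.succ_le_of_lt (by positivity)
  have hM1' : (1 : ℝ) ≤ M := by exact_mod_cast hM1
  obtain ⟨a, ha0, ha⟩ := exists_box_rpow_le hc hμ hμpos M hM1 (q := q) hα
  set e := η / 2 with he
  have he0 : 0 < e := half_pos hη
  have hε1 : ∀ᶠ n in atTop, ε n ≤ α ∧ |q| * ε n ≤ e := by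
    have h1 : Tendsto (fun n => |q| * ε n) atTop (𝓝 (|q| * 0)) := hε.const_mul _
    rw [mul_zero] at h1
    exact (hε.eventually_le_const hα).and (h1.eventually_le_const he0)
  obtain ⟨n₀, hn₀⟩ := eventually_atTop.1 hε1
  refine ⟨max (a⁻¹ * (M : ℝ) ^ (β + η)) (M + 3), by positivity, ?_⟩
  filter_upwards [(tendsto_boxGen hc hρ0).eventually hq,
    eventually_scaleSet_ge hlam_pos hlam_anti n₀] with j hsum hge
  set i := boxGen c ρ j with hi
  have hsi := side_pos hc i
  have hlow := two_mul_side_boxGen_le hc (ρ := ρ) j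
  have hup := two_rpow_le_side_boxGen hc hρ0 hρ1 j
  have hcp : (0 : ℝ) < (c : ℝ) ^ i := by positivity
  set 𝒦 := (indices d c i).filter fun k =>
    a * side c i ^ (α * q + e) ≤ μ.real (cadicBox c i k) ^ q with h𝒦
  refine ⟨𝒦.image fun k l => (k l : ℝ) / (c : ℝ) ^ i, ?_, ?_⟩
  · have h1 : (𝒦.card : ℝ) * (a * side c i ^ (α * q + e)) ≤ side c i ^ (α * q - β - e) := by
      calc (𝒦.card : ℝ) * (a * side c i ^ (α * q + e)) = ∑ _k ∈ 𝒦, a * side c i ^ (α * q + e) := by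
            rw [Finset.sum_const, nsmul_eq_mul]
        _ ≤ ∑ k ∈ 𝒦, μ.real (cadicBox c i k) ^ q :=
            Finset.sum_le_sum fun k hk => (Finset.mem_filter.1 hk).2
        _ ≤ ∑ k ∈ indices d c i, μ.real (cadicBox c i k) ^ q :=
            Finset.sum_le_sum_of_subset_of_nonneg (Finset.filter_subset _ _)
              fun k _ _ => Real.rpow_nonneg measureReal_nonneg _
        _ ≤ _ := hsum
    have h2 : (𝒦.card : ℝ) ≤ a⁻¹ * side c i ^ (-(β + η)) := by
      have h3 : side c i ^ (α * q - β - e) = side c i ^ (-(β + η)) * side c i ^ (α * q + e) := by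
        rw [← Real.rpow_add hsi]; congr 1; rw [he]; ring
      rw [h3, ← mul_assoc] at h1
      have h4 := le_of_mul_le_mul_right h1 (by positivity)
      rwa [← div_eq_inv_mul, le_div_iff₀ ha0]
    calc (((𝒦.image fun k l => (k l : ℝ) / (c : ℝ) ^ i).card : ℕ) : ℝ) ≤ 𝒦.card := by
          exact_mod_cast Finset.card_image_le
      _ ≤ a⁻¹ * side c i ^ (-(β + η)) := h2
      _ ≤ a⁻¹ * ((2 : ℝ) ^ (-(j * ρ)) / M) ^ (-(β + η)) := by
          refine mul_le_mul_of_nonneg_left ?_ (by positivity)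
          refine Real.rpow_le_rpow_of_nonpos (by positivity) ?_ (by linarith)
          rw [div_le_iff₀' (by positivity)]; exact hup
      _ = a⁻¹ * (M : ℝ) ^ (β + η) * 2 ^ (j * (ρ * (β + η))) := by
          rw [Real.div_rpow (by positivity) (by positivity), ← Real.rpow_mul two_pos.le,
            Real.rpow_neg (by positivity : (0 : ℝ) ≤ M), div_inv_eq_mul,
            show -(j * ρ) * -(β + η) = j * (ρ * (β + η)) by ring]
          ring
      _ ≤ _ := by gcongr; exact le_max_left _ _
  · intro n hn hexp
    obtain ⟨hn1, hn2⟩ := mem_scaleSet_iff.1 hn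
    obtain ⟨hεα, hqε⟩ := hn₀ n (hge n hn)
    have hl0 := hlam_pos n
    have hr1 : (2 : ℝ) ^ (-(((j : ℝ) + 1) * ρ)) ≤ lam n ^ ρ := by
      rw [← neg_mul, Real.rpow_mul two_pos.le]
      exact Real.rpow_le_rpow (by positivity) hn1.le hρ0.le
    have hr2 : lam n ^ ρ ≤ (2 : ℝ) ^ (-(j * ρ)) := by
      rw [← neg_mul, Real.rpow_mul two_pos.le]
      exact Real.rpow_le_rpow hl0.le hn2 hρ0.le
    obtain ⟨y, hy, hxy⟩ := exists_mem_cube_dist_le (c := c) (hx n) hsi (side_le_one hc i)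
    obtain ⟨h1, h2⟩ := hexp
    rw [Real.rpow_mul hl0.le] at h1 h2
    obtain ⟨k, hknear, hkidx, hk⟩ := ha i e (ε n) (lam n ^ ρ) (x n) y hy hxy (hε0 n) hεα hqε
      (hlow.trans hr1) (hr2.trans hup) h1 h2
    refine ⟨_, Finset.mem_image_of_mem _ (Finset.mem_filter.2 ⟨mem_indices.2 hkidx, hk⟩), ?_⟩
    have hy0 := ((mem_cadicBox_iff hc).1 hy).1
    have hdist : dist y (fun l => (k l : ℝ) / (c : ℝ) ^ i) ≤ (M + 2) * side c i := by
      rw [dist_pi_le_iff (by positivity)]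
      intro l
      have h3 := mem_cadicBox_indexOf hc i hy0 l
      have h4 := mem_nearIndices.1 hknear l
      have h5 : |(k l : ℝ) - indexOf c i y l| ≤ M + 1 := by exact_mod_cast h4
      rw [div_le_iff₀ hcp, lt_div_iff₀ hcp] at h3
      rw [abs_le] at h5
      rw [Real.dist_eq, abs_le, side, ← div_eq_mul_inv, ← neg_div, div_le_iff₀ hcp,
        le_div_iff₀ hcp, sub_mul, div_mul_cancel₀ _ hcp.ne']
      constructor <;> linarith [h3.1, h3.2, h5.1, h5.2]
    rw [Metric.mem_closedBall]
    have h6 : side c i ≤ (2 : ℝ) ^ (-(j * ρ)) := by linarith [hlow.trans (hr1.trans hr2)]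
    calc dist (x n) (fun l => (k l : ℝ) / (c : ℝ) ^ i) ≤ (M + 3) * side c i := by
          linarith [dist_triangle (x n) y (fun l => (k l : ℝ) / (c : ℝ) ^ i)]
      _ ≤ max (a⁻¹ * (M : ℝ) ^ (β + η)) (M + 3) * 2 ^ (-(j * ρ)) := by
          gcongr
          exact le_max_right _ _

/-! ### The upper bound -/

lemma frequently_mem_of_mem_condLimsupSet {μ : Measure (Fin d → ℝ)} {x : ℕ → Fin d → ℝ}
    {lam ε : ℕ → ℝ} {ρ δ α : ℝ} (hlam_pos : ∀ n, 0 < lam n) (hlam_lim : Tendsto lam atTop (𝓝 0))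
    {y : Fin d → ℝ} (hy : y ∈ condLimsupSet μ x lam ρ δ α ε) :
    ∃ᶠ j in atTop, ∃ n ∈ scaleSet lam j, HasBallExponent μ ρ α (x n) (lam n) (ε n) ∧
      y ∈ Metric.closedBall (x n) (lam n ^ δ) := by
  refine frequently_atTop.2 fun J => ?_
  have hpos : (0 : ℝ) < (1 / 2) ^ (J + 1) := by positivity
  obtain ⟨N, hN⟩ := eventually_atTop.1 (hlam_lim.eventually_lt_const hpos)
  have h1 := mem_iInter.1 hy N
  simp only [mem_iUnion, exists_prop] at h1
  obtain ⟨n, ⟨hn, hexp⟩, hyn⟩ := h1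
  have hlt := hN n hn
  obtain ⟨j, hj1, hj2⟩ := exists_nat_pow_near_of_lt_one (hlam_pos n)
    (hlt.le.trans (pow_le_one₀ (by norm_num) (by norm_num))) (y := (1 / 2 : ℝ)) (by norm_num)
    (by norm_num)
  have hJ : J + 1 < j + 1 :=
    (pow_lt_pow_iff_right_of_lt_one₀ (by norm_num) (by norm_num)).1 (hj1.trans hlt)
  refine ⟨j, by omega, n, ⟨?_, ?_⟩, hexp, hyn⟩
  · simpa [one_div] using hj1
  · simpa [one_div] using hj2

lemma ediam_closedBall_le_ofReal (p : Fin d → ℝ) {r R : ℝ} (h : 2 * r ≤ R) :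
    Metric.ediam (Metric.closedBall p r) ≤ ENNReal.ofReal R := by
  refine Metric.ediam_le fun u hu v hv => ?_
  rw [edist_dist]
  apply ENNReal.ofReal_le_ofReal
  rw [Metric.mem_closedBall] at hu hv
  linarith [dist_triangle_right u v p]

section Upper

variable {μ : Measure (Fin d → ℝ)} {ρ α β δ η : ℝ} {x : ℕ → Fin d → ℝ}
  {lam ε : ℕ → ℝ}

/-- Since `δ ≥ 1 > ρ`, the balls of radius `lam n ^ δ` are absorbed by the covering balls of radius
`2 ^ (-j ρ)` once the constant `C` is raised to `C + 1`. -/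
theorem dimH_condLimsupSet_le (hρ0 : 0 < ρ) (hρ1 : ρ < 1) (hβ : 0 < β) (hη : 0 < η)
    (hδ : 1 ≤ δ) (hlam_pos : ∀ n, 0 < lam n) (hlam_lim : Tendsto lam atTop (𝓝 0))
    (hcover : ∃ C : ℝ, 0 < C ∧ ∀ᶠ j : ℕ in atTop, ∃ P : Finset (Fin d → ℝ),
      (P.card : ℝ) ≤ C * 2 ^ (j * (ρ * (β + η))) ∧
      ∀ n ∈ scaleSet lam j, HasBallExponent μ ρ α (x n) (lam n) (ε n) →
        ∃ p ∈ P, x n ∈ Metric.closedBall p (C * 2 ^ (-(j * ρ)))) :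
    dimH (condLimsupSet μ x lam ρ δ α ε) ≤ ENNReal.ofReal (β + η) := by
  obtain ⟨C, hC, hP⟩ := hcover
  obtain ⟨j₀, hj₀⟩ := eventually_atTop.1 hP
  choose! P hPcard hPcov using hj₀
  have hmain := dimH_le_of_covers P
    (fun j p => Metric.closedBall p ((C + 1) * 2 ^ (-(j * ρ)))) (a := ρ * (β + η)) (b := ρ)
    (C := 2 * (C + 1)) (by positivity) hρ0 (by positivity) ?_ ?_
    (S := condLimsupSet μ x lam ρ δ α ε) ?_
  · rwa [mul_div_cancel_left₀ _ hρ0.ne'] at hmain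
  · filter_upwards [eventually_ge_atTop j₀] with j hj
    refine (hPcard j hj).trans ?_
    gcongr
    linarith
  · refine Eventually.of_forall fun j p _ => ediam_closedBall_le_ofReal p ?_
    rw [mul_assoc]
  · intro y hy
    refine ((frequently_mem_of_mem_condLimsupSet hlam_pos hlam_lim hy).and_eventually
      (eventually_ge_atTop j₀)).mono ?_
    rintro j ⟨⟨n, hn, hexp, hyn⟩, hj⟩
    obtain ⟨p, hp, hxp⟩ := hPcov j hj n hn hexp
    refine ⟨p, hp, ?_⟩
    obtain ⟨-, hn2⟩ := mem_scaleSet_iff.1 hn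
    have hl0 := hlam_pos n
    have hl1 : lam n ≤ 1 := hn2.trans
      (Real.rpow_le_one_of_one_le_of_nonpos one_le_two (neg_nonpos.2 (by positivity)))
    have h1 : lam n ^ δ ≤ 2 ^ (-(j * ρ)) := by
      calc lam n ^ δ ≤ lam n ^ ρ := Real.rpow_le_rpow_of_exponent_ge hl0 hl1 (by linarith)
        _ ≤ ((2 : ℝ) ^ (-(j : ℝ))) ^ ρ := by gcongr
        _ = _ := by rw [← Real.rpow_mul two_pos.le, neg_mul]
    rw [Metric.mem_closedBall] at hxp hyn ⊢
    linarith [dist_triangle y (x n) p]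

lemma eventually_natCast_le_two_rpow {N : ℕ → ℕ}
    (hN : Tendsto (fun j : ℕ => Real.log (N j) / (j : ℝ)) atTop (𝓝 0)) (hη : 0 < η) :
    ∀ᶠ j in atTop, (N j : ℝ) ≤ 2 ^ (j * η) := by
  have hpos : 0 < η * Real.log 2 := mul_pos hη (Real.log_pos one_lt_two)
  filter_upwards [hN.eventually_le_const hpos, eventually_gt_atTop 0] with j hj hj0
  have hj0' : (0 : ℝ) < j := by exact_mod_cast hj0
  rcases Nat.eq_zero_or_pos (N j) with h0 | h0
  · rw [h0, Nat.cast_zero]; positivity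
  · have h0' : (0 : ℝ) < N j := by exact_mod_cast h0
    rw [← Real.log_le_log_iff h0' (by positivity), Real.log_rpow two_pos]
    rw [div_le_iff₀ hj0'] at hj
    linarith

/-- The limsup set is covered by its own balls. Their number at scale `j` is at most the number of
covering places, times the `N j` families, times the number of disjoint balls of radius `2 ^ (-(j +
1))` centred in one place. The second `η` accounts for the subexponential `N j`. -/
theorem dimH_condLimsupSet_le_div (hρ0 : 0 < ρ) (hρ1 : ρ < 1) (hβ : 0 < β) (hη : 0 < η)
    (hδ : 1 ≤ δ) (hlam_pos : ∀ n, 0 < lam n) (hlam_lim : Tendsto lam atTop (𝓝 0))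
    (hred : IsWeaklyRedundant x lam)
    (hcover : ∃ C : ℝ, 0 < C ∧ ∀ᶠ j : ℕ in atTop, ∃ P : Finset (Fin d → ℝ),
      (P.card : ℝ) ≤ C * 2 ^ (j * (ρ * (β + η))) ∧
      ∀ n ∈ scaleSet lam j, HasBallExponent μ ρ α (x n) (lam n) (ε n) →
        ∃ p ∈ P, x n ∈ Metric.closedBall p (C * 2 ^ (-(j * ρ)))) :
    dimH (condLimsupSet μ x lam ρ δ α ε) ≤
      ENNReal.ofReal ((d * (1 - ρ) + ρ * (β + η) + η) / δ) := by
  classical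
  obtain ⟨C, hC, hP⟩ := hcover
  obtain ⟨N, hN, hT⟩ := hred
  have hfin : ∀ j, (scaleSet lam j).Finite := by
    intro j
    have h1 : ∀ᶠ n in atTop, lam n < ((2 : ℝ) ^ (j + 1))⁻¹ :=
      hlam_lim.eventually_lt_const (by positivity)
    obtain ⟨n₀, hn₀⟩ := eventually_atTop.1 h1
    refine (Set.finite_Iio n₀).subset fun n hn => ?_
    by_contra hle
    exact lt_asymm (hn₀ n (not_lt.1 hle)) hn.1
  set 𝒯 : ℕ → Finset ℕ := fun j => (hfin j).toFinset.filter fun n =>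
    HasBallExponent μ ρ α (x n) (lam n) (ε n) with h𝒯
  have h1ρ : 0 ≤ (d : ℝ) * (1 - ρ) := mul_nonneg (by positivity) (by linarith)
  refine dimH_le_of_covers 𝒯 (fun j n => Metric.closedBall (x n) (lam n ^ δ))
    (a := d * (1 - ρ) + ρ * (β + η) + η) (b := δ) (C := max (C * (2 * C + 1) ^ d) 2)
    (by positivity) (by linarith) (by positivity) ?_ ?_ ?_
  · filter_upwards [hP, eventually_natCast_le_two_rpow hN hη, eventually_ge_atTop 1]
      with j ⟨P, hPcard, hPcov⟩ hNj hj1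
    obtain ⟨T, hTU, -, hTdisj⟩ := hT j hj1
    have hj0 : (0 : ℝ) ≤ j := by positivity
    set r : ℝ := 2 ^ (-((j : ℝ) + 1)) with hr
    have hr0 : 0 < r := by positivity
    set R : ℝ := C * 2 ^ (-(j * ρ)) with hR
    have hratio : ((R + r) / r) ^ d ≤ (2 * C + 1) ^ d * 2 ^ (j * (d * (1 - ρ))) := by
      have h2 : (R + r) / r ≤ (2 * C + 1) * 2 ^ (j * (1 - ρ)) := by
        have h3 : R / r = 2 * C * 2 ^ (j * (1 - ρ)) := by
          rw [hR, hr, mul_div_assoc, ← Real.rpow_sub two_pos,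
            show -(j * ρ) - -((j : ℝ) + 1) = 1 + j * (1 - ρ) by ring, Real.rpow_add two_pos,
            Real.rpow_one]
          ring
        have h4 : (1 : ℝ) ≤ 2 ^ (j * (1 - ρ)) :=
          Real.one_le_rpow one_le_two (mul_nonneg hj0 (by linarith))
        rw [add_div, div_self hr0.ne', h3]
        linarith
      calc ((R + r) / r) ^ d ≤ ((2 * C + 1) * 2 ^ (j * (1 - ρ))) ^ d := by gcongr
        _ = _ := by
          rw [mul_pow, ← Real.rpow_natCast ((2 : ℝ) ^ (j * (1 - ρ))), ← Real.rpow_mul two_pos.le]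
          congr 2; ring
    have hpiece : ∀ (l : Fin (N j)) (p : Fin d → ℝ),
        ((((𝒯 j).filter fun n => n ∈ T l ∧ x n ∈ Metric.closedBall p R).card : ℕ) : ℝ) ≤
          (2 * C + 1) ^ d * 2 ^ (j * (d * (1 - ρ))) := by
      intro l p
      refine (card_le_of_pairwiseDisjoint_closedBall _ x hr0 (by positivity) p ?_
        fun n hn => (Finset.mem_filter.1 hn).2.2).trans hratio
      intro n hn n' hn' hne
      obtain ⟨hn1, hn2⟩ := Finset.mem_filter.1 (Finset.mem_coe.1 hn)
      obtain ⟨hn1', hn2'⟩ := Finset.mem_filter.1 (Finset.mem_coe.1 hn')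
      have hs : ∀ n ∈ 𝒯 j, r ≤ lam n := fun n hn =>
        (mem_scaleSet_iff.1 ((hfin j).mem_toFinset.1 (Finset.mem_filter.1 hn).1)).1.le
      exact (hTdisj l hn2.1 hn2'.1 hne).mono
        (Metric.closedBall_subset_closedBall (hs n hn1))
        (Metric.closedBall_subset_closedBall (hs n' hn1'))
    have hsub : 𝒯 j ⊆ (Finset.univ ×ˢ P).biUnion fun q : Fin (N j) × (Fin d → ℝ) =>
        (𝒯 j).filter fun n => n ∈ T q.1 ∧ x n ∈ Metric.closedBall q.2 R := by
      intro n hn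
      obtain ⟨hn1, hn2⟩ := Finset.mem_filter.1 hn
      have hns := (hfin j).mem_toFinset.1 hn1
      obtain ⟨p, hp, hxp⟩ := hPcov n hns hn2
      have hnT : n ∈ ⋃ i, T i := by rw [hTU]; exact hns
      obtain ⟨l, hl⟩ := mem_iUnion.1 hnT
      exact Finset.mem_biUnion.2 ⟨(l, p), Finset.mem_product.2 ⟨Finset.mem_univ _, hp⟩,
        Finset.mem_filter.2 ⟨hn, hl, hxp⟩⟩
    calc ((𝒯 j).card : ℝ) ≤ ∑ q ∈ Finset.univ ×ˢ P, ((((𝒯 j).filter fun n => n ∈ T q.1 ∧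
            x n ∈ Metric.closedBall q.2 R).card : ℕ) : ℝ) := by
          exact_mod_cast (Finset.card_le_card hsub).trans Finset.card_biUnion_le
      _ ≤ ∑ _q ∈ (Finset.univ : Finset (Fin (N j))) ×ˢ P,
            (2 * C + 1) ^ d * (2 : ℝ) ^ (j * (d * (1 - ρ))) :=
          Finset.sum_le_sum fun q _ => hpiece q.1 q.2
      _ = N j * P.card * ((2 * C + 1) ^ d * (2 : ℝ) ^ (j * (d * (1 - ρ)))) := by
          rw [Finset.sum_const, nsmul_eq_mul, Finset.card_product, Finset.card_univ,
            Fintype.card_fin, Nat.cast_mul]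
      _ ≤ 2 ^ (j * η) * (C * 2 ^ (j * (ρ * (β + η)))) *
            ((2 * C + 1) ^ d * (2 : ℝ) ^ (j * (d * (1 - ρ)))) := by gcongr
      _ = C * (2 * C + 1) ^ d * 2 ^ (j * (d * (1 - ρ) + ρ * (β + η) + η)) := by
          rw [mul_add (j : ℝ), mul_add (j : ℝ), Real.rpow_add two_pos, Real.rpow_add two_pos]
          ring
      _ ≤ _ := by gcongr; exact le_max_left _ _
  · refine Eventually.of_forall fun j n hn => ?_
    have hns := (hfin j).mem_toFinset.1 (Finset.mem_filter.1 hn).1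
    have hl0 := hlam_pos n
    refine ediam_closedBall_le_ofReal _ ?_
    refine mul_le_mul (le_max_right _ _) ?_ (by positivity) (by positivity)
    rw [← neg_mul, Real.rpow_mul two_pos.le]
    exact Real.rpow_le_rpow hl0.le (mem_scaleSet_iff.1 hns).2 (by linarith)
  · intro y hy
    refine (frequently_mem_of_mem_condLimsupSet hlam_pos hlam_lim hy).mono ?_
    rintro j ⟨n, hn, hexp, hyn⟩
    exact ⟨n, Finset.mem_filter.2 ⟨(hfin j).mem_toFinset.2 hn, hexp⟩, hyn⟩

end Upper

lemma le_ofReal_of_forall_pos {a : ℝ≥0∞} {f : ℝ → ℝ} (hf : Continuous f)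
    (h : ∀ η > 0, a ≤ ENNReal.ofReal (f η)) : a ≤ ENNReal.ofReal (f 0) := by
  have h1 : Tendsto (fun η => ENNReal.ofReal (f η)) (𝓝[>] 0) (𝓝 (ENNReal.ofReal (f 0))) :=
    ((ENNReal.continuous_ofReal.comp hf).tendsto 0).mono_left nhdsWithin_le_nhds
  exact ge_of_tendsto h1 (eventually_mem_nhdsWithin.mono fun η hη => h η hη)

end HetUbiquity

/-! ### Conclusion: both bounds with a common error sequence -/

open HetUbiquity in
theorem mainTheorem5 {d : ℕ} (hd : 1 ≤ d) (c : ℕ) (hc : 2 ≤ c)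
    (μ : Measure (Fin d → ℝ)) (hμ : HetUbiquity.IsMultinomial μ)
    (x : ℕ → Fin d → ℝ) (hx : ∀ n, x n ∈ Icc (0 : Fin d → ℝ) 1)
    (lam : ℕ → ℝ) (hlam_pos : ∀ n, 0 < lam n) (hlam_anti : Antitone lam)
    (hlam_lim : Tendsto lam atTop (𝓝 0))
    (ρ : ℝ) (hρ : ρ ∈ Ioo (0 : ℝ) 1) (α β : ℝ) (hα : 0 < α) (hβ : 0 < β)
    (hαβ : HetUbiquity.legendre (HetUbiquity.tau c μ) α = (β : EReal))
    (hred : HetUbiquity.IsWeaklyRedundant x lam)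
    (hsys : HetUbiquity.IsHeterogeneousUbiquitous c x lam ρ μ α β) :
    ∃ ε : ℕ → ℝ, (∀ n, 0 < ε n) ∧ Tendsto ε atTop (𝓝 0) ∧
      ∀ δ : ℝ, 1 ≤ δ →
        dimH (HetUbiquity.condLimsupSet μ x lam ρ δ α ε) =
          ENNReal.ofReal (min (((d : ℝ) * (1 - ρ) + ρ * β) / δ) β) := by
  obtain ⟨hμ1, hμ0⟩ := hμ.measure_compl_cube (c := c)
  have : IsFiniteMeasure μ := ⟨by rw [hμ1]; exact ENNReal.one_lt_top⟩
  obtain ⟨φ, ψ, χ, m, mL, hφψ, -, -, hφχ, hmany, hexp, -, h3, h4⟩ := hsys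
  have hβd := le_of_legendre_eq hc hαβ
  obtain ⟨ε, hε0, hεlim, hε⟩ := exists_error_sequence hc hμ0 hρ.1 hα hφψ.right hφχ.correction x
    hlam_pos hlam_lim
  refine ⟨ε, hε0, hεlim, fun δ hδ => le_antisymm ?_ ?_⟩
  · have hcover := fun η (hη : 0 < η) => exists_cover_scaleSet hc hμ0
      (fun i k hk => hμ.measure_cadicBox_pos hc hk) hρ.1 hρ.2 hα hβ hη hαβ hx hlam_pos hlam_anti
      hε0 hεlim
    have h1 := le_ofReal_of_forall_pos (f := fun η => (d * (1 - ρ) + ρ * (β + η) + η) / δ)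
      (by fun_prop) fun η hη => dimH_condLimsupSet_le_div (δ := δ) hρ.1 hρ.2 hβ hη hδ hlam_pos
        hlam_lim hred (hcover η hη)
    have h2 := le_ofReal_of_forall_pos (f := fun η => β + η) (by fun_prop) fun η hη =>
      dimH_condLimsupSet_le (δ := δ) hρ.1 hρ.2 hβ hη hδ hlam_pos hlam_lim (hcover η hη)
    simp only [add_zero] at h1 h2
    rw [ENNReal.ofReal_mono.map_min]
    exact le_min h1 h2
  · refine le_of_forall_lt fun a ha => ?_
    have hafin : a ≠ ⊤ := (ha.trans ENNReal.ofReal_lt_top).ne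
    rw [← ENNReal.ofReal_toReal hafin] at ha ⊢
    -- Choosing `s` strictly above `a.toReal` makes it positive even when `a = 0`, as the lower
    -- bound requires.
    have hpos := ENNReal.ofReal_pos.1 (lt_of_le_of_lt zero_le ha)
    obtain ⟨s, hs1, hs2⟩ := exists_between ((ENNReal.ofReal_lt_ofReal_iff hpos).1 ha)
    have hs0 : 0 < s := lt_of_le_of_lt ENNReal.toReal_nonneg hs1
    rw [lt_min_iff] at hs2
    refine lt_of_lt_of_le ((ENNReal.ofReal_lt_ofReal_iff hs0).2 hs1) ?_
    exact le_dimH_condLimsupSet hc hρ.1 hρ.2 hβd hδ hφψ.left hφχ.correction hlam_pos hlam_anti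
      hmany hexp (fun J K hK => ⟨(h3 J K hK).1, (h3 J K hK).2.1, (h3 J K hK).2.2.2⟩) h4 hε hs0
      hs2.1 hs2.2
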